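/- Let $d\ge 1$, $k\ge 1$. For $S\subseteq\mathbb{R}^d$ write $\|f\|_{C^k(S)}=\sup_{n\le k}\sup_{x\in S}\|D^nf(x)\|$, with $D^nf(x)$ the $n$-th Fréchet derivative and $\|\cdot\|$ the operator norm of multilinear maps for the Euclidean norm. For $L_1>1$, $L_2>0$ let $\mathcal{D}_k(L_1,L_2)$ be the set of probability measures on $[0,1]^d$ that have a Lebesgue density $q\in C^k([0,1]^d)$ with $\|q\|_{C^k([0,1]^d)}\le L_1$ and $\inf_{x\in[0,1]^d}q(x)\ge L_2$. Let $\sigma_2(x)=\max\{0,x\}^2$, applied coordinatewise. For $L\ge 2$, let $\Phi^{d_1,d_2}(L,W,S,B)$ be the set of functions $\mathbb{R}^{d_1}\to\mathbb{R}^{d_2}$ of the form $$\big(W^{(L)}\sigma_2(\cdot)+b^{(L)}\big)\circ\cdots\circ\big(W^{(2)}\sigma_2(\cdot)+b^{(2)}\big)\circ\big(W^{(1)}(\cdot)+b^{(1)}\big),$$ where $W^{(1)}\in\mathbb{R}^{W\times d_1}$, $W^{(l)}\in\mathbb{R}^{W\times W}$ for $1<l<L$, $W^{(L)}\in\mathbb{R}^{d_2\times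 W}$, $b^{(l)}\in\mathbb{R}^W$ for $l<L$, $b^{(L)}\in\mathbb{R}^{d_2}$, the total number of nonzero entries of all $W^{(l)}$, $b^{(l)}$ is at most $S$, and all these entries are at most $B$ in absolute value. For $g:\mathbb{R}^{d}\times\mathbb{R}\to\mathbb{R}^d$ let $X_g(x,\cdot)$ denote the solution of $\frac{d}{dt}X_g(x,t)=g(X_g(x,t),t)$, $X_g(x,0)=x$. For $p\in[1,\infty)$ let $W_p(\mu,\nu)=\big(\inf_\gamma\int|x-y|^p\,d\gamma(x,y)\big)^{1/p}$, where $\gamma$ ranges over the couplings of $\mu$ and $\nu$ and $|\cdot|$ is the Euclidean norm, and let $W_\infty(\mu,\nu)=\inf_\gamma\operatorname{ess\,sup}_{\gamma}|x-y|$. Then there is a constant $C_{d,k}$ depending only on $d,k$, and for all $L_1>1$, $L_2>0$ there are constants $C'=C'_{d,k,L_1,L_2}$ and $C=C_{d,k,L_1,L_2}$ depending only on $d,k,L_1,L_2$, such that for all $\rho,\pi\in\mathcal{D}_k(L_1,L_2)$ and every $\varepsilon\in(0,1]$ there are $L,W,S\in\mathbb{N}$, $B\in\mathbb{R}$ and $g\in\Phi^{d+1,d}(L,W,S,B)$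 with $$L\le C_{d,k},\qquad W\le C'\varepsilon^{-\frac{d+1}{k}},\qquad S\le C'\varepsilon^{-\frac{d+1}{k}},\qquad B\le C'\varepsilon^{-\frac1k},$$ such that for every $x\in[0,1]^d$ the initial value problem for $X_g(x,\cdot)$ has a solution on $[0,1]$ (necessarily unique, since $g$ is locally Lipschitz), the map $x\mapsto X_g(x,1)$ is $\pi$-measurable, and for every $p\in[1,\infty]$ $$W_p\big(\rho,X_g(\cdot,1)_\sharp\pi\big)\le C\varepsilon.$$ -/

import Mathlib

open MeasureTheory Set
open scoped ENNReal

noncomputable section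

/-! ### Densities on the unit cube -/

/-- The closed unit cube `[0,1]^d` in Euclidean space. -/
def unitCube (d : ℕ) : Set (EuclideanSpace ℝ (Fin d)) :=
  {x | ∀ i, x i ∈ Icc (0 : ℝ) 1}

/-- The norm `‖f‖_{C^k(S)} = sup_{n ≤ k} sup_{x ∈ S} ‖D^n f(x)‖`, where `D^n f(x)` is the `n`-th
Fréchet derivative (within `S`) and `‖·‖` is the operator norm of multilinear maps. -/
def ckNormOn {E F : Type*} [NormedAddCommGroup E] [NormedSpace ℝ E] [NormedAddCommGroup F]
    [NormedSpace ℝ F] (k : ℕ) (f : E → F) (S : Set E) : ℝ≥0∞ :=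
  ⨆ (n : ℕ) (_ : n ≤ k) (x : E) (_ : x ∈ S), ‖iteratedFDerivWithin ℝ n f S x‖ₑ

/-- The measure on `ℝ^d` with Lebesgue density `q` on the unit cube and density `0` outside. -/
def cubeMeasure {d : ℕ} (q : EuclideanSpace ℝ (Fin d) → ℝ) :
    Measure (EuclideanSpace ℝ (Fin d)) :=
  (volume.restrict (unitCube d)).withDensity (fun x => ENNReal.ofReal (q x))

/-- `q` is a probability density on `[0,1]^d` of class `C^k` up to the boundary, with
`‖q‖_{C^k} ≤ L₁` and `q ≥ L₂`. -/
structure IsCubeDensity {d : ℕ} (k : ℕ) (L₁ L₂ : ℝ) (q : EuclideanSpace ℝ (Fin d) → ℝ) :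
    Prop where
  contDiffOn : ContDiffOn ℝ k q (unitCube d)
  norm_le : ckNormOn k q (unitCube d) ≤ ENNReal.ofReal L₁
  lower_bound : ∀ x ∈ unitCube d, L₂ ≤ q x
  isProbabilityMeasure : IsProbabilityMeasure (cubeMeasure q)

/-! ### The Wasserstein distance of order `p ∈ [1, ∞]` -/

/-- `γ` is a coupling of `μ` and `ν`. -/
def IsCoupling {E : Type*} [MeasurableSpace E] (μ ν : Measure E) (γ : Measure (E × E)) : Prop :=
  γ.map Prod.fst = μ ∧ γ.map Prod.snd = ν

/-- The Wasserstein distance of order `p`: the infimum over all couplings `γ` of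
`(∫ |x - y|^p dγ(x,y))^{1/p}`, and of the `γ`-essential supremum of `|x - y|` if `p = ∞`. -/
def wasserstein {E : Type*} [NormedAddCommGroup E] [MeasurableSpace E] (p : ℝ≥0∞)
    (μ ν : Measure E) : ℝ≥0∞ :=
  ⨅ (γ : Measure (E × E)) (_ : IsCoupling μ ν γ), eLpNorm (fun z : E × E => z.1 - z.2) p γ

/-! ### ReLU² networks -/

/-- The activation `σ₂(x) = max{0,x}²`, applied to each coordinate. -/
def reluSq {n : ℕ} (v : Fin n → ℝ) : Fin n → ℝ := fun i => max 0 (v i) ^ 2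

/-- An affine layer `ℝ^m → ℝ^n`. -/
structure AffineLayer (m n : ℕ) where
  weight : Matrix (Fin n) (Fin m) ℝ
  bias : Fin n → ℝ

namespace AffineLayer

variable {m n : ℕ}

/-- The affine map `v ↦ A v + b`. -/
def apply (A : AffineLayer m n) (v : Fin m → ℝ) : Fin n → ℝ :=
  A.weight.mulVec v + A.bias

/-- The number `‖A‖₀ + ‖b‖₀` of nonzero parameters. -/
def nnz (A : AffineLayer m n) : ℕ :=
  {ij : Fin n × Fin m | A.weight ij.1 ij.2 ≠ 0}.ncard + {i : Fin n | A.bias i ≠ 0}.ncard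

/-- All entries of the weight matrix and of the bias are at most `B` in absolute value. -/
def BoundedBy (A : AffineLayer m n) (B : ℝ) : Prop :=
  (∀ i j, |A.weight i j| ≤ B) ∧ ∀ i, |A.bias i| ≤ B

end AffineLayer

/-- The parameters of a ReLU² network with input dimension `d₁`, output dimension `d₂` and
width `W`: the first layer, the list of intermediate layers, and the last layer. -/
structure ReLUSqNet (d₁ d₂ W : ℕ) where
  first : AffineLayer d₁ W
  mid : List (AffineLayer W W)
  last : AffineLayer W d₂

namespace ReLUSqNet

variable {d₁ d₂ W : ℕ}

/-- The number of affine layers. -/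
def depth (N : ReLUSqNet d₁ d₂ W) : ℕ := N.mid.length + 2

/-- The number of nonzero parameters of the network. -/
def sparsity (N : ReLUSqNet d₁ d₂ W) : ℕ :=
  N.first.nnz + (N.mid.map AffineLayer.nnz).sum + N.last.nnz

/-- All parameters of the network are at most `B` in absolute value. -/
def BoundedBy (N : ReLUSqNet d₁ d₂ W) (B : ℝ) : Prop :=
  N.first.BoundedBy B ∧ (∀ A ∈ N.mid, A.BoundedBy B) ∧ N.last.BoundedBy B

/-- The function realized by the network: affine layers with `σ₂` between consecutive layers. -/
def eval (N : ReLUSqNet d₁ d₂ W) (x : Fin d₁ → ℝ) : Fin d₂ → ℝ :=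
  N.last.apply (reluSq (N.mid.foldl (fun v A => A.apply (reluSq v)) (N.first.apply x)))

end ReLUSqNet

/-- The class `Φ^{d₁,d₂}(L, W, S, B)` of functions realized by a ReLU² network of depth `L`,
width `W`, with at most `S` nonzero parameters, all of absolute value at most `B`. -/
def reluSqClass (d₁ d₂ L W S : ℕ) (B : ℝ) : Set ((Fin d₁ → ℝ) → (Fin d₂ → ℝ)) :=
  {g | ∃ N : ReLUSqNet d₁ d₂ W,
    N.depth = L ∧ N.sparsity ≤ S ∧ N.BoundedBy B ∧ N.eval = g}

/-! ### Flows -/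

/-- A map `g : ℝ^{d+1} → ℝ^d` seen as the time-dependent velocity field `(x, t) ↦ g(x, t)`;
time is the last input coordinate. -/
def toVelocity {d : ℕ} (g : (Fin (d + 1) → ℝ) → (Fin d → ℝ)) (x : EuclideanSpace ℝ (Fin d))
    (t : ℝ) : EuclideanSpace ℝ (Fin d) :=
  WithLp.toLp 2 (g (Fin.snoc (α := fun _ => ℝ) (fun i => x i) t))

/-- `X` solves the initial value problem `d/dt X(x,t) = f(X(x,t),t)`, `X(x,0) = x`, on the time
interval `[0,1]` for every starting point `x ∈ S`. -/
def IsFlowOn {E : Type*} [NormedAddCommGroup E] [NormedSpace ℝ E] (f : E → ℝ → E) (S : Set E)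
    (X : E → ℝ → E) : Prop :=
  ∀ x ∈ S, X x 0 = x ∧
    ∀ t ∈ Icc (0 : ℝ) 1, HasDerivWithinAt (X x) (f (X x t) t) (Icc 0 1) t

end

/-! The transport runs along the segment r_t = (1 - t) π + t ρ, in the manner of Dacorogna and
Moser. If v_q is a field on the cube with div v_q = q - 1 and no flow through the faces, then F =
(v_π - v_ρ) / r_t satisfies the continuity equation ∂_t r_t + div (r_t F) = 0, so its flow carries π
to ρ.

For v_q an explicit triangular choice is made, `flux`: its j-th component is the primitive in x_j of
the difference of two partial averages of q, one over the coordinates after j and one over those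
from j on (`margAvg`). These differences telescope to q - ∫ q, and each has mean zero in x_j, so the
component vanishes on both faces x_j = 0 and x_j = 1. No elliptic theory at the corners is needed
and no regularity is lost: every term is an average of q over diagonal affine maps of the cube into
itself. Hence F has, at every point of the cube and uniformly over the class of densities, a
polynomial approximation of order k (`IsCubeAverage.uLoc`, `ULoc.inv`, `uLoc_transportCoord`). This
is the only form of smoothness used for F. For k = 1 the field is merely Lipschitz, so the
continuity equation is used in weak form: a Lipschitz test function pulled back along the flow is
Lipschitz, hence differentiable almost everywhere, and its integral against r_t is constant in t
(`integral_flow_eq`, `exists_flow_map_eq`).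

Approximation: shallow ReLU² networks compute B-splines exactly, and also coordinates on nonnegative
inputs; polarization and iterated squaring then give products at fixed depth. Tensor B-splines at
scale 1/N form a partition of unity with (N + 2)^(d+1) members, and gluing the local polynomials
with it costs O(N^(d+1)) parameters of size O(N) for an error O(N^(-k)) (`exists_net_approx`). The
choice N ~ ε^(-1/k) gives the stated sizes.

Stability: the network approximates not F but F + ε (1/2 - x), up to ε/4 in each coordinate. Since F
is tangential at the faces, the network field points strictly inward there, so its trajectories
never leave the cube, the only place where it is controlled. Gronwall's inequality with the
Lipschitz constant of F alone shows that both flows differ by O(ε) uniformly; pushing π forward by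
the pair of flows is a coupling that bounds W_p for all p at once (`flow_of_approx`,
`wasserstein_map_le`). -/

/-! ### Realizing sums of powers of shallow ReLU² networks -/

namespace AffineLayer

variable {m n : ℕ} {α β γ : Type*}

/-- A layer whose inputs and outputs are indexed by types identified with `Fin m` and `Fin n`. -/
def ofEquiv (e : α ≃ Fin m) (f : β ≃ Fin n) (M : Matrix β α ℝ) (b : β → ℝ) : AffineLayer m n :=
  ⟨Matrix.reindex f e M, b ∘ f.symm⟩

theorem ofEquiv_apply [Fintype α] (e : α ≃ Fin m) (f : β ≃ Fin n) (M : Matrix β α ℝ) (b : β → ℝ)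
    (v : α → ℝ) : (ofEquiv e f M b).apply (v ∘ e.symm) = (M.mulVec v + b) ∘ f.symm := by
  unfold ofEquiv apply
  simp only [Matrix.reindex_apply, Matrix.submatrix_mulVec_equiv]
  ext i
  simp [Function.comp_def]

theorem ofEquiv_boundedBy (e : α ≃ Fin m) (f : β ≃ Fin n) (M : Matrix β α ℝ) (b : β → ℝ) {B : ℝ}
    (hM : ∀ i j, |M i j| ≤ B) (hb : ∀ i, |b i| ≤ B) : (ofEquiv e f M b).BoundedBy B :=
  ⟨fun _ _ => hM _ _, fun _ => hb _⟩

/-- Bounding by a set that contains the support is what makes block-diagonal layers count linearly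
in the number of blocks. -/
theorem ofEquiv_nnz_le [Fintype α] [Fintype β] (e : α ≃ Fin m) (f : β ≃ Fin n) (M : Matrix β α ℝ)
    (b : β → ℝ) (s : Finset (β × α)) (t : Finset β) (hs : ∀ i j, M i j ≠ 0 → (i, j) ∈ s)
    (ht : ∀ i, b i ≠ 0 → i ∈ t) : (ofEquiv e f M b).nnz ≤ s.card + t.card := by
  classical
  unfold nnz
  refine Nat.add_le_add ?_ ?_
  · rw [← Finset.card_image_of_injective s (Equiv.injective (Equiv.prodCongr f e)),
      ← Set.ncard_coe_finset]
    refine Set.ncard_le_ncard ?_ (Finset.finite_toSet _)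
    intro p hp
    simp only [Finset.coe_image, Set.mem_image, Finset.mem_coe]
    exact ⟨(f.symm p.1, e.symm p.2), hs _ _ hp, by ext <;> simp⟩
  · rw [← Finset.card_image_of_injective t f.injective, ← Set.ncard_coe_finset]
    refine Set.ncard_le_ncard ?_ (Finset.finite_toSet _)
    intro p hp
    simp only [Finset.coe_image, Set.mem_image, Finset.mem_coe]
    exact ⟨f.symm p, ht _ hp, by simp⟩

end AffineLayer

theorem reluSq_add_reluSq_neg (y : ℝ) : max 0 y ^ 2 + max 0 (-y) ^ 2 = y ^ 2 := by
  rcases le_total 0 y with h | h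
  · rw [max_eq_right h, max_eq_left (by linarith)]; ring
  · rw [max_eq_left h, max_eq_right (by linarith)]; ring

/-- Iterated squaring, as performed by the hidden layers of a ReLU² network. -/
theorem foldl_replicate_squaring {H : Type*} {W : ℕ} (e : H ≃ Fin W) (A : AffineLayer W W)
    (v : ℕ → H → ℝ)
    (hA : ∀ n, A.apply (reluSq (v n ∘ e.symm)) = v (n + 1) ∘ e.symm) (ℓ : ℕ) :
    (List.replicate ℓ A).foldl (fun v A => A.apply (reluSq v)) (v 0 ∘ e.symm) = v ℓ ∘ e.symm := by
  induction ℓ with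
  | zero => simp
  | succ n ih => rw [List.replicate_succ', List.foldl_append, ih]; simp [hA]

/-- A ReLU² network computing linear combinations of `2 ^ (ℓ + 1)`-th powers of shallow ReLU²
networks of fixed size. -/
theorem exists_net_sum_pow {n m : ℕ} {Q Λ : Type*} [Fintype Q] [Fintype Λ] (ℓ : ℕ) {B : ℝ}
    (hB : 1 ≤ B) (A : Q → Λ → Fin n → ℝ) (β : Q → Λ → ℝ) (w : Q → Λ → ℝ) (b : Q → ℝ)
    (a : Fin m → Q → ℝ) (hA : ∀ q l i, |A q l i| ≤ B) (hβ : ∀ q l, |β q l| ≤ B)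
    (hw : ∀ q l, |w q l| ≤ B) (hb : ∀ q, |b q| ≤ B) (ha : ∀ j q, |a j q| ≤ B) :
    ∃ N : ReLUSqNet n m (Fintype.card Q * (2 + Fintype.card Λ)),
      N.depth = ℓ + 3 ∧
      N.sparsity ≤ Fintype.card Q *
        ((2 + Fintype.card Λ) * (n + 1) +
          (ℓ + 1) * ((2 + Fintype.card Λ) * (2 + Fintype.card Λ) + (2 + Fintype.card Λ)) +
          m * (2 + Fintype.card Λ)) ∧
      N.BoundedBy B ∧
      ∀ z j, N.eval z j =
        ∑ q, a j q * (b q + ∑ l, w q l * max 0 (∑ i, A q l i * z i + β q l) ^ 2) ^ 2 ^ (ℓ + 1) := by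
  classical
  have hB0 : 0 ≤ B := zero_le_one.trans hB
  -- Each q owns a block of neurons: two sign channels, which carry the value to be squared, and one
  -- neuron per element of Λ for its shallow network. All hidden layers share this index set because
  -- the width is constant.
  let e : Q × (Bool ⊕ Λ) ≃ Fin (Fintype.card Q * (2 + Fintype.card Λ)) :=
    Fintype.equivFinOfCardEq (by simp)
  let M0 : Matrix (Q × (Bool ⊕ Λ)) (Fin n) ℝ := fun h i => Sum.elim (fun _ => 0) (fun l => A h.1 l i) h.2
  let b0 : Q × (Bool ⊕ Λ) → ℝ := fun h => Sum.elim (fun _ => 0) (fun l => β h.1 l) h.2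
  let sg : Bool → ℝ := fun s => if s then 1 else -1
  let M1 : Matrix (Q × (Bool ⊕ Λ)) (Q × (Bool ⊕ Λ)) ℝ := fun h h' => if h.1 = h'.1 then
    Sum.elim (fun s => Sum.elim (fun _ => 0) (fun l => sg s * w h.1 l) h'.2) (fun _ => 0) h.2 else 0
  let b1 : Q × (Bool ⊕ Λ) → ℝ := fun h => Sum.elim (fun s => sg s * b h.1) (fun _ => 0) h.2
  -- Squaring layer: the two sign channels are added into the positive one. After one squaring the
  -- value is nonnegative, so the negative channel can stay empty.
  let M2 : Matrix (Q × (Bool ⊕ Λ)) (Q × (Bool ⊕ Λ)) ℝ := fun h h' => if h.1 = h'.1 then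
    Sum.elim (fun s => if s then Sum.elim (fun _ => 1) (fun _ => 0) h'.2 else 0) (fun _ => 0) h.2
    else 0
  let M3 : Matrix (Fin m) (Q × (Bool ⊕ Λ)) ℝ := fun j h =>
    Sum.elim (fun _ => a j h.1) (fun _ => 0) h.2
  -- The block-diagonal positions; hidden weight matrices are supported here, which keeps the
  -- sparsity linear in the number of blocks.
  let T : Finset ((Q × (Bool ⊕ Λ)) × (Q × (Bool ⊕ Λ))) :=
    (Finset.univ : Finset (Q × (Bool ⊕ Λ) × (Bool ⊕ Λ))).image
      (fun p => ((p.1, p.2.1), (p.1, p.2.2)))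
  have hT : T.card ≤ Fintype.card Q * ((2 + Fintype.card Λ) * (2 + Fintype.card Λ)) := by
    refine Finset.card_image_le.trans ?_
    simp
  have memT : ∀ h h' : Q × (Bool ⊕ Λ), h.1 = h'.1 → (h, h') ∈ T := by
    rintro ⟨q, x⟩ ⟨q', x'⟩ h
    simp only at h
    subst h
    exact Finset.mem_image.2 ⟨(q, x, x'), Finset.mem_univ _, rfl⟩
  have hsg : ∀ s, |sg s| = 1 := by rintro (_ | _) <;> simp [sg]
  let L2 := AffineLayer.ofEquiv e e M2 0
  let N : ReLUSqNet n m (Fintype.card Q * (2 + Fintype.card Λ)) :=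
    ⟨.ofEquiv (Equiv.refl _) e M0 b0, .ofEquiv e e M1 b1 :: List.replicate ℓ L2,
      .ofEquiv e (Equiv.refl _) M3 0⟩
  have n0 : N.first.nnz ≤ Fintype.card Q * ((2 + Fintype.card Λ) * (n + 1)) := by
    refine (AffineLayer.ofEquiv_nnz_le _ _ M0 b0 Finset.univ Finset.univ (by simp) (by simp)).trans ?_
    simp
    exact le_of_eq (by ring)
  have n1 : (AffineLayer.ofEquiv e e M1 b1).nnz ≤ Fintype.card Q *
      ((2 + Fintype.card Λ) * (2 + Fintype.card Λ) + (2 + Fintype.card Λ)) := by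
    refine (AffineLayer.ofEquiv_nnz_le _ _ M1 b1 T Finset.univ ?_ (by simp)).trans ?_
    · intro i j h
      refine memT _ _ (by_contra fun h' => h ?_)
      simp [M1, h']
    · have : (Finset.univ : Finset (Q × (Bool ⊕ Λ))).card =
        Fintype.card Q * (2 + Fintype.card Λ) := by simp
      rw [this]
      exact (Nat.add_le_add_right hT _).trans (le_of_eq (by ring))
  have n2 : L2.nnz ≤ Fintype.card Q *
      ((2 + Fintype.card Λ) * (2 + Fintype.card Λ) + (2 + Fintype.card Λ)) := by
    refine (AffineLayer.ofEquiv_nnz_le _ _ M2 0 T ∅ ?_ (by simp)).trans ?_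
    · intro i j h
      refine memT _ _ (by_contra fun h' => h ?_)
      simp [M2, h']
    · simp only [Finset.card_empty, add_zero]
      exact hT.trans (Nat.mul_le_mul_left _ (Nat.le_add_right _ _))
  have n3 : N.last.nnz ≤ Fintype.card Q * (m * (2 + Fintype.card Λ)) := by
    refine (AffineLayer.ofEquiv_nnz_le _ _ M3 0 Finset.univ ∅ (by simp) (by simp)).trans ?_
    simp
    exact le_of_eq (by ring)
  refine ⟨N, by simp [N, ReLUSqNet.depth], ?_, ⟨?_, ?_, ?_⟩, ?_⟩
  · have : (N.mid.map AffineLayer.nnz).sum ≤ (ℓ + 1) * (Fintype.card Q *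
      ((2 + Fintype.card Λ) * (2 + Fintype.card Λ) + (2 + Fintype.card Λ))) := by
      simp only [N, List.map_cons, List.map_replicate, List.sum_cons, List.sum_replicate,
        smul_eq_mul]
      nlinarith [Nat.mul_le_mul_left ℓ n2]
    unfold ReLUSqNet.sparsity
    refine (Nat.add_le_add (Nat.add_le_add n0 this) n3).trans (le_of_eq (by ring))
  · refine AffineLayer.ofEquiv_boundedBy _ _ _ _ ?_ ?_
    · rintro ⟨q, x | x⟩ i <;> simp [M0, hB0, hA]
    · rintro ⟨q, x | x⟩ <;> simp [b0, hB0, hβ]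
  · intro A' hA'
    simp only [N, List.mem_cons, List.mem_replicate] at hA'
    rcases hA' with rfl | ⟨-, rfl⟩
    · refine AffineLayer.ofEquiv_boundedBy _ _ _ _ ?_ ?_
      · rintro ⟨q, x | x⟩ ⟨q', x' | x'⟩ <;> by_cases h : q = q' <;>
          simp [M1, hB0, h, abs_mul, hsg, hw]
      · rintro ⟨q, x | x⟩ <;> simp [b1, hB0, abs_mul, hsg, hb]
    · refine AffineLayer.ofEquiv_boundedBy _ _ _ _ ?_ ?_
      · rintro ⟨q, (_ | _) | x⟩ ⟨q', x' | x'⟩ <;> by_cases h : q = q' <;>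
          simp [M2, hB0, h, hB]
      · simp [hB0]
  · refine AffineLayer.ofEquiv_boundedBy _ _ _ _ ?_ ?_
    · rintro j ⟨q, x | x⟩ <;> simp [M3, hB0, ha]
    · simp [hB0]
  intro z j
  let y : Q → ℝ := fun q => b q + ∑ l, w q l * max 0 (∑ i, A q l i * z i + β q l) ^ 2
  -- The preactivation after k squaring layers. The last affine layer again adds the two channels,
  -- which supplies the final squaring and explains the exponent 2^(ℓ + 1).
  let v : ℕ → Q × (Bool ⊕ Λ) → ℝ := fun k h => Sum.elim
    (fun s => if k = 0 then sg s * y h.1 else if s then y h.1 ^ 2 ^ k else 0) (fun _ => 0) h.2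
  have comp : ∀ u : Q × (Bool ⊕ Λ) → ℝ,
    reluSq (u ∘ e.symm) = (fun h => max 0 (u h) ^ 2) ∘ e.symm := fun u => rfl
  have hv0 : (AffineLayer.ofEquiv e e M1 b1).apply (reluSq (N.first.apply z)) = v 0 ∘ e.symm := by
    have h1 := AffineLayer.ofEquiv_apply (Equiv.refl _) e M0 b0 z
    have h2 : N.first.apply z = (M0.mulVec z + b0) ∘ e.symm := h1
    rw [h2, comp, AffineLayer.ofEquiv_apply]
    congr 1
    ext ⟨q, x⟩
    rcases x with s | l
    · simp [Matrix.mulVec, dotProduct, Fintype.sum_prod_type, M1, M0, b1, b0, v, y,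
        Finset.mul_sum, mul_add]
      rw [add_comm]
      simp [mul_assoc]
    · simp [Matrix.mulVec, dotProduct, M1, M0, b1, b0, v]
  have sq : ∀ k q, (max 0 (v k (q, .inl true)) ^ 2 + max 0 (v k (q, .inl false)) ^ 2 =
      y q ^ 2 ^ (k + 1)) := by
    intro k q
    rcases k with _ | k
    · simpa [v, sg] using reluSq_add_reluSq_neg (y q)
    · have : 0 ≤ y q ^ 2 ^ (k + 1) := by
        rw [pow_succ 2 k, pow_mul]; positivity
      simp only [v, Nat.add_eq_zero_iff, one_ne_zero, and_false, ↓reduceIte, Sum.elim_inl,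
        max_eq_right this]
      simp
      rw [← pow_mul, ← pow_succ]
  have hv : ∀ k, L2.apply (reluSq (v k ∘ e.symm)) = v (k + 1) ∘ e.symm := by
    intro k
    rw [comp, AffineLayer.ofEquiv_apply]
    congr 1
    ext ⟨q, x⟩
    rcases x with s | l
    · rcases s with _ | _
      · simp [Matrix.mulVec, dotProduct, M2, v]
      · simp only [Matrix.mulVec, dotProduct, Fintype.sum_prod_type, M2, Pi.add_apply,
          Pi.zero_apply, add_zero]
        rw [Finset.sum_eq_single q (fun q' _ h => by simp [Ne.symm h]) (by simp)]
        simp only [Fintype.sum_sum_type, Fintype.sum_bool, Sum.elim_inl, Sum.elim_inr]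
        simpa [v] using sq k q
    · simp [Matrix.mulVec, dotProduct, M2, v]
  have hfold : N.mid.foldl (fun v A => A.apply (reluSq v)) (N.first.apply z) = v ℓ ∘ e.symm := by
    simp only [N, List.foldl_cons]
    rw [show (AffineLayer.ofEquiv e e M1 b1).apply (reluSq ((AffineLayer.ofEquiv (Equiv.refl _) e M0 b0).apply z)) = v 0 ∘ e.symm from hv0]
    exact foldl_replicate_squaring e L2 v hv ℓ
  unfold ReLUSqNet.eval
  rw [hfold, comp]
  have := congrFun (AffineLayer.ofEquiv_apply e (Equiv.refl _) M3 0 (fun h => max 0 (v ℓ h) ^ 2)) j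
  refine this.trans ?_
  simp only [Matrix.mulVec, dotProduct, Fintype.sum_prod_type, M3, Function.comp_apply,
    add_zero, Fintype.sum_sum_type, Fintype.sum_bool, Sum.elim_inl,
    Sum.elim_inr, zero_mul, Finset.sum_const_zero, Equiv.refl_symm, Equiv.refl_apply]
  refine Finset.sum_congr rfl fun q _ => ?_
  rw [← mul_add, sq]

/-! ### Products of shallow networks via polarization -/

/-- Iterated finite differences of the `n`-th power, for `n` at most the number of steps. -/
theorem sum_powerset_neg_one_pow_mul_add_sum_pow {ι R : Type*} [DecidableEq ι] [CommRing R]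
    (y : ι → R) (s : Finset ι) :
    ∀ (n : ℕ) (t : R), n ≤ s.card →
      ∑ S ∈ s.powerset, (-1) ^ (s.card + S.card) * (t + ∑ i ∈ S, y i) ^ n =
        if n = s.card then (s.card.factorial : R) * ∏ i ∈ s, y i else 0 := by
  induction s using Finset.induction_on with
  | empty => intro n t hn; simp at hn; simp [hn]
  | insert a s ha ih =>
    intro n t hn
    rw [Finset.card_insert_of_notMem ha] at hn ⊢
    rw [Finset.sum_powerset_insert ha, ← Finset.sum_add_distrib]
    have key : ∀ S ∈ s.powerset,
        (-1) ^ (s.card + 1 + S.card) * (t + ∑ i ∈ S, y i) ^ n +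
          (-1) ^ (s.card + 1 + (insert a S).card) * (t + ∑ i ∈ insert a S, y i) ^ n =
        ∑ k ∈ Finset.range n, (n.choose k * y a ^ (n - k) : R) *
          ((-1) ^ (s.card + S.card) * (t + ∑ i ∈ S, y i) ^ k) := by
      intro S hS
      have haS : a ∉ S := fun h => ha (Finset.mem_powerset.1 hS h)
      rw [Finset.card_insert_of_notMem haS, Finset.sum_insert haS,
        show t + (y a + ∑ i ∈ S, y i) = (t + ∑ i ∈ S, y i) + y a by ring,
        add_pow (t + ∑ i ∈ S, y i), Finset.sum_range_succ]
      simp only [Nat.sub_self, pow_zero, mul_one, Nat.choose_self, Nat.cast_one]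
      rw [mul_add, Finset.mul_sum, show s.card + 1 + (S.card + 1) = s.card + S.card + 2 by ring,
        pow_add _ _ 2, show s.card + 1 + S.card = s.card + S.card + 1 by ring, pow_succ]
      have : ∀ k ∈ Finset.range n, (n.choose k * y a ^ (n - k) : R) *
          ((-1) ^ (s.card + S.card) * (t + ∑ i ∈ S, y i) ^ k) =
          (-1) ^ (s.card + S.card) * (-1) ^ 2 *
            ((t + ∑ i ∈ S, y i) ^ k * y a ^ (n - k) * (n.choose k : R)) := by
        intro k _; ring
      rw [Finset.sum_congr rfl this]
      ring
    rw [Finset.sum_congr rfl key, Finset.sum_comm]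
    simp only [← Finset.mul_sum]
    have h2 : ∀ k ∈ Finset.range n, (n.choose k * y a ^ (n - k) : R) *
        ∑ S ∈ s.powerset, (-1) ^ (s.card + S.card) * (t + ∑ i ∈ S, y i) ^ k =
        (n.choose k * y a ^ (n - k) : R) *
          (if k = s.card then (s.card.factorial : R) * ∏ i ∈ s, y i else 0) := by
      intro k hk
      rw [ih k t (by have := Finset.mem_range.1 hk; omega)]
    rw [Finset.sum_congr rfl h2]
    by_cases h : n = s.card + 1
    · subst h
      rw [Finset.sum_eq_single s.card (fun k _ hk => by simp [hk]) (by simp)]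
      simp [Nat.factorial_succ, Finset.prod_insert ha]
      ring
    · rw [if_neg h]
      refine Finset.sum_eq_zero fun k hk => ?_
      rw [if_neg (by have := Finset.mem_range.1 hk; omega), mul_zero]

/-- Polarization: the iterated difference of the power of degree equal to the number of steps, taken
at 0, leaves only the mixed term. It trades a product for powers of subset sums, which squaring
layers can compute. -/
theorem prod_eq_sum_powerset_pow {F : Type*} [Fintype F] [DecidableEq F] (y : F → ℝ) :
    ∏ i, y i = ∑ S : Finset F, ((-1) ^ (Fintype.card F + S.card) / (Fintype.card F).factorial) *
      (∑ i ∈ S, y i) ^ Fintype.card F := by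
  have h := sum_powerset_neg_one_pow_mul_add_sum_pow y Finset.univ (Fintype.card F) 0 le_rfl
  simp only [Finset.powerset_univ, zero_add, Finset.card_univ, if_true] at h
  have h0 : ((Fintype.card F).factorial : ℝ) ≠ 0 := by positivity
  have : ∏ i, y i = (∑ S : Finset F, (-1) ^ (Fintype.card F + S.card) *
      (∑ i ∈ S, y i) ^ Fintype.card F) / (Fintype.card F).factorial := by
    rw [h]; field_simp
  rw [this, Finset.sum_div]
  exact Finset.sum_congr rfl fun S _ => by ring

/-- A ReLU² network computing linear combinations of products of `2 ^ (ℓ + 1)` shallow ReLU²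
networks with four neurons. -/
theorem exists_net_sum_prod {n m : ℕ} {Q F : Type} [Fintype Q] [Fintype F] (ℓ : ℕ)
    (hF : Fintype.card F = 2 ^ (ℓ + 1)) {B : ℝ}
    (hB : 1 ≤ B) (A : Q → F → Fin 4 → Fin n → ℝ) (β w : Q → F → Fin 4 → ℝ) (c : Q → F → ℝ)
    (a : Fin m → Q → ℝ) (hA : ∀ q f l i, |A q f l i| ≤ B) (hβ : ∀ q f l, |β q f l| ≤ B)
    (hw : ∀ q f l, |w q f l| ≤ B) (hc : ∀ q f, |c q f| ≤ B) (ha : ∀ j q, |a j q| ≤ B) :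
    ∃ N : ReLUSqNet n m (Fintype.card Q * 2 ^ Fintype.card F * (2 + Fintype.card F * 4)),
      N.depth = ℓ + 3 ∧
      N.sparsity ≤ Fintype.card Q * 2 ^ Fintype.card F *
        ((2 + Fintype.card F * 4) * (n + 1) +
          (ℓ + 1) * ((2 + Fintype.card F * 4) * (2 + Fintype.card F * 4) +
            (2 + Fintype.card F * 4)) + m * (2 + Fintype.card F * 4)) ∧
      N.BoundedBy (Fintype.card F * B) ∧
      ∀ z j, N.eval z j =
        ∑ q, a j q * ∏ f, (c q f + ∑ l, w q f l * max 0 (∑ i, A q f l i * z i + β q f l) ^ 2) := by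
  classical
  have hB0 : 0 ≤ B := zero_le_one.trans hB
  have hF1 : (1 : ℝ) ≤ Fintype.card F := by
    rw [hF]; exact_mod_cast Nat.one_le_two_pow
  have hle : ∀ {x : ℝ}, x ≤ B → x ≤ Fintype.card F * B := fun h => h.trans (by nlinarith)
  have hcard : Fintype.card (Q × Finset F) = Fintype.card Q * 2 ^ Fintype.card F := by simp
  have hcard' : Fintype.card (F × Fin 4) = Fintype.card F * 4 := by simp
  -- One power unit per pair (q, S). Output weights are set to zero outside S, so that all units
  -- have the same shape; the constants add up over S, which is why the weight bound grows by the
  -- factor `Fintype.card F`.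
  have := exists_net_sum_pow (Q := Q × Finset F) (Λ := F × Fin 4) ℓ (B := Fintype.card F * B)
    (hle hB) (fun q l => A q.1 l.1 l.2) (fun q l => β q.1 l.1 l.2)
    (fun q l => if l.1 ∈ q.2 then w q.1 l.1 l.2 else 0) (fun q => ∑ i ∈ q.2, c q.1 i)
    (fun j q => a j q.1 *
      ((-1) ^ (Fintype.card F + q.2.card) / (Fintype.card F).factorial))
    (fun _ _ _ => hle (hA _ _ _ _)) (fun _ _ => hle (hβ _ _ _))
    (fun q l => by split_ifs; exacts [hle (hw _ _ _), by simpa using hle hB0])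
    (fun q => ?_) (fun j q => ?_)
  · rw [hcard, hcard'] at this
    obtain ⟨N, h1, h2, h3, h4⟩ := this
    refine ⟨N, h1, h2, h3, fun z j => ?_⟩
    rw [h4, Fintype.sum_prod_type]
    refine Finset.sum_congr rfl fun q _ => ?_
    rw [prod_eq_sum_powerset_pow, Finset.mul_sum]
    refine Finset.sum_congr rfl fun S _ => ?_
    rw [mul_assoc, hF]
    congr 3
    rw [Fintype.sum_prod_type, Finset.sum_add_distrib]
    congr 1
    rw [← Finset.sum_filter_add_sum_filter_not Finset.univ (· ∈ S)
      (fun f => ∑ l, _), Finset.filter_univ_mem]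
    have h0 : ∀ f ∈ Finset.univ.filter (· ∉ S), (∑ l : Fin 4, (if f ∈ S then w q f l else 0) *
        max 0 (∑ i, A q f l i * z i + β q f l) ^ 2) = 0 := by
      intro f hf
      simp [(Finset.mem_filter.1 hf).2]
    rw [Finset.sum_eq_zero h0, add_zero]
    exact Finset.sum_congr rfl fun f hf => by simp [hf]
  · refine (Finset.abs_sum_le_sum_abs _ _).trans ?_
    refine (Finset.sum_le_card_nsmul _ _ B fun i _ => hc _ _).trans ?_
    rw [nsmul_eq_mul]
    exact mul_le_mul_of_nonneg_right (by exact_mod_cast Finset.card_le_univ _) hB0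
  · refine hle ?_
    rw [abs_mul, abs_div, abs_pow, abs_neg, abs_one, one_pow]
    have : (1 : ℝ) ≤ (Fintype.card F).factorial := by
      exact_mod_cast Nat.succ_le_of_lt (Nat.factorial_pos _)
    rw [Nat.abs_cast]
    exact (mul_le_of_le_one_right (abs_nonneg _) ((div_le_one (by positivity)).2 this)).trans
      (ha _ _)

/-! ### Quadratic B-splines as a partition of unity -/

/-- The quadratic B-spline with knots `0, 1, 2, 3`. -/
noncomputable def bSpline (y : ℝ) : ℝ :=
  1 / 2 * max 0 y ^ 2 - 3 / 2 * max 0 (y - 1) ^ 2 + 3 / 2 * max 0 (y - 2) ^ 2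
    - 1 / 2 * max 0 (y - 3) ^ 2

theorem bSpline_nonneg (y : ℝ) : 0 ≤ bSpline y := by
  unfold bSpline
  rcases le_total y 0 with h | h
  · rw [max_eq_left h, max_eq_left (by linarith), max_eq_left (by linarith),
      max_eq_left (by linarith)]; norm_num
  rcases le_total y 1 with h1 | h1
  · rw [max_eq_right h, max_eq_left (by linarith), max_eq_left (by linarith),
      max_eq_left (by linarith)]; nlinarith
  rcases le_total y 2 with h2 | h2
  · rw [max_eq_right h, max_eq_right (by linarith), max_eq_left (by linarith),
      max_eq_left (by linarith)]; nlinarith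
  rcases le_total y 3 with h3 | h3
  · rw [max_eq_right h, max_eq_right (by linarith), max_eq_right (by linarith),
      max_eq_left (by linarith)]; nlinarith [sq_nonneg (y - 3)]
  · rw [max_eq_right h, max_eq_right (by linarith), max_eq_right (by linarith),
      max_eq_right (by linarith)]; nlinarith

theorem bSpline_eq_zero_of_nonpos {y : ℝ} (h : y ≤ 0) : bSpline y = 0 := by
  unfold bSpline
  rw [max_eq_left h, max_eq_left (by linarith), max_eq_left (by linarith),
    max_eq_left (by linarith)]; norm_num

theorem bSpline_eq_zero_of_three_le {y : ℝ} (h : 3 ≤ y) : bSpline y = 0 := by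
  unfold bSpline
  rw [max_eq_right (by linarith), max_eq_right (by linarith), max_eq_right (by linarith),
    max_eq_right (by linarith)]; ring

/-- A quadratic B-spline is a third difference of the truncated square, hence a first difference of
the second difference `f`, and the sum telescopes. At m = 0 all truncations are inactive, so `f`
equals 1; at m = N + 2 all of them vanish. -/
theorem sum_bSpline (N : ℕ) {x : ℝ} (h0 : 0 ≤ x) (hN : x ≤ N) :
    ∑ m : Fin (N + 2), bSpline (x - (m : ℕ) + 2) = 1 := by
  rw [Fin.sum_univ_eq_sum_range (fun m : ℕ => bSpline (x - m + 2)) (N + 2)]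
  let f : ℕ → ℝ := fun m => 1 / 2 * max 0 (x - m + 2) ^ 2 - max 0 (x - m + 2 - 1) ^ 2
    + 1 / 2 * max 0 (x - m + 2 - 2) ^ 2
  have : ∀ m ∈ Finset.range (N + 2), bSpline (x - m + 2) = f m - f (m + 1) := by
    intro m _
    simp only [f, bSpline]
    push_cast
    rw [show x - (m + 1 : ℝ) + 2 = x - m + 2 - 1 by ring,
      show x - (m : ℝ) + 2 - 1 - 1 = x - m + 2 - 2 by ring,
      show x - (m : ℝ) + 2 - 1 - 2 = x - m + 2 - 3 by ring]
    ring
  rw [Finset.sum_congr rfl this, Finset.sum_range_sub']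
  simp only [f]
  push_cast
  rw [max_eq_right (by linarith), max_eq_right (by linarith), max_eq_right (by linarith),
    max_eq_left (by linarith), max_eq_left (by linarith), max_eq_left (by linarith)]
  ring

/-! ### Functions with local polynomial approximations -/

/-- Polynomials with all exponents at most `D` and all coefficients at most `M`. -/
def IsBddPoly {ι : Type*} [Fintype ι] [DecidableEq ι] (D : ℕ) (M : ℝ) (p : (ι → ℝ) → ℝ) : Prop :=
  ∃ c : (ι → Fin (D + 1)) → ℝ,
    (∀ α, |c α| ≤ M) ∧ ∀ z, p z = ∑ α, c α * ∏ i, z i ^ (α i : ℕ)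

/-- Functions on the unit cube approximated to order `k` at each point by polynomials. -/
def LocPoly {ι : Type*} [Fintype ι] [DecidableEq ι] (k D : ℕ) (M : ℝ) (u : (ι → ℝ) → ℝ) : Prop :=
  ∀ a ∈ Icc (0 : ι → ℝ) 1, ∃ p, IsBddPoly D M p ∧
    ∀ z ∈ Icc (0 : ι → ℝ) 1, |u z - p z| ≤ M * dist z a ^ k

theorem prod_fin_ite_lt (D a : ℕ) (ha : a ≤ D) (x : ℝ) :
    ∏ t : Fin D, (if (t : ℕ) < a then x else 1) = x ^ a := by
  rw [Fin.prod_univ_eq_prod_range (fun t => if t < a then x else 1) D, Finset.prod_ite,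
    Finset.prod_const, Finset.prod_const_one, mul_one]
  congr 1
  rw [show (Finset.range D).filter (· < a) = Finset.range a by ext; simp; omega,
    Finset.card_range]

/-- The m-th spline lives on (m - 2, m + 1) / N. The node m / N is cut off at 1, because m = N + 1
would leave the interval where local polynomials are available. -/
theorem bSpline_center {N : ℕ} (hN : 1 ≤ N) (m : Fin (N + 2)) {x : ℝ} (h1 : x ≤ 1)
    (h : bSpline (N * x - (m : ℕ) + 2) ≠ 0) : |x - min (m : ℝ) N / N| ≤ 2 / N := by
  have hN' : (0 : ℝ) < N := by exact_mod_cast hN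
  have l : 0 < N * x - (m : ℕ) + 2 := not_le.1 fun h' => h (bSpline_eq_zero_of_nonpos h')
  have r : N * x - (m : ℕ) + 2 < 3 := not_le.1 fun h' => h (bSpline_eq_zero_of_three_le h')
  have hx : N * x ≤ N := by nlinarith
  have : x - min (m : ℝ) N / N = (N * x - min (m : ℝ) N) / N := by field_simp
  rw [this, abs_div, abs_of_pos hN']
  gcongr
  rw [abs_le]
  rcases le_total (m : ℝ) N with hm | hm
  · rw [min_eq_left hm]; constructor <;> linarith
  · rw [min_eq_right hm]; constructor <;> linarith

/-- The parameters of the neurons realizing the factors of a product of B-splines and monomials: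
a constant, four output weights, four input weights and four biases. -/
noncomputable def factorParam {n N D : ℕ} {P : Type} (q : (Fin n → Fin (N + 2)) × (Fin n → Fin (D + 1))) :
    Fin n ⊕ (Fin n × Fin D) ⊕ P → ℝ × (Fin 4 → ℝ) × (Fin 4 → Fin n → ℝ) × (Fin 4 → ℝ)
  | .inl i => (0, ![1 / 2, -3 / 2, 3 / 2, -1 / 2], fun _ i' => if i' = i then N else 0,
      fun l => 2 - (q.1 i : ℕ) - (l : ℕ))
  -- For z ≥ 0 the identity z = ((z + 1)² - z² - 1) / 2 gives the coordinate from two neurons. Each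
  -- coordinate has D slots, of which the first `q.2 i` hold it and the others hold the constant 1.
  | .inr (.inl (i, t)) => if (t : ℕ) < q.2 i then
      (-1 / 2, ![1 / 2, -1 / 2, 0, 0], fun _ i' => if i' = i then 1 else 0, ![1, 0, 0, 0])
      else (1, 0, 0, 0)
  | .inr (.inr _) => (1, 0, 0, 0)

theorem factorParam_bound {n N D : ℕ} {P : Type} (hN : 1 ≤ N)
    (q : (Fin n → Fin (N + 2)) × (Fin n → Fin (D + 1))) (f : Fin n ⊕ (Fin n × Fin D) ⊕ P) :
    |(factorParam q f).1| ≤ 7 * N ∧ (∀ l, |(factorParam q f).2.1 l| ≤ 7 * N) ∧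
      (∀ l i, |(factorParam q f).2.2.1 l i| ≤ 7 * N) ∧
      ∀ l, |(factorParam q f).2.2.2 l| ≤ 7 * N := by
  have hN' : (1 : ℝ) ≤ N := by exact_mod_cast hN
  have h0 : |(0 : ℝ)| ≤ 7 * N := by simp
  have hc : ∀ x : ℝ, |x| ≤ 7 → |x| ≤ 7 * N := fun x hx => hx.trans (by linarith)
  rcases f with i | ⟨i, t⟩ | s
  · refine ⟨by simp [factorParam], fun l => hc _ ?_, fun l i' => ?_, fun l => ?_⟩
    · fin_cases l <;> norm_num [factorParam, abs_of_neg]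
    · simp only [factorParam]
      split_ifs
      · rw [Nat.abs_cast]; linarith
      · exact h0
    · simp only [factorParam]
      have h1 : ((q.1 i : ℕ) : ℝ) ≤ N + 1 := by
        exact_mod_cast Nat.lt_succ_iff.1 (q.1 i).2
      have h2 : ((l : ℕ) : ℝ) ≤ 3 := by exact_mod_cast Nat.lt_succ_iff.1 l.2
      rw [abs_le]
      constructor <;> linarith [Nat.cast_nonneg (α := ℝ) (q.1 i : ℕ), Nat.cast_nonneg (α := ℝ) (l : ℕ)]
  · simp only [factorParam]
    split_ifs
    · refine ⟨hc _ (by norm_num [abs_of_neg]), fun l => hc _ ?_, fun l i' => ?_, fun l => hc _ ?_⟩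
      · fin_cases l <;> norm_num [abs_of_neg]
      · change |if i' = i then (1 : ℝ) else 0| ≤ _
        split_ifs
        · exact hc _ (by norm_num)
        · exact h0
      · fin_cases l <;> norm_num [abs_of_neg]
    · exact ⟨hc _ (by norm_num), fun _ => h0, fun _ _ => h0, fun _ => h0⟩
  · exact ⟨hc _ (by norm_num [factorParam]), fun _ => h0, fun _ _ => h0, fun _ => h0⟩

theorem prod_factorParam {n N D : ℕ} {P : Type} [Fintype P]
    (q : (Fin n → Fin (N + 2)) × (Fin n → Fin (D + 1))) {z : Fin n → ℝ} (hz : 0 ≤ z) :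
    ∏ f : Fin n ⊕ (Fin n × Fin D) ⊕ P, ((factorParam q f).1 + ∑ l, (factorParam q f).2.1 l *
      max 0 (∑ i, (factorParam q f).2.2.1 l i * z i + (factorParam q f).2.2.2 l) ^ 2) =
    (∏ i, bSpline (N * z i - (q.1 i : ℕ) + 2)) * ∏ i, z i ^ (q.2 i : ℕ) := by
  rw [Fintype.prod_sum_type, Fintype.prod_sum_type, Fintype.prod_prod_type]
  congr 1
  · refine Finset.prod_congr rfl fun i _ => ?_
    simp [factorParam, Fin.sum_univ_four, bSpline]
    ring_nf
  · rw [Finset.prod_eq_one (s := (Finset.univ : Finset P)) (fun s _ => by simp [factorParam]),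
      mul_one]
    refine Finset.prod_congr rfl fun i _ => ?_
    rw [← prod_fin_ite_lt D (q.2 i) (Nat.lt_succ_iff.1 (q.2 i).2)]
    refine Finset.prod_congr rfl fun t _ => ?_
    have h0 := hz i
    simp only [Pi.zero_apply] at h0
    simp only [factorParam]
    split_ifs
    · simp [Fin.sum_univ_four]
      rw [max_eq_right (by linarith), max_eq_right h0]
      ring
    · simp

/-- Functions with local polynomial approximations of order `k` are approximated by ReLU²
networks of size `N ^ n` with error of order `N ^ (-k)`. -/
theorem exists_net_approx (n m k D : ℕ) :
    ∃ L K : ℕ, ∀ M : ℝ, ∃ C : ℝ, 0 < C ∧ ∀ N : ℕ, 1 ≤ N → ∀ u : Fin m → (Fin n → ℝ) → ℝ,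
      (∀ j, LocPoly k D M (u j)) →
      ∃ W : ℕ, ∃ net : ReLUSqNet n m W, net.depth = L ∧ W ≤ K * N ^ n ∧
        net.sparsity ≤ K * N ^ n ∧ net.BoundedBy (C * N) ∧
        ∀ z ∈ Icc (0 : Fin n → ℝ) 1, ∀ j, |net.eval z j - u j z| ≤ C / N ^ k := by
  classical
  -- A term has n splines and n * D monomial slots; the last summand of `F` pads the product by ones
  -- up to a power of two.
  let ℓ := n + n * D
  have hℓ : n + n * D ≤ 2 ^ (ℓ + 1) := (Nat.lt_two_pow_self).le.trans (Nat.pow_le_pow_right (by norm_num) (Nat.le_succ _))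
  let F := Fin n ⊕ (Fin n × Fin D) ⊕ Fin (2 ^ (ℓ + 1) - (n + n * D))
  have hF : Fintype.card F = 2 ^ (ℓ + 1) := by simp [F]; omega
  let K1 := 2 + Fintype.card F * 4
  let K0 := (2 + Fintype.card F * 4) * (n + 1) +
          (ℓ + 1) * ((2 + Fintype.card F * 4) * (2 + Fintype.card F * 4) +
            (2 + Fintype.card F * 4)) + m * (2 + Fintype.card F * 4)
  refine ⟨ℓ + 3, 3 ^ n * (D + 1) ^ n * 2 ^ Fintype.card F * (K0 + K1), fun M => ?_⟩
  -- The first summand bounds the weights; the second bounds the error, as a point in the support of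
  -- a spline is within 2 / N of its centre.
  refine ⟨Fintype.card F * (7 + |M|) + |M| * 2 ^ k, ?_, fun N hN u hu => ?_⟩
  · rw [hF]; positivity
  have hN' : (1 : ℝ) ≤ N := by exact_mod_cast hN
  have hN0 : (0 : ℝ) < N := by linarith
  -- The base point of the local polynomial used with the spline of index μ.
  let ctr : (Fin n → Fin (N + 2)) → Fin n → ℝ := fun μ i => min (μ i : ℝ) N / N
  have hctr : ∀ μ, ctr μ ∈ Icc (0 : Fin n → ℝ) 1 := by
    intro μ
    refine ⟨fun i => ?_, fun i => ?_⟩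
    · simp only [ctr, Pi.zero_apply]; positivity
    · simp only [ctr, Pi.one_apply]
      rw [div_le_one hN0]; exact min_le_right _ _
  have hex : ∀ j μ, ∃ c : (Fin n → Fin (D + 1)) → ℝ, (∀ α, |c α| ≤ M) ∧
      ∀ z ∈ Icc (0 : Fin n → ℝ) 1,
        |u j z - ∑ α, c α * ∏ i, z i ^ (α i : ℕ)| ≤ M * dist z (ctr μ) ^ k := by
    intro j μ
    obtain ⟨p, ⟨c, hc, hp⟩, h⟩ := hu j (ctr μ) (hctr μ)
    exact ⟨c, hc, fun z hz => by rw [← hp]; exact h z hz⟩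
  choose c hc hcu using hex
  let Q := (Fin n → Fin (N + 2)) × (Fin n → Fin (D + 1))
  have hQ : Fintype.card Q ≤ 3 ^ n * (D + 1) ^ n * N ^ n := by
    simp only [Q, Fintype.card_prod, Fintype.card_pi, Fintype.card_fin, Finset.prod_const,
      Finset.card_univ]
    calc (N + 2) ^ n * (D + 1) ^ n ≤ (3 * N) ^ n * (D + 1) ^ n :=
          Nat.mul_le_mul_right _ (Nat.pow_le_pow_left (by omega) n)
      _ = _ := by rw [mul_pow]; ring
  obtain ⟨net, h1, h2, h3, h4⟩ := exists_net_sum_prod (Q := Q) (F := F) (n := n) (m := m) ℓ hF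
    (B := (7 + |M|) * N) (by nlinarith [abs_nonneg M])
    (fun q f => (factorParam q f).2.2.1) (fun q f => (factorParam q f).2.2.2)
    (fun q f => (factorParam q f).2.1) (fun q f => (factorParam q f).1)
    (fun j q => c j q.1 q.2)
    (fun q f l i => ((factorParam_bound hN q f).2.2.1 l i).trans (by nlinarith [abs_nonneg M]))
    (fun q f l => ((factorParam_bound hN q f).2.2.2 l).trans (by nlinarith [abs_nonneg M]))
    (fun q f l => ((factorParam_bound hN q f).2.1 l).trans (by nlinarith [abs_nonneg M]))
    (fun q f => ((factorParam_bound hN q f).1).trans (by nlinarith [abs_nonneg M]))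
    (fun j q => ((hc j q.1 q.2).trans (le_abs_self M)).trans (by nlinarith [abs_nonneg M]))
  refine ⟨_, net, h1, ?_, h2.trans ?_, ?_, fun z hz j => ?_⟩
  · calc Fintype.card Q * 2 ^ Fintype.card F * (2 + Fintype.card F * 4)
        ≤ (3 ^ n * (D + 1) ^ n * N ^ n) * 2 ^ Fintype.card F * (K0 + K1) :=
          Nat.mul_le_mul (Nat.mul_le_mul_right _ hQ) (Nat.le_add_left _ _)
      _ = _ := by ring
  · calc Fintype.card Q * 2 ^ Fintype.card F * K0
        ≤ (3 ^ n * (D + 1) ^ n * N ^ n) * 2 ^ Fintype.card F * (K0 + K1) :=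
          Nat.mul_le_mul (Nat.mul_le_mul_right _ hQ) (Nat.le_add_right _ _)
      _ = _ := by ring
  · have hle : (Fintype.card F : ℝ) * ((7 + |M|) * N) ≤
        (Fintype.card F * (7 + |M|) + |M| * 2 ^ k) * N := by
      have : 0 ≤ |M| * 2 ^ k * N := by positivity
      linarith
    obtain ⟨⟨a1, a2⟩, b, c1, c2⟩ := h3
    exact ⟨⟨fun i j => (a1 i j).trans hle, fun i => (a2 i).trans hle⟩,
      fun A hA => ⟨fun i j => ((b A hA).1 i j).trans hle, fun i => ((b A hA).2 i).trans hle⟩,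
      fun i j => (c1 i j).trans hle, fun i => (c2 i).trans hle⟩
  · rw [h4]
    rw [Finset.sum_congr rfl fun q _ => congrArg (c j q.1 q.2 * ·) (prod_factorParam q hz.1)]
    let Ψ : (Fin n → Fin (N + 2)) → ℝ := fun μ => ∏ i, bSpline (N * z i - (μ i : ℕ) + 2)
    have hΨ0 : ∀ μ, 0 ≤ Ψ μ := fun μ => Finset.prod_nonneg fun i _ => bSpline_nonneg _
    have hΨ1 : ∑ μ, Ψ μ = 1 := by
      have := Finset.prod_univ_sum (fun _ : Fin n => (Finset.univ : Finset (Fin (N + 2))))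
        (fun i m => bSpline (N * z i - (m : ℕ) + 2))
      rw [Fintype.piFinset_univ] at this
      refine this.symm.trans (Finset.prod_eq_one fun i _ => ?_)
      have h0 := hz.1 i
      have h1 := hz.2 i
      simp only [Pi.zero_apply, Pi.one_apply] at h0 h1
      exact sum_bSpline N (by positivity) (by nlinarith)
    -- Since the splines sum to one, the error is an average of local errors; only those splines
    -- count that do not vanish at z.
    have e1 : ∑ q : Q, c j q.1 q.2 * (Ψ q.1 * ∏ i, z i ^ (q.2 i : ℕ)) - u j z =
        ∑ μ, Ψ μ * (∑ α, c j μ α * ∏ i, z i ^ (α i : ℕ) - u j z) := by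
      simp only [mul_sub, Finset.sum_sub_distrib, ← Finset.sum_mul, hΨ1, one_mul]
      rw [Fintype.sum_prod_type]
      congr 1
      refine Finset.sum_congr rfl fun μ _ => ?_
      rw [Finset.mul_sum]
      exact Finset.sum_congr rfl fun α _ => by ring
    rw [e1]
    refine (Finset.abs_sum_le_sum_abs _ _).trans ?_
    have hb : ∀ μ ∈ Finset.univ, |Ψ μ * (∑ α, c j μ α * ∏ i, z i ^ (α i : ℕ) - u j z)| ≤
        Ψ μ * (|M| * (2 / N) ^ k) := by
      intro μ _
      rw [abs_mul, abs_of_nonneg (hΨ0 μ)]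
      rcases eq_or_ne (Ψ μ) 0 with h | h
      · rw [h]; simp
      refine mul_le_mul_of_nonneg_left ?_ (hΨ0 μ)
      rw [abs_sub_comm]
      refine (hcu j μ z hz).trans ?_
      have hd : dist z (ctr μ) ≤ 2 / N := by
        rw [dist_pi_le_iff (by positivity)]
        intro i
        rw [Real.dist_eq]
        exact bSpline_center hN (μ i) (hz.2 i) ((Finset.prod_ne_zero_iff.1 h) i (Finset.mem_univ _))
      calc M * dist z (ctr μ) ^ k ≤ |M| * dist z (ctr μ) ^ k := by
            gcongr; exact le_abs_self M
        _ ≤ _ := by gcongr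
    refine (Finset.sum_le_sum hb).trans ?_
    rw [← Finset.sum_mul, hΨ1, one_mul, div_pow, ← mul_div_assoc]
    gcongr
    have : (0 : ℝ) ≤ Fintype.card F * (7 + |M|) := by positivity
    linarith

/-! ### Calculus of local polynomial approximations -/

section Poly

variable {ι : Type*} [Fintype ι] [DecidableEq ι] {D D' : ℕ} {M M' : ℝ} {p q : (ι → ℝ) → ℝ}

theorem IsBddPoly.nonneg (hp : IsBddPoly D M p) : 0 ≤ M := by
  obtain ⟨c, hc, -⟩ := hp
  exact (abs_nonneg _).trans (hc 0)

theorem IsBddPoly.mono_right (hp : IsBddPoly D M p) (h : M ≤ M') : IsBddPoly D M' p := by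
  obtain ⟨c, hc, hp⟩ := hp
  exact ⟨c, fun α => (hc α).trans h, hp⟩

/-- A family of terms with exponents at most `D` sums up to a polynomial. -/
theorem isBddPoly_sum {κ : Type*} (s : Finset κ) (c : κ → ℝ) (e : κ → ι → Fin (D + 1))
    (hp : ∀ z, p z = ∑ κ ∈ s, c κ * ∏ i, z i ^ (e κ i : ℕ)) : IsBddPoly D (∑ κ ∈ s, |c κ|) p := by
  refine ⟨fun α => ∑ κ ∈ s.filter (fun κ => e κ = α), c κ, fun α => ?_, fun z => ?_⟩
  · exact (Finset.abs_sum_le_sum_abs _ _).trans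
      (Finset.sum_le_sum_of_subset_of_nonneg (Finset.filter_subset _ _) fun _ _ _ => abs_nonneg _)
  · rw [hp, ← Finset.sum_fiberwise s e]
    refine Finset.sum_congr rfl fun α _ => ?_
    rw [Finset.sum_mul]
    refine Finset.sum_congr rfl fun κ hκ => ?_
    rw [(Finset.mem_filter.1 hκ).2]

theorem IsBddPoly.mono_left (hp : IsBddPoly D M p) (h : D ≤ D') :
    IsBddPoly D' (Fintype.card (ι → Fin (D + 1)) * M) p := by
  obtain ⟨c, hc, hp⟩ := hp
  refine (isBddPoly_sum Finset.univ c (fun α i => Fin.castLE (Nat.succ_le_succ h) (α i))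
    (fun z => by simpa using hp z)).mono_right ?_
  refine (Finset.sum_le_card_nsmul _ _ M fun i _ => hc i).trans ?_
  rw [nsmul_eq_mul, Finset.card_univ]

theorem isBddPoly_const (D : ℕ) (c : ℝ) : IsBddPoly D |c| (fun _ : ι → ℝ => c) := by
  simpa using isBddPoly_sum (p := fun _ : ι → ℝ => c) (D := D) (Finset.univ : Finset Unit)
    (fun _ => c) (fun _ _ => 0) (fun z => by simp)

theorem isBddPoly_coord (i : ι) : IsBddPoly 1 1 (fun z : ι → ℝ => z i) := by
  have := isBddPoly_sum (p := fun z : ι → ℝ => z i) (D := 1) (Finset.univ : Finset Unit)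
    (fun _ => 1) (fun _ => Pi.single i 1) (fun z => by
      rw [Finset.univ_unique, Finset.sum_singleton, one_mul,
        Finset.prod_eq_single i (fun j _ hj => by simp [hj]) (by simp)]
      simp)
  simpa using this

theorem IsBddPoly.add (hp : IsBddPoly D M p) (hq : IsBddPoly D M' q) :
    IsBddPoly D (M + M') (fun z => p z + q z) := by
  obtain ⟨c, hc, hp⟩ := hp
  obtain ⟨c', hc', hq⟩ := hq
  refine ⟨fun α => c α + c' α, fun α => (abs_add_le _ _).trans (add_le_add (hc α) (hc' α)),
    fun z => ?_⟩
  simp only [hp, hq, ← Finset.sum_add_distrib]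
  exact Finset.sum_congr rfl fun α _ => by ring

theorem IsBddPoly.mul (hp : IsBddPoly D M p) (hq : IsBddPoly D' M' q) :
    IsBddPoly (D + D') (Fintype.card ((ι → Fin (D + 1)) × (ι → Fin (D' + 1))) * (M * M'))
      (fun z => p z * q z) := by
  have hM := hp.nonneg
  obtain ⟨c, hc, hp⟩ := hp
  obtain ⟨c', hc', hq⟩ := hq
  refine (isBddPoly_sum (D := D + D') Finset.univ
    (fun α : (ι → Fin (D + 1)) × (ι → Fin (D' + 1)) => c α.1 * c' α.2)
    (fun α i => ⟨α.1 i + α.2 i, by have := (α.1 i).2; have := (α.2 i).2; omega⟩)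
    (fun z => ?_)).mono_right ?_
  · rw [hp, hq, Finset.sum_mul_sum, Fintype.sum_prod_type]
    refine Finset.sum_congr rfl fun α _ => Finset.sum_congr rfl fun β _ => ?_
    simp only [pow_add, Finset.prod_mul_distrib]
    ring
  · refine (Finset.sum_le_card_nsmul _ _ (M * M') fun i _ => ?_).trans ?_
    · rw [abs_mul]
      exact mul_le_mul (hc _) (hc' _) (abs_nonneg _) hM
    · rw [nsmul_eq_mul, Finset.card_univ]

theorem IsBddPoly.abs_apply_le (hp : IsBddPoly D M p) {z : ι → ℝ} (hz : z ∈ Icc (0 : ι → ℝ) 1) :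
    |p z| ≤ Fintype.card (ι → Fin (D + 1)) * M := by
  have hM := hp.nonneg
  obtain ⟨c, hc, hp⟩ := hp
  rw [hp]
  refine (Finset.abs_sum_le_sum_abs _ _).trans ?_
  refine (Finset.sum_le_card_nsmul _ _ M fun α _ => ?_).trans ?_
  · rw [abs_mul, Finset.abs_prod]
    refine (mul_le_of_le_one_right (abs_nonneg _) ?_).trans (hc α)
    refine Finset.prod_le_one (fun _ _ => abs_nonneg _) fun i _ => ?_
    have h0 := hz.1 i
    rw [abs_pow]
    exact pow_le_one₀ (abs_nonneg _) (abs_le.2 ⟨by simp at h0; linarith, hz.2 i⟩)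
  · rw [nsmul_eq_mul, Finset.card_univ]

end Poly

theorem dist_le_one_of_mem_Icc {ι : Type*} [Fintype ι] {z a : ι → ℝ} (hz : z ∈ Icc (0 : ι → ℝ) 1)
    (ha : a ∈ Icc (0 : ι → ℝ) 1) : dist z a ≤ 1 := by
  rw [dist_pi_le_iff zero_le_one]
  intro i
  rw [Real.dist_eq, abs_le]
  have h1 := hz.1 i
  have h2 := hz.2 i
  have h3 := ha.1 i
  have h4 := ha.2 i
  simp only [Pi.zero_apply, Pi.one_apply] at h1 h2 h3 h4
  constructor <;> linarith

/-! ### Algebra of families with uniform local polynomial approximations -/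

section Loc

variable {ι T : Type*} [Fintype ι] [DecidableEq ι] {k D D' : ℕ} {a : T → ι → ℝ}
  {u w : T → (ι → ℝ) → ℝ}

/-- A family of functions with local polynomial approximations of order `k` at given base points,
uniformly over the family. -/
def ULoc (k D : ℕ) (a : T → ι → ℝ) (u : T → (ι → ℝ) → ℝ) : Prop :=
  ∃ M : ℝ, ∀ τ, ∃ p, IsBddPoly D M p ∧
    ∀ z ∈ Icc (0 : ι → ℝ) 1, |u τ z - p z| ≤ M * dist z (a τ) ^ k

theorem ULoc.congr (hu : ULoc k D a u) (h : ∀ τ, ∀ z ∈ Icc (0 : ι → ℝ) 1, w τ z = u τ z) :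
    ULoc k D a w := by
  obtain ⟨M, hM⟩ := hu
  refine ⟨M, fun τ => ?_⟩
  obtain ⟨p, hp, hup⟩ := hM τ
  exact ⟨p, hp, fun z hz => by rw [h τ z hz]; exact hup z hz⟩

theorem ULoc.mono (hu : ULoc k D a u) (h : D ≤ D') : ULoc k D' a u := by
  obtain ⟨M, hM⟩ := hu
  refine ⟨Fintype.card (ι → Fin (D + 1)) * M + M, fun τ => ?_⟩
  obtain ⟨p, hp, hup⟩ := hM τ
  have := hp.nonneg
  refine ⟨p, (hp.mono_left h).mono_right (by linarith), fun z hz => (hup z hz).trans ?_⟩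
  gcongr
  exact le_add_of_nonneg_left (by positivity)

theorem ULoc.of_close (hu : ULoc k D a u) (C : ℝ)
    (h : ∀ τ, ∀ z ∈ Icc (0 : ι → ℝ) 1, |w τ z - u τ z| ≤ C * dist z (a τ) ^ k) : ULoc k D a w := by
  obtain ⟨M, hM⟩ := hu
  refine ⟨M + |C|, fun τ => ?_⟩
  obtain ⟨p, hp, hup⟩ := hM τ
  refine ⟨p, hp.mono_right (by linarith [abs_nonneg C]), fun z hz => ?_⟩
  calc |w τ z - p z| ≤ |w τ z - u τ z| + |u τ z - p z| := abs_sub_le _ _ _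
    _ ≤ C * dist z (a τ) ^ k + M * dist z (a τ) ^ k := add_le_add (h τ z hz) (hup z hz)
    _ ≤ |C| * dist z (a τ) ^ k + M * dist z (a τ) ^ k := by gcongr; exact le_abs_self C
    _ = _ := by ring

theorem ULoc.of_isBddPoly (M : ℝ) (h : ∀ τ, IsBddPoly D M (u τ)) : ULoc k D a u := by
  refine ⟨M, fun τ => ⟨u τ, h τ, fun z _ => ?_⟩⟩
  have := (h τ).nonneg
  simp only [sub_self, abs_zero]
  positivity

theorem uLoc_const {c : T → ℝ} {C : ℝ} (h : ∀ τ, |c τ| ≤ C) : ULoc k D a (fun τ _ => c τ) :=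
  .of_isBddPoly C fun τ => (isBddPoly_const D (c τ)).mono_right (h τ)

theorem uLoc_coord (i : ι) : ULoc k 1 a (fun _ z => z i) :=
  .of_isBddPoly 1 fun _ => isBddPoly_coord i

theorem ULoc.add (hu : ULoc k D a u) (hw : ULoc k D a w) :
    ULoc k D a (fun τ z => u τ z + w τ z) := by
  obtain ⟨M, hM⟩ := hu
  obtain ⟨M', hM'⟩ := hw
  refine ⟨M + M', fun τ => ?_⟩
  obtain ⟨p, hp, hup⟩ := hM τ
  obtain ⟨q, hq, hwq⟩ := hM' τ
  refine ⟨_, hp.add hq, fun z hz => ?_⟩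
  rw [add_sub_add_comm, add_mul]
  exact (abs_add_le _ _).trans (add_le_add (hup z hz) (hwq z hz))

/-- From uw - pq = (u - p) w + p (w - q), where w and p are bounded on the cube. No truncation at
order k is needed, as the degree is allowed to grow. -/
theorem ULoc.mul (ha : ∀ τ, a τ ∈ Icc (0 : ι → ℝ) 1) (hu : ULoc k D a u) (hw : ULoc k D' a w) :
    ULoc k (D + D') a (fun τ z => u τ z * w τ z) := by
  obtain ⟨M, hM⟩ := hu
  obtain ⟨M', hM'⟩ := hw
  let C1 : ℝ := Fintype.card (ι → Fin (D + 1))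
  let C2 : ℝ := Fintype.card (ι → Fin (D' + 1))
  let C3 : ℝ := Fintype.card ((ι → Fin (D + 1)) × (ι → Fin (D' + 1)))
  refine ⟨C3 * (M * M') + M * (M' + C2 * M') + C1 * M * M', fun τ => ?_⟩
  obtain ⟨p, hp, hup⟩ := hM τ
  obtain ⟨q, hq, hwq⟩ := hM' τ
  have hM0 := hp.nonneg
  have hM0' := hq.nonneg
  refine ⟨_, (hp.mul hq).mono_right ?_, fun z hz => ?_⟩
  · change C3 * (M * M') ≤ _
    have : 0 ≤ M * (M' + C2 * M') + C1 * M * M' := by positivity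
    linarith
  · have hd : dist z (a τ) ^ k ≤ 1 := pow_le_one₀ dist_nonneg (dist_le_one_of_mem_Icc hz (ha τ))
    have hwz : |w τ z| ≤ M' + C2 * M' := by
      calc |w τ z| = |(w τ z - q z) + q z| := by ring_nf
        _ ≤ |w τ z - q z| + |q z| := abs_add_le _ _
        _ ≤ M' + C2 * M' := add_le_add ((hwq z hz).trans (by nlinarith)) (hq.abs_apply_le hz)
    calc |u τ z * w τ z - p z * q z| = |(u τ z - p z) * w τ z + p z * (w τ z - q z)| := by ring_nf
      _ ≤ |u τ z - p z| * |w τ z| + |p z| * |w τ z - q z| := by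
        rw [← abs_mul, ← abs_mul]; exact abs_add_le _ _
      _ ≤ (M * dist z (a τ) ^ k) * (M' + C2 * M') + (C1 * M) * (M' * dist z (a τ) ^ k) := by
        refine add_le_add (mul_le_mul (hup z hz) hwz (abs_nonneg _) (by positivity))
          (mul_le_mul (hp.abs_apply_le hz) (hwq z hz) (abs_nonneg _) (by positivity))
      _ = (M * (M' + C2 * M') + C1 * M * M') * dist z (a τ) ^ k := by ring
      _ ≤ _ := by
        refine mul_le_mul_of_nonneg_right ?_ (by positivity)
        have : 0 ≤ C3 * (M * M') := by positivity
        linarith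

theorem ULoc.const_mul {c : T → ℝ} {C : ℝ} (ha : ∀ τ, a τ ∈ Icc (0 : ι → ℝ) 1)
    (h : ∀ τ, |c τ| ≤ C) (hu : ULoc k D a u) : ULoc k D a (fun τ z => c τ * u τ z) := by
  have := (uLoc_const (D := 0) h).mul ha hu
  rwa [zero_add] at this

theorem ULoc.sub (ha : ∀ τ, a τ ∈ Icc (0 : ι → ℝ) 1) (hu : ULoc k D a u) (hw : ULoc k D a w) :
    ULoc k D a (fun τ z => u τ z - w τ z) :=
  (hu.add (hw.const_mul (c := fun _ => -1) (C := 1) ha (by simp))).congr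
    fun τ z _ => by ring

theorem ULoc.sum {κ : Type*} (s : Finset κ) {u : κ → T → (ι → ℝ) → ℝ}
    (h : ∀ i ∈ s, ULoc k D a (u i)) : ULoc k D a (fun τ z => ∑ i ∈ s, u i τ z) := by
  classical
  induction s using Finset.induction_on with
  | empty => simpa using uLoc_const (c := fun _ : T => 0) (C := 0) (by simp)
  | insert i s hi ih =>
    simp only [Finset.sum_insert hi]
    exact (h i (by simp)).add (ih fun j hj => h j (by simp [hj]))

theorem ULoc.prod {κ : Type*} (s : Finset κ) {u : κ → T → (ι → ℝ) → ℝ}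
    (ha : ∀ τ, a τ ∈ Icc (0 : ι → ℝ) 1) (h : ∀ i ∈ s, ULoc k D a (u i)) :
    ULoc k (s.card * D) a (fun τ z => ∏ i ∈ s, u i τ z) := by
  classical
  induction s using Finset.induction_on with
  | empty => simpa using uLoc_const (c := fun _ : T => 1) (C := 1) (by simp)
  | insert i s hi ih =>
    simp only [Finset.prod_insert hi, Finset.card_insert_of_notMem hi, add_mul, one_mul]
    rw [add_comm]
    exact (h i (by simp)).mul ha (ih fun j hj => h j (by simp [hj]))

theorem ULoc.pow (ha : ∀ τ, a τ ∈ Icc (0 : ι → ℝ) 1) (h : ULoc k D a u) (n : ℕ) :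
    ULoc k (n * D) a (fun τ z => u τ z ^ n) := by
  simpa using ULoc.prod (Finset.range n) ha (fun _ _ => h)

theorem inv_eq_geom_sum_add {K : Type*} [Field K] {c u : K} (hc : c ≠ 0) (hu : u ≠ 0) (k : ℕ) :
    u⁻¹ = ∑ n ∈ Finset.range k, (c⁻¹) ^ (n + 1) * (c - u) ^ n + (c⁻¹ * (c - u)) ^ k * u⁻¹ := by
  induction k with
  | zero => simp
  | succ k ih =>
    rw [Finset.sum_range_succ, add_assoc]
    nth_rewrite 1 [ih]
    congr 1
    have : u⁻¹ = c⁻¹ + c⁻¹ * (c - u) * u⁻¹ := by field_simp; ring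
    nth_rewrite 1 [this]
    generalize c - u = s
    ring

/-- The reciprocal is a geometric series in (u(a) - u) / u(a), cut after k terms. The remainder is
of order k at a because u(a) - u is of order one there, and the lower bound keeps all factors under
control. -/
theorem ULoc.inv (ha : ∀ τ, a τ ∈ Icc (0 : ι → ℝ) 1) (hu : ULoc k D a u) {L₂ K : ℝ} (hL : 0 < L₂)
    (hlow : ∀ τ, ∀ z ∈ Icc (0 : ι → ℝ) 1, L₂ ≤ u τ z)
    (hlip : ∀ τ, ∀ z ∈ Icc (0 : ι → ℝ) 1, |u τ (a τ) - u τ z| ≤ K * dist z (a τ)) :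
    ULoc k (k * D) a (fun τ z => (u τ z)⁻¹) := by
  have hc : ∀ τ, |(u τ (a τ))⁻¹| ≤ L₂⁻¹ := by
    intro τ
    have := hlow τ _ (ha τ)
    rw [abs_of_pos (inv_pos.2 (hL.trans_le this))]
    gcongr
  have hcb : ∃ C, ∀ τ, |u τ (a τ)| ≤ C := by
    obtain ⟨M, hM⟩ := hu
    refine ⟨M + Fintype.card (ι → Fin (D + 1)) * M, fun τ => ?_⟩
    obtain ⟨p, hp, hup⟩ := hM τ
    have := hp.nonneg
    calc |u τ (a τ)| = |(u τ (a τ) - p (a τ)) + p (a τ)| := by ring_nf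
      _ ≤ |u τ (a τ) - p (a τ)| + |p (a τ)| := abs_add_le _ _
      _ ≤ M + Fintype.card (ι → Fin (D + 1)) * M :=
        add_le_add ((hup _ (ha τ)).trans (mul_le_of_le_one_right this
          (pow_le_one₀ dist_nonneg (dist_le_one_of_mem_Icc (ha τ) (ha τ))))) (hp.abs_apply_le (ha τ))
  obtain ⟨C, hC⟩ := hcb
  have hs : ULoc k D a (fun τ z => u τ (a τ) - u τ z) := (uLoc_const hC).sub ha hu
  have hsum : ULoc k (k * D) a (fun τ z => ∑ n ∈ Finset.range k,
      (u τ (a τ))⁻¹ ^ (n + 1) * (u τ (a τ) - u τ z) ^ n) := by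
    refine ULoc.sum _ fun n hn => ?_
    refine ULoc.const_mul (C := L₂⁻¹ ^ (n + 1)) ha (fun τ => ?_) ((hs.pow ha n).mono ?_)
    · rw [abs_pow]; exact pow_le_pow_left₀ (abs_nonneg _) (hc τ) _
    · exact Nat.mul_le_mul_right _ (Finset.mem_range.1 hn).le
  refine hsum.of_close ((L₂⁻¹ * K) ^ k * L₂⁻¹) fun τ z hz => ?_
  have h1 := hlow τ _ (ha τ)
  have h2 := hlow τ z hz
  have h3 := inv_eq_geom_sum_add (hL.trans_le h1).ne' (hL.trans_le h2).ne' k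
  rw [sub_eq_of_eq_add' h3, abs_mul, abs_pow, abs_mul, abs_of_pos (inv_pos.2 (hL.trans_le h2))]
  calc (|(u τ (a τ))⁻¹| * |u τ (a τ) - u τ z|) ^ k * (u τ z)⁻¹
      ≤ (L₂⁻¹ * (K * dist z (a τ))) ^ k * L₂⁻¹ := by
        have hK := (abs_nonneg _).trans (hlip τ z hz)
        have hL' : 0 ≤ L₂⁻¹ := by positivity
        refine mul_le_mul (pow_le_pow_left₀ (by positivity) (mul_le_mul (hc τ) (hlip τ z hz)
          (abs_nonneg _) hL') k) (by gcongr) (inv_nonneg.2 (hL.trans_le h2).le) (by positivity)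
    _ = _ := by rw [← mul_assoc, mul_pow]; ring

end Loc

/-! ### Taylor expansion of densities on the cube -/

/-- Restriction to the segment from b to y reduces this to the Taylor formula in one variable: the
derivatives of the restriction are the multilinear derivatives evaluated at y - b. The factor 1/k!
of the remainder is dropped. -/
theorem taylor_bound_of_iteratedFDerivWithin {E : Type*} [NormedAddCommGroup E] [NormedSpace ℝ E]
    {k : ℕ} {q : E → ℝ} {S : Set E} (hS : Convex ℝ S) (hSd : UniqueDiffOn ℝ S)
    (hq : ContDiffOn ℝ (k + 1 : ℕ) q S) {C : ℝ}
    (hC : ∀ x ∈ S, ‖iteratedFDerivWithin ℝ (k + 1) q S x‖ ≤ C) {b y : E} (hb : b ∈ S) (hy : y ∈ S) :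
    |q y - ∑ n ∈ Finset.range (k + 1), ((n.factorial : ℝ))⁻¹ *
      iteratedFDerivWithin ℝ n q S b (fun _ => y - b)| ≤ C * ‖y - b‖ ^ (k + 1) := by
  have hC0 : 0 ≤ C := (norm_nonneg _).trans (hC b hb)
  let g : ℝ →ᴬ[ℝ] E := ContinuousAffineMap.lineMap b y
  have hg : ∀ t, g t = b + t • (y - b) := fun t => by
    simp [g, ContinuousAffineMap.coe_lineMap_eq, AffineMap.lineMap_apply, add_comm]
  have hglin : ∀ t, g.contLinear t = t • (y - b) := by
    intro t
    have := g.contLinear_map_vsub t 0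
    simp only [vsub_eq_sub, sub_zero, hg, zero_smul, add_zero, add_sub_cancel_left] at this
    exact this
  have hmap : Icc (0 : ℝ) 1 ⊆ g ⁻¹' S := by
    intro t ht
    rw [mem_preimage, hg]
    exact hS.add_smul_sub_mem hb hy ht
  have hT := ((hq.ftaylorSeriesWithin hSd).comp_continuousAffineMap g).mono hmap
  have hud := uniqueDiffOn_Icc (zero_lt_one (α := ℝ))
  have hit : ∀ n ≤ k + 1, ∀ t ∈ Icc (0 : ℝ) 1, iteratedDerivWithin n (q ∘ g) (Icc 0 1) t =
      iteratedFDerivWithin ℝ n q S (g t) (fun _ => y - b) := by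
    intro n hn t ht
    rw [iteratedDerivWithin_eq_iteratedFDerivWithin,
      ← hT.eq_iteratedFDerivWithin_of_uniqueDiffOn (by exact_mod_cast hn) hud ht]
    simp [hglin, ftaylorSeriesWithin]
  have hcd : ContDiffOn ℝ (k + 1) (q ∘ g) (Icc 0 1) := by
    exact_mod_cast hT.contDiffOn (n := ((k + 1 : ℕ) : ℕ∞))
  have h := taylor_mean_remainder_bound (f := q ∘ g) (a := 0) (b := 1) (x := 1) (n := k)
    (C := C * ‖y - b‖ ^ (k + 1)) zero_le_one hcd (by simp) (by
      intro t ht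
      rw [hit _ le_rfl t ht]
      refine (ContinuousMultilinearMap.le_opNorm _ _).trans ?_
      rw [Finset.prod_const, Finset.card_univ, Fintype.card_fin]
      gcongr
      exact hC _ (hmap ht))
  rw [taylor_within_apply] at h
  simp only [Function.comp_apply, hg 1, one_smul, add_sub_cancel, sub_zero, one_pow, mul_one,
    smul_eq_mul, Real.norm_eq_abs] at h
  have e : ∑ n ∈ Finset.range (k + 1), ((n.factorial : ℝ))⁻¹ *
      iteratedFDerivWithin ℝ n q S b (fun _ => y - b) = ∑ n ∈ Finset.range (k + 1),
      ((n.factorial : ℝ))⁻¹ * iteratedDerivWithin n (q ∘ g) (Icc 0 1) 0 := by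
    refine Finset.sum_congr rfl fun n hn => ?_
    rw [hit n (Finset.mem_range.1 hn).le 0 (by simp), hg 0, zero_smul, add_zero]
  rw [e]
  exact h.trans (div_le_self (by positivity) (by exact_mod_cast Nat.succ_le_of_lt (Nat.factorial_pos k)))

theorem convex_unitCube (d : ℕ) : Convex ℝ (unitCube d) := by
  intro x hx y hy a b ha hb hab i
  have := convex_Icc (0 : ℝ) 1 (hx i) (hy i) ha hb hab
  simpa using this

theorem uniqueDiffOn_unitCube (d : ℕ) : UniqueDiffOn ℝ (unitCube d) := by
  refine uniqueDiffOn_convex (convex_unitCube d) ⟨WithLp.toLp 2 (fun _ => 1 / 2), ?_⟩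
  have ho : IsOpen {x : EuclideanSpace ℝ (Fin d) | ∀ i, x i ∈ Ioo (0 : ℝ) 1} := by
    simp only [ofPred_forall]
    exact isOpen_iInter_of_finite fun i => isOpen_Ioo.preimage (by fun_prop)
  refine interior_maximal (t := {x : EuclideanSpace ℝ (Fin d) | ∀ i, x i ∈ Ioo (0 : ℝ) 1})
    (fun x hx i => Ioo_subset_Icc_self (hx i)) ho ?_
  intro i
  norm_num

theorem isClosed_unitCube (d : ℕ) : IsClosed (unitCube d) := by
  simp only [unitCube, ofPred_forall]
  exact isClosed_iInter fun i => isClosed_Icc.preimage (by fun_prop)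

theorem euclidean_norm_le_sum {d : ℕ} (x : EuclideanSpace ℝ (Fin d)) : ‖x‖ ≤ ∑ i, |x i| := by
  have h := (EuclideanSpace.basisFun (Fin d) ℝ).sum_repr x
  conv_lhs => rw [← h]
  refine (norm_sum_le _ _).trans (le_of_eq ?_)
  refine Finset.sum_congr rfl fun i _ => ?_
  rw [norm_smul, OrthonormalBasis.norm_eq_one, mul_one]
  simp

/-- Turns the terms of the Taylor expansion into monomials with explicit coefficients. -/
theorem multilinear_apply_eq_sum {d n : ℕ}
    (m : ContinuousMultilinearMap ℝ (fun _ : Fin n => EuclideanSpace ℝ (Fin d)) ℝ)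
    (w : EuclideanSpace ℝ (Fin d)) :
    m (fun _ => w) = ∑ r : Fin n → Fin d, (∏ l, w (r l)) *
      m (fun l => EuclideanSpace.basisFun (Fin d) ℝ (r l)) := by
  have h := (EuclideanSpace.basisFun (Fin d) ℝ).sum_repr w
  conv_lhs => rw [← h]
  rw [m.map_sum]
  refine Finset.sum_congr rfl fun r _ => ?_
  rw [m.map_smul_univ]
  simp

namespace IsCubeDensity

variable {d k : ℕ} {L₁ L₂ : ℝ} {q : EuclideanSpace ℝ (Fin d) → ℝ}

theorem norm_iteratedFDerivWithin_le (hq : IsCubeDensity k L₁ L₂ q) (hL : 0 ≤ L₁) {n : ℕ}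
    (hn : n ≤ k) {x : EuclideanSpace ℝ (Fin d)} (hx : x ∈ unitCube d) :
    ‖iteratedFDerivWithin ℝ n q (unitCube d) x‖ ≤ L₁ := by
  have h : ‖iteratedFDerivWithin ℝ n q (unitCube d) x‖ₑ ≤ ENNReal.ofReal L₁ := by
    refine le_trans ?_ hq.norm_le
    exact le_iSup₂_of_le n hn (le_iSup₂_of_le x hx le_rfl)
  rw [← ofReal_norm] at h
  exact (ENNReal.ofReal_le_ofReal_iff hL).1 h

theorem abs_le (hq : IsCubeDensity k L₁ L₂ q) (hL : 0 ≤ L₁) {x : EuclideanSpace ℝ (Fin d)}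
    (hx : x ∈ unitCube d) : |q x| ≤ L₁ := by
  have := hq.norm_iteratedFDerivWithin_le hL (Nat.zero_le k) hx
  rwa [norm_iteratedFDerivWithin_zero, Real.norm_eq_abs] at this

theorem taylor (hq : IsCubeDensity k L₁ L₂ q) (hL : 0 ≤ L₁) {n : ℕ} (hn : n + 1 ≤ k)
    {b y : EuclideanSpace ℝ (Fin d)} (hb : b ∈ unitCube d) (hy : y ∈ unitCube d) :
    |q y - ∑ n ∈ Finset.range (n + 1), ((n.factorial : ℝ))⁻¹ *
      iteratedFDerivWithin ℝ n q (unitCube d) b (fun _ => y - b)| ≤ L₁ * ‖y - b‖ ^ (n + 1) :=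
  taylor_bound_of_iteratedFDerivWithin (convex_unitCube d) (uniqueDiffOn_unitCube d)
    (hq.contDiffOn.of_le (by exact_mod_cast hn))
    (fun _ hx => hq.norm_iteratedFDerivWithin_le hL hn hx) hb hy

end IsCubeDensity

/-! ### Averages of densities over diagonal affine maps of the cube -/

/-- The diagonal affine map `x ↦ (lᵢ xᵢ + bᵢ)ᵢ`. -/
def diagAffine {d : ℕ} (l b : Fin d → ℝ) (x : EuclideanSpace ℝ (Fin d)) :
    EuclideanSpace ℝ (Fin d) :=
  WithLp.toLp 2 (fun i => l i * x i + b i)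

/-- The spatial part of a point `(x, t)`. -/
def spatial {d : ℕ} (z : Fin (d + 1) → ℝ) : EuclideanSpace ℝ (Fin d) :=
  WithLp.toLp 2 (fun i => z i.castSucc)

theorem spatial_mem {d : ℕ} {z : Fin (d + 1) → ℝ} (hz : z ∈ Icc (0 : Fin (d + 1) → ℝ) 1) :
    spatial z ∈ unitCube d := fun i => ⟨hz.1 i.castSucc, hz.2 i.castSucc⟩

/-- A probability space of diagonal affine maps of the cube into itself. -/
structure IsCubeAverage {d : ℕ} {Ω : Type*} [MeasurableSpace Ω] (P : Measure Ω)
    (l b : Ω → Fin d → ℝ) : Prop where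
  prob : IsProbabilityMeasure P
  meas_l : Measurable l
  meas_b : Measurable b
  l_mem : ∀ᵐ ω ∂P, ∀ i, l ω i ∈ Icc (0 : ℝ) 1
  maps : ∀ᵐ ω ∂P, ∀ x ∈ unitCube d, diagAffine (l ω) (b ω) x ∈ unitCube d

section Average

variable {d k : ℕ} {L₁ L₂ : ℝ} {q : EuclideanSpace ℝ (Fin d) → ℝ} {Ω : Type*} [MeasurableSpace Ω]
  {P : Measure Ω} {l b : Ω → Fin d → ℝ}

theorem diagAffine_sub {l b : Fin d → ℝ} (x y : EuclideanSpace ℝ (Fin d)) (i : Fin d) :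
    (diagAffine l b x - diagAffine l b y) i = l i * (x i - y i) := by
  simp [diagAffine]; ring

theorem norm_diagAffine_sub_le {l b : Fin d → ℝ} (hl : ∀ i, l i ∈ Icc (0 : ℝ) 1)
    (z a : Fin (d + 1) → ℝ) :
    ‖diagAffine l b (spatial z) - diagAffine l b (spatial a)‖ ≤ d * dist z a := by
  refine (euclidean_norm_le_sum _).trans ?_
  refine (Finset.sum_le_card_nsmul _ _ (dist z a) fun i _ => ?_).trans (by simp)
  rw [diagAffine_sub, abs_mul, abs_of_nonneg (hl i).1]
  refine (mul_le_of_le_one_left (abs_nonneg _) (hl i).2).trans ?_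
  exact dist_le_pi_dist z a i.castSucc

theorem IsCubeAverage.aestronglyMeasurable (hA : IsCubeAverage P l b)
    {f : EuclideanSpace ℝ (Fin d) → ℝ} (hf : ContinuousOn f (unitCube d))
    {x : EuclideanSpace ℝ (Fin d)} (hx : x ∈ unitCube d) :
    AEStronglyMeasurable (fun ω => f (diagAffine (l ω) (b ω) x)) P := by
  have hm : Measurable fun ω => diagAffine (l ω) (b ω) x := by
    have h1 := hA.meas_l
    have h2 := hA.meas_b
    unfold diagAffine
    refine (WithLp.measurable_toLp 2 _).comp (measurable_pi_lambda _ fun i => ?_)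
    exact ((measurable_pi_apply i).comp h1).mul_const _ |>.add ((measurable_pi_apply i).comp h2)
  classical
  have hf' : Measurable ((unitCube d).piecewise f fun _ => 0) :=
    hf.measurable_piecewise continuousOn_const (isClosed_unitCube d).measurableSet
  refine (hf'.comp hm).aestronglyMeasurable.congr ?_
  filter_upwards [hA.maps] with ω h
  simp [Set.piecewise_eq_of_mem _ _ _ (h x hx)]

theorem IsCubeAverage.integrable (hA : IsCubeAverage P l b)
    {f : EuclideanSpace ℝ (Fin d) → ℝ} (hf : ContinuousOn f (unitCube d)) {C : ℝ}
    (hC : ∀ x ∈ unitCube d, |f x| ≤ C) {x : EuclideanSpace ℝ (Fin d)} (hx : x ∈ unitCube d) :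
    Integrable (fun ω => f (diagAffine (l ω) (b ω) x)) P := by
  have := hA.prob
  refine Integrable.of_bound (hA.aestronglyMeasurable hf hx) C ?_
  filter_upwards [hA.maps] with ω h
  exact hC _ (h x hx)

/-- Taylor expansion is performed for each ω at the image of the base point and then integrated. The
maps being diagonal affine with factors at most 1, the integrated expansion is again polynomial in z
with coefficients bounded by L₁, and distances grow at most by the factor d. Differentiation under
the integral is not needed. -/
theorem IsCubeAverage.uLoc {T : Type*} (hA : IsCubeAverage P l b)
    {q : T → EuclideanSpace ℝ (Fin d) → ℝ} (hq : ∀ τ, IsCubeDensity k L₁ L₂ (q τ)) (hL : 0 ≤ L₁)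
    (hk : 1 ≤ k) {a : T → Fin (d + 1) → ℝ} (ha : ∀ τ, a τ ∈ Icc (0 : Fin (d + 1) → ℝ) 1) :
    ULoc k k a (fun τ z => ∫ ω, q τ (diagAffine (l ω) (b ω) (spatial z)) ∂P) := by
  have := hA.prob
  obtain ⟨k, rfl⟩ : ∃ k', k = k' + 1 := ⟨k - 1, by omega⟩
  let A := fun ω x => diagAffine (l ω) (b ω) x
  -- The coefficient contributed by ω to the monomial of the multi-index r; the product collects the
  -- factors by which the map contracts the increments.
  let F : T → (n : ℕ) → (Fin n → Fin d) → Ω → ℝ := fun τ n r ω => ((n.factorial : ℝ))⁻¹ *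
    (iteratedFDerivWithin ℝ n (q τ) (unitCube d) (A ω (spatial (a τ)))
      (fun i => EuclideanSpace.basisFun (Fin d) ℝ (r i)) * ∏ i, l ω (r i))
  have hder : ∀ τ n (r : Fin n → Fin d), n ≤ k + 1 → ∀ x ∈ unitCube d,
      |iteratedFDerivWithin ℝ n (q τ) (unitCube d) x
        (fun i => EuclideanSpace.basisFun (Fin d) ℝ (r i))| ≤ L₁ := by
    intro τ n r hn x hx
    have h := (iteratedFDerivWithin ℝ n (q τ) (unitCube d) x).le_opNorm
      (fun i => EuclideanSpace.basisFun (Fin d) ℝ (r i))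
    simp only [OrthonormalBasis.norm_eq_one, Finset.prod_const_one, mul_one] at h
    exact h.trans ((hq τ).norm_iteratedFDerivWithin_le hL hn hx)
  have hFb : ∀ τ n r, n ≤ k + 1 → ∀ᵐ ω ∂P, ‖F τ n r ω‖ ≤ L₁ := by
    intro τ n r hn
    filter_upwards [hA.maps, hA.l_mem] with ω h hl
    have h1 := hder τ n r hn _ (h _ (spatial_mem (ha τ)))
    have h2 : |∏ i : Fin n, l ω (r i)| ≤ 1 := by
      rw [Finset.abs_prod]
      refine Finset.prod_le_one (fun _ _ => abs_nonneg _) fun i _ => ?_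
      rw [abs_of_nonneg (hl _).1]; exact (hl _).2
    have h3 : ((n.factorial : ℝ))⁻¹ ≤ 1 :=
      inv_le_one_of_one_le₀ (by exact_mod_cast Nat.succ_le_of_lt (Nat.factorial_pos n))
    rw [Real.norm_eq_abs, abs_mul, abs_mul, abs_of_nonneg (by positivity)]
    calc ((n.factorial : ℝ))⁻¹ * (_ * _) ≤ 1 * (L₁ * 1) := by
          refine mul_le_mul h3 (mul_le_mul h1 h2 (abs_nonneg _) hL) (by positivity) zero_le_one
      _ = L₁ := by ring
  have hFi : ∀ τ n r, n ≤ k + 1 → Integrable (F τ n r) P := by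
    intro τ n r hn
    refine Integrable.of_bound (AEStronglyMeasurable.const_mul (AEStronglyMeasurable.mul ?_ ?_) _)
      L₁ (hFb τ n r hn)
    · refine hA.aestronglyMeasurable (f := fun x => iteratedFDerivWithin ℝ n (q τ) (unitCube d) x
        (fun i => EuclideanSpace.basisFun (Fin d) ℝ (r i))) ?_ (spatial_mem (ha τ))
      have := (hq τ).contDiffOn.continuousOn_iteratedFDerivWithin (m := n) (by exact_mod_cast hn)
        (uniqueDiffOn_unitCube d)
      exact (ContinuousMultilinearMap.apply ℝ (fun _ : Fin n => EuclideanSpace ℝ (Fin d)) ℝ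
        (fun i => EuclideanSpace.basisFun (Fin d) ℝ (r i))).continuous.comp_continuousOn this
    · refine (Finset.measurable_prod _ fun i _ => ?_).aestronglyMeasurable
      exact (measurable_pi_apply (r i)).comp hA.meas_l
  have hint : ∀ τ {x}, x ∈ unitCube d → Integrable (fun ω => q τ (A ω x)) P :=
    fun τ x hx => hA.integrable (hq τ).contDiffOn.continuousOn (fun x hx => (hq τ).abs_le hL hx) hx
  have hpoly : ULoc (k + 1) (k + 1) a (fun τ z => ∑ n ∈ Finset.range (k + 1),
      ∑ r : Fin n → Fin d, (∫ ω, F τ n r ω ∂P) * ∏ i, (z (r i).castSucc - a τ (r i).castSucc)) := by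
    refine ULoc.sum _ fun n hn => ULoc.sum _ fun r _ => ?_
    have hn' := (Finset.mem_range.1 hn).le
    refine ULoc.const_mul (C := L₁) ha (fun τ => ?_) (ULoc.mono (ULoc.prod (D := 1) Finset.univ ha fun i _ => ?_) ?_)
    · simpa using norm_integral_le_of_norm_le_const (hFb τ n r hn')
    · refine ((uLoc_coord (r i).castSucc)).sub ha (uLoc_const (C := 1) fun τ => ?_)
      exact _root_.abs_le.2 ⟨by have := (ha τ).1 (r i).castSucc; simp only [Pi.zero_apply] at this; linarith,
        (ha τ).2 _⟩
    · simpa using hn'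
  refine hpoly.of_close (L₁ * d ^ (k + 1)) fun τ z hz => ?_
  have e : ∑ n ∈ Finset.range (k + 1), ∑ r : Fin n → Fin d, (∫ ω, F τ n r ω ∂P) *
      ∏ i, (z (r i).castSucc - a τ (r i).castSucc) =
      ∫ ω, ∑ n ∈ Finset.range (k + 1), ∑ r : Fin n → Fin d, F τ n r ω *
        ∏ i, (z (r i).castSucc - a τ (r i).castSucc) ∂P := by
    rw [integral_finsetSum _ fun n hn => integrable_finsetSum _ fun r _ =>
      (hFi τ n r (Finset.mem_range.1 hn).le).mul_const _]
    refine Finset.sum_congr rfl fun n hn => ?_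
    rw [integral_finsetSum _ fun r _ => (hFi τ n r (Finset.mem_range.1 hn).le).mul_const _]
    exact Finset.sum_congr rfl fun r _ => (integral_mul_const _ _).symm
  rw [e, ← integral_sub (hint τ (spatial_mem hz)) (integrable_finsetSum _ fun n hn =>
    integrable_finsetSum _ fun r _ => (hFi τ n r (Finset.mem_range.1 hn).le).mul_const _)]
  have hb : ∀ᵐ ω ∂P, ‖q τ (A ω (spatial z)) - ∑ n ∈ Finset.range (k + 1),
      ∑ r : Fin n → Fin d, F τ n r ω * ∏ i, (z (r i).castSucc - a τ (r i).castSucc)‖ ≤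
      L₁ * d ^ (k + 1) * dist z (a τ) ^ (k + 1) := ?_
  · simpa using norm_integral_le_of_norm_le_const hb
  filter_upwards [hA.maps, hA.l_mem] with ω h hl
  have ht := (hq τ).taylor hL le_rfl (h _ (spatial_mem (ha τ))) (h _ (spatial_mem hz))
  refine le_trans (le_of_eq ?_) (ht.trans ?_)
  · rw [Real.norm_eq_abs]
    congr 2
    refine Finset.sum_congr rfl fun n _ => ?_
    rw [multilinear_apply_eq_sum, Finset.mul_sum]
    refine Finset.sum_congr rfl fun r _ => ?_
    simp only [diagAffine_sub, Finset.prod_mul_distrib, F]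
    simp only [spatial, A]
    ring
  · rw [mul_assoc, ← mul_pow]
    gcongr
    exact norm_diagAffine_sub_le hl z (a τ)

end Average

/-! ### The uniform measure on the cube, in coordinates -/

/-- The uniform probability measure on `[0,1]^d`, in coordinates. -/
noncomputable def unifCube (d : ℕ) : Measure (Fin d → ℝ) :=
  Measure.pi fun _ => volume.restrict (Icc (0 : ℝ) 1)

instance isProbabilityMeasure_restrict_Icc :
    IsProbabilityMeasure (volume.restrict (Icc (0 : ℝ) 1)) := ⟨by simp⟩

instance (d : ℕ) : IsProbabilityMeasure (unifCube d) := by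
  unfold unifCube; infer_instance

theorem unifCube_eq_restrict (d : ℕ) :
    unifCube d = volume.restrict {r : Fin d → ℝ | ∀ i, r i ∈ Icc (0 : ℝ) 1} := by
  unfold unifCube
  rw [← Measure.restrict_pi_pi]
  congr 1
  ext r
  simp only [Set.mem_pi, mem_univ, true_implies]
  rfl

theorem ae_unifCube_mem (d : ℕ) : ∀ᵐ r ∂unifCube d, ∀ i, r i ∈ Icc (0 : ℝ) 1 := by
  rw [unifCube_eq_restrict]
  have h : MeasurableSet {r : Fin d → ℝ | ∀ i, r i ∈ Icc (0 : ℝ) 1} := by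
    rw [ofPred_forall]
    exact MeasurableSet.iInter fun i => measurableSet_Icc.preimage (measurable_pi_apply i)
  exact ae_restrict_mem h

theorem integral_unitCube {d : ℕ} (F : EuclideanSpace ℝ (Fin d) → ℝ) :
    ∫ x in unitCube d, F x = ∫ r, F (WithLp.toLp 2 r) ∂unifCube d := by
  rw [unifCube_eq_restrict]
  exact ((PiLp.volume_preserving_toLp (Fin d)).setIntegral_preimage_emb
    (MeasurableEquiv.toLp 2 (Fin d → ℝ)).measurableEmbedding F (unitCube d)).symm

/-- Resampling one coordinate independently preserves a product of probability measures. This allows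
Fubini in a single coordinate without splitting the cube into factors. -/
theorem measurePreserving_update {d : ℕ} (j : Fin d) :
    MeasurePreserving (fun p : ℝ × (Fin d → ℝ) => Function.update p.2 j p.1)
      ((volume.restrict (Icc (0 : ℝ) 1)).prod (unifCube d)) (unifCube d) := by
  have hm : Measurable (fun p : ℝ × (Fin d → ℝ) => Function.update p.2 j p.1) := by
    refine measurable_pi_lambda _ fun i => ?_
    by_cases h : i = j
    · subst h; simpa using measurable_fst
    · simp only [Function.update_of_ne h]
      fun_prop
  refine ⟨hm, ?_⟩
  unfold unifCube
  symm
  refine Measure.pi_eq fun s hs => ?_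
  rw [Measure.map_apply hm (MeasurableSet.univ_pi hs)]
  have : (fun p : ℝ × (Fin d → ℝ) => Function.update p.2 j p.1) ⁻¹' (Set.pi univ s) =
      s j ×ˢ Set.pi univ (Function.update s j univ) := by
    ext ⟨x, r⟩
    simp only [mem_preimage, Set.mem_pi, mem_univ, true_implies, mem_prod]
    constructor
    · intro h
      refine ⟨by simpa using h j, fun i => ?_⟩
      by_cases hi : i = j
      · subst hi; simp
      · simpa [hi] using h i
    · rintro ⟨h1, h2⟩ i
      by_cases hi : i = j
      · subst hi; simpa using h1
      · simpa [hi] using h2 i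
  rw [this, Measure.prod_prod, Measure.pi_pi, ← Finset.mul_prod_erase _ _ (Finset.mem_univ j),
    ← Finset.mul_prod_erase Finset.univ (fun i => volume.restrict (Icc (0 : ℝ) 1) (s i))
      (Finset.mem_univ j)]
  simp only [Function.update_self, measure_univ, one_mul]
  congr 1
  refine Finset.prod_congr rfl fun i hi => ?_
  rw [Function.update_of_ne (Finset.ne_of_mem_erase hi)]

theorem integral_update_unifCube {d : ℕ} (j : Fin d) {F : (Fin d → ℝ) → ℝ}
    (hF : Integrable F (unifCube d)) :
    ∫ r, (∫ s in Icc (0 : ℝ) 1, F (Function.update r j s)) ∂unifCube d = ∫ r, F r ∂unifCube d := by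
  have h := measurePreserving_update j
  have hi := (h.integrable_comp hF.aestronglyMeasurable).2 hF
  have e := integral_map h.measurable.aemeasurable
    (by rw [h.map_eq]; exact hF.aestronglyMeasurable)
  rw [h.map_eq] at e
  exact (integral_prod_symm _ hi).symm.trans e.symm

theorem integral_Icc_update_unifCube {d : ℕ} (j : Fin d) {F : (Fin d → ℝ) → ℝ}
    (hF : Integrable F (unifCube d)) :
    ∫ s in Icc (0 : ℝ) 1, ∫ r, F (Function.update r j s) ∂unifCube d = ∫ r, F r ∂unifCube d := by
  have h := measurePreserving_update j
  have hi := (h.integrable_comp hF.aestronglyMeasurable).2 hF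
  rw [← integral_update_unifCube j hF]
  exact integral_integral_swap (f := fun s r => F (Function.update r j s)) hi

/-! ### Partial averages and the triangular flux -/

section Flux

variable {d : ℕ} {q : EuclideanSpace ℝ (Fin d) → ℝ}

/-- The average of `q` over all coordinates with index at least `j`. -/
noncomputable def margAvg (q : EuclideanSpace ℝ (Fin d) → ℝ) (j : ℕ)
    (x : EuclideanSpace ℝ (Fin d)) : ℝ :=
  ∫ r, q (WithLp.toLp 2 fun i => if (i : ℕ) < j then x i else r i) ∂unifCube d

/-- The triangular vector field whose divergence on the cube is `q - ∫ q`. -/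
noncomputable def flux (q : EuclideanSpace ℝ (Fin d) → ℝ) (j : Fin d)
    (x : EuclideanSpace ℝ (Fin d)) : ℝ :=
  x j * ((∫ s in Icc (0 : ℝ) 1, margAvg q (j + 1) (WithLp.toLp 2 (Function.update x.ofLp j (s * x j))))
    - margAvg q j x)

theorem margAvg_zero (x : EuclideanSpace ℝ (Fin d)) :
    margAvg q 0 x = ∫ r, q (WithLp.toLp 2 r) ∂unifCube d := by
  simp [margAvg]

theorem margAvg_self (x : EuclideanSpace ℝ (Fin d)) : margAvg q d x = q x := by
  simp [margAvg]

theorem abs_margAvg_le {C : ℝ} (hC : ∀ x, |q x| ≤ C) (j : ℕ) (x : EuclideanSpace ℝ (Fin d)) :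
    |margAvg q j x| ≤ C := by
  have : ∀ᵐ r ∂unifCube d, ‖q (WithLp.toLp 2 fun i => if (i : ℕ) < j then x i else r i)‖ ≤ C :=
    .of_forall fun _ => hC _
  simpa [margAvg] using norm_integral_le_of_norm_le_const this

theorem continuous_margAvg (hq : Continuous q) {C : ℝ} (hC : ∀ x, |q x| ≤ C) (j : ℕ) :
    Continuous (margAvg q j) := by
  have hc : ∀ i : Fin d, Continuous fun p : EuclideanSpace ℝ (Fin d) × (Fin d → ℝ) =>
      if (i : ℕ) < j then p.1 i else p.2 i := by
    intro i
    split_ifs <;> fun_prop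
  have hc' : Continuous fun p : EuclideanSpace ℝ (Fin d) × (Fin d → ℝ) =>
      q (WithLp.toLp 2 fun i => if (i : ℕ) < j then p.1 i else p.2 i) :=
    hq.comp ((PiLp.continuous_toLp 2 _).comp (continuous_pi hc))
  refine continuous_of_dominated (bound := fun _ => C) (fun x => ?_) (fun x => .of_forall fun r => hC _)
    (integrable_const _) (.of_forall fun r => ?_)
  · exact (hc'.comp (Continuous.prodMk_right x)).aestronglyMeasurable
  · exact hc'.comp (Continuous.prodMk_left r)

theorem margAvg_update (j : Fin d) (r : Fin d → ℝ) (s : ℝ) :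
    margAvg q j (WithLp.toLp 2 (Function.update r j s)) = margAvg q j (WithLp.toLp 2 r) := by
  unfold margAvg
  congr 1
  ext r'
  congr 2
  ext i
  by_cases h : (i : ℕ) < j
  · have : i ≠ j := fun h' => by simp [h'] at h
    simp [h, this]
  · simp [h]

theorem integral_margAvg_succ (hq : Continuous q) {C : ℝ} (hC : ∀ x, |q x| ≤ C) (j : Fin d)
    (x : EuclideanSpace ℝ (Fin d)) :
    ∫ s in Icc (0 : ℝ) 1, margAvg q (j + 1) (WithLp.toLp 2 (Function.update x.ofLp j s)) =
      margAvg q j x := by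
  have hc : Continuous fun r : Fin d → ℝ =>
      q (WithLp.toLp 2 fun i => if (i : ℕ) < j then x i else r i) := by
    refine hq.comp ((PiLp.continuous_toLp 2 _).comp (continuous_pi fun i => ?_))
    split_ifs <;> fun_prop
  have := integral_Icc_update_unifCube j (F := fun r =>
      q (WithLp.toLp 2 fun i => if (i : ℕ) < j then x i else r i))
    (Integrable.of_bound hc.aestronglyMeasurable C (.of_forall fun _ => hC _))
  unfold margAvg
  rw [← this]
  congr 1
  ext s
  congr 1
  ext r
  congr 2
  ext i
  rcases lt_trichotomy (i : ℕ) j with h | h | h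
  · have : i ≠ j := fun h' => by simp [h'] at h
    simp [h, this, h.trans (Nat.lt_succ_self _)]
  · have : i = j := Fin.ext h
    subst this
    simp
  · have : i ≠ j := fun h' => by simp [h'] at h
    simp [this, h.not_gt, show ¬ (i : ℕ) < j + 1 by omega]

theorem integral_Icc_scale (g : ℝ → ℝ) (y : ℝ) :
    y * ∫ s in Icc (0 : ℝ) 1, g (s * y) = ∫ s in (0 : ℝ)..y, g s := by
  rw [integral_Icc_eq_integral_Ioc, ← intervalIntegral.integral_of_le zero_le_one,
    ← smul_eq_mul, intervalIntegral.smul_integral_comp_mul_right]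
  simp

/-- Along its own coordinate the flux is a primitive of the difference of consecutive averages. The
definition uses the rescaled integral over [0,1] instead, since in that form it is an average over
affine maps of the cube. -/
theorem flux_update (hq : Continuous q) {C : ℝ} (hC : ∀ x, |q x| ≤ C) (j : Fin d)
    (r : Fin d → ℝ) (s : ℝ) :
    flux q j (WithLp.toLp 2 (Function.update r j s)) =
      ∫ t in (0 : ℝ)..s, (margAvg q (j + 1) (WithLp.toLp 2 (Function.update r j t)) -
        margAvg q j (WithLp.toLp 2 r)) := by
  unfold flux
  rw [margAvg_update]
  simp only [Function.update_self, Function.update_idem]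
  have hg : Continuous fun t => margAvg q (j + 1) (WithLp.toLp 2 (Function.update r j t)) := by
    refine (continuous_margAvg hq hC _).comp ((PiLp.continuous_toLp 2 _).comp ?_)
    exact continuous_const.update j continuous_id
  rw [mul_sub, integral_Icc_scale (fun t => margAvg q (j + 1) (WithLp.toLp 2 (Function.update r j t))),
    intervalIntegral.integral_sub (hg.intervalIntegrable _ _) (by simp)]
  simp

/-- At 0 the prefactor vanishes; at 1 the primitive has run over the whole interval, where its
integrand has mean zero. -/
theorem flux_eq_zero_of_coord (hq : Continuous q) {C : ℝ} (hC : ∀ x, |q x| ≤ C) (j : Fin d)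
    {x : EuclideanSpace ℝ (Fin d)} (hx : x j = 0 ∨ x j = 1) : flux q j x = 0 := by
  rcases hx with h | h
  · simp [flux, h]
  · simp only [flux, h, mul_one, integral_margAvg_succ hq hC, sub_self, mul_zero]

theorem continuous_flux (hq : Continuous q) {C : ℝ} (hC : ∀ x, |q x| ≤ C) (j : Fin d) :
    Continuous (flux q j) := by
  unfold flux
  have hc : Continuous fun p : EuclideanSpace ℝ (Fin d) × ℝ =>
      margAvg q (j + 1) (WithLp.toLp 2 (Function.update p.1.ofLp j (p.2 * p.1 j))) := by
    refine (continuous_margAvg hq hC _).comp ((PiLp.continuous_toLp 2 _).comp ?_)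
    refine Continuous.update (by fun_prop) j (by fun_prop)
  refine Continuous.mul (by fun_prop) (Continuous.sub ?_ (continuous_margAvg hq hC _))
  refine continuous_of_dominated (bound := fun _ => C) (fun x => ?_)
    (fun x => .of_forall fun s => abs_margAvg_le hC _ _) (integrable_const _)
    (.of_forall fun s => ?_)
  · exact (hc.comp (Continuous.prodMk_right x)).aestronglyMeasurable
  · exact hc.comp (Continuous.prodMk_left s)

theorem abs_flux_le {C : ℝ} (hC : ∀ x, |q x| ≤ C) (j : Fin d) {x : EuclideanSpace ℝ (Fin d)}
    (hx : x ∈ unitCube d) : |flux q j x| ≤ 2 * C := by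
  unfold flux
  have h1 : |∫ s in Icc (0 : ℝ) 1,
      margAvg q (j + 1) (WithLp.toLp 2 (Function.update x.ofLp j (s * x j)))| ≤ C := by
    have : ∀ᵐ s ∂volume.restrict (Icc (0 : ℝ) 1),
      ‖margAvg q (j + 1) (WithLp.toLp 2 (Function.update x.ofLp j (s * x j)))‖ ≤ C :=
      .of_forall fun s => abs_margAvg_le hC _ _
    simpa using norm_integral_le_of_norm_le_const this
  have h2 := abs_margAvg_le hC j x
  rw [abs_mul]
  refine (mul_le_of_le_one_left (abs_nonneg _) ?_).trans ((abs_sub _ _).trans (by linarith))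
  exact _root_.abs_le.2 ⟨by have := (hx j).1; linarith, (hx j).2⟩

/-- Integration by parts against a primitive vanishing at both ends. -/
theorem integral_deriv_mul_primitive {ψ g : ℝ → ℝ} {K : NNReal} (hψ : LipschitzWith K ψ)
    (hg : Continuous g) (h1 : ∫ s in (0 : ℝ)..1, g s = 0) :
    ∫ s in (0 : ℝ)..1, deriv ψ s * ∫ t in (0 : ℝ)..s, g t = -∫ s in (0 : ℝ)..1, ψ s * g s := by
  have hA : AbsolutelyContinuousOnInterval ψ 0 1 := hψ.lipschitzOnWith.absolutelyContinuousOnInterval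
  have hB : AbsolutelyContinuousOnInterval (fun s => ∫ t in (0 : ℝ)..s, g t) 0 1 :=
    (hg.intervalIntegrable 0 1).absolutelyContinuousOnInterval_intervalIntegral (by simp)
  have h := hA.integral_mul_deriv_eq_deriv_mul hB
  simp only [h1, intervalIntegral.integral_same, mul_zero, sub_zero, zero_sub] at h
  have hd : ∀ s, deriv (fun s => ∫ t in (0 : ℝ)..s, g t) s = g s := fun s => hg.deriv_integral g 0 s
  simp only [hd] at h
  linarith

theorem lineDeriv_update {ψ : EuclideanSpace ℝ (Fin d) → ℝ} (j : Fin d) (r : Fin d → ℝ) (s : ℝ) :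
    lineDeriv ℝ ψ (WithLp.toLp 2 (Function.update r j s)) (EuclideanSpace.single j 1) =
      deriv (fun t => ψ (WithLp.toLp 2 (Function.update r j t))) s := by
  unfold lineDeriv
  have : ∀ t : ℝ, WithLp.toLp 2 (Function.update r j s) + t • EuclideanSpace.single j (1 : ℝ) =
      WithLp.toLp 2 (Function.update r j (s + t)) := by
    intro t
    ext i
    by_cases h : i = j
    · subst h; simp
    · simp [h]
  simp only [this]
  rw [deriv_comp_const_add (f := fun t => ψ (WithLp.toLp 2 (Function.update r j t)))]
  simp

theorem lipschitz_update {ψ : EuclideanSpace ℝ (Fin d) → ℝ} {K : NNReal} (hψ : LipschitzWith K ψ)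
    (j : Fin d) (r : Fin d → ℝ) :
    LipschitzWith K fun t => ψ (WithLp.toLp 2 (Function.update r j t)) := by
  refine LipschitzWith.of_dist_le_mul fun s t => (hψ.dist_le_mul _ _).trans ?_
  have : WithLp.toLp 2 (Function.update r j s) - WithLp.toLp 2 (Function.update r j t) =
      EuclideanSpace.single j (s - t) := by
    ext i
    by_cases h : i = j
    · subst h; simp
    · simp [h]
  rw [dist_eq_norm, this]
  simp [Real.dist_eq]

/-- Integration by parts on almost every line parallel to the j-th axis. Lipschitz functions are
absolutely continuous on lines, and there are no boundary terms since the flux vanishes at both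
ends. -/
theorem integral_lineDeriv_mul_flux (hq : Continuous q) {C : ℝ} (hC : ∀ x, |q x| ≤ C)
    {ψ : EuclideanSpace ℝ (Fin d) → ℝ} {K : NNReal} (hψ : LipschitzWith K ψ)
    {B : ℝ} (hB : ∀ x, |ψ x| ≤ B) (j : Fin d) :
    ∫ x in unitCube d, lineDeriv ℝ ψ x (EuclideanSpace.single j 1) * flux q j x =
      -∫ x in unitCube d, ψ x * (margAvg q (j + 1) x - margAvg q j x) := by
  have hto : Measurable (WithLp.toLp 2 : (Fin d → ℝ) → EuclideanSpace ℝ (Fin d)) :=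
    WithLp.measurable_toLp 2 _
  have hli : Integrable (fun r => lineDeriv ℝ ψ (WithLp.toLp 2 r) (EuclideanSpace.single j 1) *
      flux q j (WithLp.toLp 2 r)) (unifCube d) := by
    refine Integrable.of_bound (C := K * (2 * C)) (AEStronglyMeasurable.mul
      ((measurable_lineDeriv hψ.continuous).comp hto).aestronglyMeasurable
      ((continuous_flux hq hC j).measurable.comp hto).aestronglyMeasurable) ?_
    filter_upwards [ae_unifCube_mem d] with r hr
    rw [norm_mul]
    refine mul_le_mul ?_ (abs_flux_le hC j (x := WithLp.toLp 2 r) hr) (norm_nonneg _) K.2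
    simpa using norm_lineDeriv_le_of_lipschitz ℝ hψ (v := EuclideanSpace.single j (1 : ℝ))
      (x₀ := WithLp.toLp 2 r)
  have hcm : ∀ n, Continuous (margAvg q n) := continuous_margAvg hq hC
  have hri : Integrable (fun r => ψ (WithLp.toLp 2 r) * (margAvg q (j + 1) (WithLp.toLp 2 r) -
      margAvg q j (WithLp.toLp 2 r))) (unifCube d) := by
    refine Integrable.of_bound (C := B * (2 * C)) (((hψ.continuous.mul ((hcm _).sub
      (hcm _))).measurable.comp hto).aestronglyMeasurable) (.of_forall fun r => ?_)
    rw [norm_mul]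
    refine mul_le_mul (hB _) ((abs_sub _ _).trans ?_) (norm_nonneg _) ((abs_nonneg _).trans (hB 0))
    linarith [abs_margAvg_le hC (j + 1) (WithLp.toLp 2 r), abs_margAvg_le hC j (WithLp.toLp 2 r)]
  rw [integral_unitCube, integral_unitCube, ← integral_update_unifCube j hli,
    ← integral_update_unifCube j hri, ← integral_neg]
  congr 1
  ext r
  simp only [integral_Icc_eq_integral_Ioc, ← intervalIntegral.integral_of_le zero_le_one,
    flux_update hq hC, margAvg_update, lineDeriv_update]
  have hg : Continuous fun t => margAvg q (j + 1) (WithLp.toLp 2 (Function.update r j t)) -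
      margAvg q j (WithLp.toLp 2 r) := by
    refine ((hcm _).comp ((PiLp.continuous_toLp 2 _).comp ?_)).sub continuous_const
    exact continuous_const.update j continuous_id
  refine integral_deriv_mul_primitive (lipschitz_update hψ j r) hg ?_
  rw [← flux_update hq hC]
  exact flux_eq_zero_of_coord hq hC j (by simp)

theorem integrable_lineDeriv_mul_flux (hq : Continuous q) {C : ℝ} (hC : ∀ x, |q x| ≤ C)
    {ψ : EuclideanSpace ℝ (Fin d) → ℝ} {K : NNReal} (hψ : LipschitzWith K ψ) (j : Fin d) :
    IntegrableOn (fun x => lineDeriv ℝ ψ x (EuclideanSpace.single j 1) * flux q j x)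
      (unitCube d) := by
  refine IntegrableOn.of_bound ?_ (AEStronglyMeasurable.mul
    (measurable_lineDeriv hψ.continuous).aestronglyMeasurable
    (continuous_flux hq hC j).aestronglyMeasurable) (K * (2 * C)) ?_
  · have := measure_univ (μ := unifCube d)
    rw [unifCube_eq_restrict, Measure.restrict_apply_univ] at this
    have h := (PiLp.volume_preserving_toLp (Fin d)).measure_preimage
      (isClosed_unitCube d).measurableSet.nullMeasurableSet
    rw [← h]
    exact this.trans_lt ENNReal.one_lt_top
  · filter_upwards [ae_restrict_mem (isClosed_unitCube d).measurableSet] with x hx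
    rw [norm_mul]
    refine mul_le_mul ?_ (abs_flux_le hC j hx) (norm_nonneg _) K.2
    simpa using norm_lineDeriv_le_of_lipschitz ℝ hψ (v := EuclideanSpace.single j (1 : ℝ)) (x₀ := x)

/-- The triangular flux of `q` has divergence `q - ∫ q` in the weak sense, without boundary
terms. -/
theorem sum_integral_lineDeriv_mul_flux (hq : Continuous q) {C : ℝ} (hC : ∀ x, |q x| ≤ C)
    {ψ : EuclideanSpace ℝ (Fin d) → ℝ} {K : NNReal} (hψ : LipschitzWith K ψ)
    {B : ℝ} (hB : ∀ x, |ψ x| ≤ B) :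
    ∑ j, ∫ x in unitCube d, lineDeriv ℝ ψ x (EuclideanSpace.single j 1) * flux q j x =
      -∫ x in unitCube d, ψ x * (q x - ∫ y in unitCube d, q y) := by
  have hto : Measurable (WithLp.toLp 2 : (Fin d → ℝ) → EuclideanSpace ℝ (Fin d)) :=
    WithLp.measurable_toLp 2 _
  have hcm : ∀ n, Continuous (margAvg q n) := continuous_margAvg hq hC
  simp only [integral_lineDeriv_mul_flux hq hC hψ hB, Finset.sum_neg_distrib]
  congr 1
  simp only [integral_unitCube]
  rw [← integral_finsetSum]
  · congr 1
    ext r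
    rw [← Finset.mul_sum]
    congr 1
    -- The sum telescopes from the full average, at index 0, to `q` itself, at index d.
    rw [Fin.sum_univ_eq_sum_range (fun j => margAvg q (j + 1) (WithLp.toLp 2 r) -
      margAvg q j (WithLp.toLp 2 r)) d, Finset.sum_range_sub (fun j => margAvg q j (WithLp.toLp 2 r)),
      margAvg_self, margAvg_zero]
  · intro j _
    refine Integrable.of_bound (C := B * (2 * C)) (((hψ.continuous.mul ((hcm _).sub
      (hcm _))).measurable.comp hto).aestronglyMeasurable) (.of_forall fun r => ?_)
    rw [norm_mul]
    refine mul_le_mul (hB _) ((abs_sub _ _).trans ?_) (norm_nonneg _) ((abs_nonneg _).trans (hB 0))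
    linarith [abs_margAvg_le hC (j + 1) (WithLp.toLp 2 r), abs_margAvg_le hC j (WithLp.toLp 2 r)]

end Flux

/-! ### Flows of bounded Lipschitz fields -/

section Flow

open scoped NNReal

variable {E : Type*} [NormedAddCommGroup E] [NormedSpace ℝ E] {F : E → ℝ → E} {K B : ℝ≥0}

/-- Bounded time-dependent vector fields, Lipschitz in space and time. -/
structure IsLipField (F : E → ℝ → E) (K B : ℝ≥0) : Prop where
  lip : ∀ x y t s, ‖F x t - F y s‖ ≤ K * (‖x - y‖ + |t - s|)
  bound : ∀ x t, ‖F x t‖ ≤ B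

/-- `α` is an integral curve of `F` on the time interval `[0,1]`. -/
def IsCurve (F : E → ℝ → E) (α : ℝ → E) : Prop :=
  ∀ t ∈ Icc (0 : ℝ) 1, HasDerivWithinAt α (F (α t) t) (Icc 0 1) t

omit [NormedSpace ℝ E] in
theorem IsLipField.lipschitzWith (hF : IsLipField F K B) (t : ℝ) : LipschitzWith K (F · t) :=
  LipschitzWith.of_dist_le_mul fun x y => by
    simpa [dist_eq_norm] using hF.lip x y t t

theorem IsLipField.exists_curve [CompleteSpace E] (hF : IsLipField F K B) {t₀ : ℝ}
    (ht₀ : t₀ ∈ Icc (0 : ℝ) 1) (y : E) : ∃ α, α t₀ = y ∧ IsCurve F α := by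
  -- A ball of radius B suffices: at speed at most B a curve cannot leave it within unit time.
  have hP : IsPicardLindelof (fun t x => F x t) (tmin := 0) (tmax := 1) ⟨t₀, ht₀⟩ y B 0 B K := by
    refine ⟨fun t _ => (hF.lipschitzWith t).lipschitzOnWith, fun x _ => ?_,
      fun t _ x _ => hF.bound x t, ?_⟩
    · have : LipschitzWith K (F x) := LipschitzWith.of_dist_le_mul fun s t => by
        simpa [dist_eq_norm] using hF.lip x x s t
      exact this.continuous.continuousOn
    · simp only [NNReal.coe_zero, sub_zero]
      refine mul_le_of_le_one_right B.2 (max_le ?_ ?_) <;> linarith [ht₀.1, ht₀.2]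
  exact hP.exists_eq_forall_mem_Icc_hasDerivWithinAt₀

theorem IsCurve.continuousOn {α : ℝ → E} (h : IsCurve F α) : ContinuousOn α (Icc 0 1) :=
  fun t ht => (h t ht).continuousWithinAt

theorem IsCurve.hasDerivWithinAt_Ici {α : ℝ → E} (h : IsCurve F α) {t : ℝ}
    (ht : t ∈ Ico (0 : ℝ) 1) : HasDerivWithinAt α (F (α t) t) (Ici t) t :=
  (h t (Ico_subset_Icc_self ht)).mono_of_mem_nhdsWithin (Icc_mem_nhdsGE_of_mem ht)

theorem IsCurve.dist_le {α β : ℝ → E} (hF : IsLipField F K B) (hα : IsCurve F α)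
    (hβ : IsCurve F β) {t₀ t : ℝ} (h₀ : 0 ≤ t₀) (ht : t₀ ≤ t) (h₁ : t ≤ 1) :
    dist (α t) (β t) ≤ dist (α t₀) (β t₀) * Real.exp (K * (t - t₀)) :=
  dist_le_of_trajectories_ODE (v := fun t x => F x t) (a := t₀) (b := 1)
    (fun t => hF.lipschitzWith t)
    (hα.continuousOn.mono (Icc_subset_Icc_left h₀))
    (fun _ ht => hα.hasDerivWithinAt_Ici ⟨h₀.trans ht.1, ht.2⟩)
    (hβ.continuousOn.mono (Icc_subset_Icc_left h₀))
    (fun _ ht => hβ.hasDerivWithinAt_Ici ⟨h₀.trans ht.1, ht.2⟩) le_rfl t ⟨ht, h₁⟩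

theorem IsCurve.norm_sub_le {α : ℝ → E} (hF : IsLipField F K B) (hα : IsCurve F α) {t₀ t : ℝ}
    (h₀ : 0 ≤ t₀) (ht : t₀ ≤ t) (h₁ : t ≤ 1) : ‖α t - α t₀‖ ≤ B * (t - t₀) :=
  norm_image_sub_le_of_norm_deriv_le_segment'
    (fun s hs => (hα s ⟨h₀.trans hs.1, hs.2.trans h₁⟩).mono (Icc_subset_Icc h₀ h₁))
    (fun _ _ => hF.bound _ _) t ⟨ht, le_rfl⟩

/-- First-order expansion with a quadratic error. The field is frozen at the initial position but
the final time, since in the transport argument the final time is fixed and the initial time tends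
to it. -/
theorem IsCurve.norm_sub_sub_le {α : ℝ → E} (hF : IsLipField F K B) (hα : IsCurve F α) {t₀ t : ℝ}
    (h₀ : 0 ≤ t₀) (ht : t₀ ≤ t) (h₁ : t ≤ 1) :
    ‖α t - α t₀ - (t - t₀) • F (α t₀) t‖ ≤ K * (B + 1) * (t - t₀) * (t - t₀) := by
  have h := norm_image_sub_le_of_norm_deriv_le_segment' (a := t₀) (b := t)
    (f := fun s => α s - s • F (α t₀) t) (f' := fun s => F (α s) s - F (α t₀) t)
    (C := K * (B + 1) * (t - t₀))
    (fun s hs => by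
      have h1 := (hα s ⟨h₀.trans hs.1, hs.2.trans h₁⟩).mono (Icc_subset_Icc h₀ h₁)
      simpa using! h1.sub ((hasDerivWithinAt_id s _).smul_const (F (α t₀) t)))
    (fun s hs => by
      refine (hF.lip _ _ _ _).trans ?_
      rw [mul_assoc]
      refine mul_le_mul_of_nonneg_left ?_ K.2
      have h2 := hα.norm_sub_le hF h₀ hs.1 (hs.2.le.trans h₁)
      rw [abs_of_nonpos (by linarith [hs.2])]
      have h3 : (B : ℝ) * (s - t₀) ≤ B * (t - t₀) :=
        mul_le_mul_of_nonneg_left (by linarith [hs.2]) B.2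
      linarith [hs.1])
    t ⟨ht, le_rfl⟩
  refine le_trans (le_of_eq ?_) h
  congr 1
  rw [sub_smul]
  abel

end Flow

/-! ### Transport of densities along the flow -/

section Transport

open scoped NNReal
open Filter Topology

variable {d : ℕ}

theorem lineDeriv_sum_of_differentiableAt {ψ : EuclideanSpace ℝ (Fin d) → ℝ}
    {y : EuclideanSpace ℝ (Fin d)} (h : DifferentiableAt ℝ ψ y) (w : EuclideanSpace ℝ (Fin d)) :
    fderiv ℝ ψ y w = ∑ j, lineDeriv ℝ ψ y (EuclideanSpace.single j 1) * w j := by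
  have hw := (EuclideanSpace.basisFun (Fin d) ℝ).sum_repr w
  conv_lhs => rw [← hw]
  rw [map_sum]
  refine Finset.sum_congr rfl fun j _ => ?_
  rw [map_smul, (h.hasFDerivAt.hasLineDerivAt _).lineDeriv]
  simp [mul_comm]

theorem volume_unitCube (d : ℕ) : volume (unitCube d) = 1 := by
  have h := (PiLp.volume_preserving_toLp (Fin d)).measure_preimage
    (isClosed_unitCube d).measurableSet.nullMeasurableSet
  have h2 : (WithLp.toLp 2 ⁻¹' unitCube d : Set (Fin d → ℝ)) =
    {r : Fin d → ℝ | ∀ i, r i ∈ Icc (0 : ℝ) 1} := rfl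
  rw [← h, h2, ← Measure.restrict_apply_univ, ← unifCube_eq_restrict, measure_univ]

instance (d : ℕ) : IsProbabilityMeasure (volume.restrict (unitCube d)) :=
  ⟨by rw [Measure.restrict_apply_univ, volume_unitCube]⟩

variable {F : EuclideanSpace ℝ (Fin d) → ℝ → EuclideanSpace ℝ (Fin d)} {K B : ℝ≥0}
  {ρ π : EuclideanSpace ℝ (Fin d) → ℝ}

/-- If `F` transports the linear interpolation of the densities in the sense of the continuity
equation, then its flow transports integrals of bounded Lipschitz functions. -/
theorem integral_flow_eq (hF : IsLipField F K B) (hρ : Continuous ρ) (hπ : Continuous π) {C : ℝ}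
    (hρC : ∀ x, |ρ x| ≤ C) (hπC : ∀ x, |π x| ≤ C) (hρ1 : ∫ x in unitCube d, ρ x = 1)
    (hπ1 : ∫ x in unitCube d, π x = 1)
    (hFρ : ∀ x ∈ unitCube d, ∀ t ∈ Icc (0 : ℝ) 1, ∀ j,
      F x t j * ((1 - t) * π x + t * ρ x) = flux π j x - flux ρ j x)
    {Φ : ℝ → EuclideanSpace ℝ (Fin d) → ℝ → EuclideanSpace ℝ (Fin d)}
    (hΦ : ∀ t ∈ Icc (0 : ℝ) 1, ∀ y, Φ t y t = y ∧ IsCurve F (Φ t y))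
    {φ : EuclideanSpace ℝ (Fin d) → ℝ} {Kφ : ℝ≥0} (hφ : LipschitzWith Kφ φ) {Bφ : ℝ}
    (hBφ : ∀ x, |φ x| ≤ Bφ) :
    ∫ x in unitCube d, φ (Φ 0 x 1) * π x = ∫ x in unitCube d, φ x * ρ x := by
  have hC0 : 0 ≤ C := (abs_nonneg _).trans (hρC 0)
  have hB0 : 0 ≤ Bφ := (abs_nonneg _).trans (hBφ 0)
  -- The test function pulled back: its value at the time-1 end of the curve that passes through y
  -- at time t. It is constant along curves.
  let ψ : ℝ → EuclideanSpace ℝ (Fin d) → ℝ := fun t y => φ (Φ t y 1)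
  let r : ℝ → EuclideanSpace ℝ (Fin d) → ℝ := fun t y => (1 - t) * π y + t * ρ y
  let Kψ : ℝ≥0 := Kφ * Real.toNNReal (Real.exp K)
  have hψ : ∀ t ∈ Icc (0 : ℝ) 1, LipschitzWith Kψ (ψ t) := by
    intro t ht
    refine LipschitzWith.of_dist_le_mul fun y y' => (hφ.dist_le_mul _ _).trans ?_
    have h := IsCurve.dist_le hF (hΦ t ht y).2 (hΦ t ht y').2 ht.1 ht.2 le_rfl
    rw [(hΦ t ht y).1, (hΦ t ht y').1] at h
    have h2 : Real.exp (K * (1 - t)) ≤ Real.exp K := by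
      rw [Real.exp_le_exp]
      exact mul_le_of_le_one_right K.2 (by linarith [ht.1])
    simp only [Kψ, NNReal.coe_mul, Real.coe_toNNReal _ (Real.exp_pos _).le]
    calc Kφ * dist (Φ t y 1) (Φ t y' 1) ≤ Kφ * (dist y y' * Real.exp K) := by
          refine mul_le_mul_of_nonneg_left (h.trans ?_) Kφ.2
          exact mul_le_mul_of_nonneg_left h2 dist_nonneg
      _ = _ := by ring
  have hψB : ∀ t y, |ψ t y| ≤ Bφ := fun t y => hBφ _
  have hrc : ∀ t, Continuous (r t) := fun t => by simp only [r]; fun_prop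
  have hrC : ∀ t ∈ Icc (0 : ℝ) 1, ∀ y, |r t y| ≤ C := by
    intro t ht y
    calc |r t y| ≤ |(1 - t) * π y| + |t * ρ y| := abs_add_le _ _
      _ ≤ (1 - t) * C + t * C := by
        rw [abs_mul, abs_mul, abs_of_nonneg ht.1, abs_of_nonneg (by linarith [ht.2])]
        exact add_le_add (mul_le_mul_of_nonneg_left (hπC y) (by linarith [ht.2]))
          (mul_le_mul_of_nonneg_left (hρC y) ht.1)
      _ = C := by ring
  have hsemi : ∀ t ∈ Icc (0 : ℝ) 1, ∀ t' ∈ Icc (0 : ℝ) 1, t ≤ t' → ∀ y,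
      ψ t y = ψ t' (Φ t y t') := by
    intro t ht t' ht' htt y
    have h := IsCurve.dist_le hF (hΦ t ht y).2 (hΦ t' ht' (Φ t y t')).2 ht'.1 ht'.2 le_rfl
    rw [(hΦ t' ht' _).1, dist_self, zero_mul] at h
    simp only [ψ]
    rw [dist_le_zero.1 h]
  have hψt : ∀ t ∈ Icc (0 : ℝ) 1, ∀ t' ∈ Icc (0 : ℝ) 1, t ≤ t' → ∀ y,
      |ψ t y - ψ t' y| ≤ Kψ * B * (t' - t) := by
    intro t ht t' ht' htt y
    rw [hsemi t ht t' ht' htt y, mul_assoc]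
    refine ((hψ t' ht').dist_le_mul _ _).trans (mul_le_mul_of_nonneg_left ?_ Kψ.2)
    have h := (hΦ t ht y).2.norm_sub_le hF ht.1 htt ht'.2
    rwa [(hΦ t ht y).1, ← dist_eq_norm] at h
  -- A Lipschitz constant in time of the integrand; it yields both the continuity of `G` and the
  -- dominating function for its difference quotients.
  let C' : ℝ := Kψ * B * C + Bφ * (2 * C)
  have hdiff : ∀ t ∈ Icc (0 : ℝ) 1, ∀ t' ∈ Icc (0 : ℝ) 1, t ≤ t' → ∀ y,
      |ψ t y * r t y - ψ t' y * r t' y| ≤ C' * (t' - t) := by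
    intro t ht t' ht' htt y
    have e : ψ t y * r t y - ψ t' y * r t' y =
        (ψ t y - ψ t' y) * r t y + ψ t' y * ((t' - t) * (π y - ρ y)) := by simp only [r]; ring
    rw [e]
    refine (abs_add_le _ _).trans ?_
    rw [abs_mul, abs_mul, abs_mul, abs_of_nonneg (sub_nonneg.2 htt)]
    have h1 : |π y - ρ y| ≤ 2 * C := (abs_sub _ _).trans (by linarith [hπC y, hρC y])
    calc _ ≤ (Kψ * B * (t' - t)) * C + Bφ * ((t' - t) * (2 * C)) := by
          refine add_le_add (mul_le_mul (hψt t ht t' ht' htt y) (hrC t ht y) (abs_nonneg _)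
            (mul_nonneg (by positivity) (sub_nonneg.2 htt))) (mul_le_mul (hψB _ _)
            (mul_le_mul_of_nonneg_left h1 (sub_nonneg.2 htt)) (mul_nonneg (sub_nonneg.2 htt)
            (abs_nonneg _)) hB0)
      _ = _ := by simp only [C']; ring
  have hmeas : ∀ t ∈ Icc (0 : ℝ) 1, Continuous (fun y => ψ t y * r t y) :=
    fun t ht => (hψ t ht).continuous.mul (hrc t)
  have hint : ∀ t ∈ Icc (0 : ℝ) 1, Integrable (fun y => ψ t y * r t y)
      (volume.restrict (unitCube d)) := by
    intro t ht
    refine Integrable.of_bound (hmeas t ht).aestronglyMeasurable (Bφ * C) (.of_forall fun y => ?_)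
    rw [norm_mul]
    exact mul_le_mul (hψB t y) (hrC t ht y) (abs_nonneg _) hB0
  -- Time is reversed so that right derivatives of `G` compare `ψ` at an earlier time with `ψ` at
  -- the fixed time t₀. By `hsemi` the earlier function is ψ t₀ evaluated at a displaced point, so
  -- only spatial differentiability of ψ t₀ is needed.
  let G : ℝ → ℝ := fun τ => ∫ y in unitCube d, ψ (1 - τ) y * r (1 - τ) y
  have hG : ∀ τ ∈ Icc (0 : ℝ) 1, G τ = G 0 := by
    refine constant_of_has_deriv_right_zero ?_ ?_
    · have : LipschitzOnWith (Real.toNNReal C') G (Icc 0 1) := by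
        have key : ∀ τ ∈ Icc (0 : ℝ) 1, ∀ τ' ∈ Icc (0 : ℝ) 1, τ ≤ τ' →
            |G τ' - G τ| ≤ C' * (τ' - τ) := by
          intro τ hτ τ' hτ' h
          have h1 : 1 - τ ∈ Icc (0 : ℝ) 1 := ⟨by linarith [hτ.2], by linarith [hτ.1]⟩
          have h2 : 1 - τ' ∈ Icc (0 : ℝ) 1 := ⟨by linarith [hτ'.2], by linarith [hτ'.1]⟩
          simp only [G]
          rw [← integral_sub (hint _ h2) (hint _ h1)]
          have : ∀ᵐ y ∂volume.restrict (unitCube d), ‖ψ (1 - τ') y * r (1 - τ') y -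
              ψ (1 - τ) y * r (1 - τ) y‖ ≤ C' * (τ' - τ) := by
            refine .of_forall fun y => (hdiff _ h2 _ h1 (by linarith) y).trans (le_of_eq (by ring))
          simpa using norm_integral_le_of_norm_le_const this
        refine LipschitzOnWith.of_dist_le_mul fun τ hτ τ' hτ' => ?_
        have hC'0 : 0 ≤ C' := by positivity
        rw [Real.coe_toNNReal _ hC'0, Real.dist_eq, Real.dist_eq]
        rcases le_total τ τ' with h | h
        · rw [abs_sub_comm, abs_sub_comm τ, abs_of_nonneg (sub_nonneg.2 h)]
          exact key τ hτ τ' hτ' h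
        · rw [abs_of_nonneg (sub_nonneg.2 h)]
          exact key τ' hτ' τ hτ h
      exact this.continuousOn
    · intro τ hτ
      have ht₀ : 1 - τ ∈ Icc (0 : ℝ) 1 := ⟨by linarith [hτ.2], by linarith [hτ.1]⟩
      rw [← hasDerivWithinAt_Ioi_iff_Ici, hasDerivWithinAt_iff_tendsto_slope' (by simp)]
      let t₀ := 1 - τ
      have hev : ∀ᶠ σ in 𝓝[>] τ, σ ∈ Ioo τ 1 := Ioo_mem_nhdsGT hτ.2
      have hlim : Tendsto (fun σ => ∫ y in unitCube d,
          (σ - τ)⁻¹ * (ψ (1 - σ) y * r (1 - σ) y - ψ t₀ y * r t₀ y)) (𝓝[>] τ)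
          (𝓝 (∫ y in unitCube d, fderiv ℝ (ψ t₀) y (F y t₀) * r t₀ y + ψ t₀ y * (π y - ρ y))) := by
        refine tendsto_integral_filter_of_dominated_convergence (fun _ => C') ?_ ?_
          (integrable_const _) ?_
        · filter_upwards [hev] with σ hσ
          have : 1 - σ ∈ Icc (0 : ℝ) 1 := ⟨by linarith [hσ.2], by linarith [hσ.1, hτ.1]⟩
          exact (continuous_const.mul ((hmeas _ this).sub (hmeas _ ht₀))).aestronglyMeasurable
        · filter_upwards [hev] with σ hσ
          refine .of_forall fun y => ?_
          have h1 : 1 - σ ∈ Icc (0 : ℝ) 1 := ⟨by linarith [hσ.2], by linarith [hσ.1, hτ.1]⟩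
          have h2 : 0 < σ - τ := sub_pos.2 hσ.1
          rw [norm_mul, norm_inv, Real.norm_eq_abs, abs_of_pos h2, inv_mul_le_iff₀ h2]
          refine (hdiff _ h1 _ ht₀ (by linarith [hσ.1]) y).trans (le_of_eq (by ring))
        -- Rademacher's theorem for ψ t₀; the exceptional null set depends on t₀ only, not on σ.
        · filter_upwards [ae_restrict_of_ae (hψ t₀ ht₀).ae_differentiableAt] with y hy
          have hd := hy.hasFDerivAt
          have hpos : Tendsto (fun σ => (σ - τ)⁻¹ • (Φ (1 - σ) y t₀ - y)) (𝓝[>] τ)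
              (𝓝 (F y t₀)) := by
            rw [tendsto_iff_norm_sub_tendsto_zero]
            have hz : Tendsto (fun σ => K * (B + 1) * (σ - τ)) (𝓝[>] τ) (𝓝 0) := by
              have : Tendsto (fun σ : ℝ => K * (B + 1) * (σ - τ)) (𝓝 τ)
                (𝓝 (K * (B + 1) * (τ - τ))) := by
                exact ((continuous_const.mul (continuous_id.sub continuous_const)).tendsto τ)
              rw [sub_self, mul_zero] at this
              exact this.mono_left nhdsWithin_le_nhds
            refine squeeze_zero' (.of_forall fun _ => norm_nonneg _) ?_ hz
            filter_upwards [hev] with σ hσ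
            have h1 : 1 - σ ∈ Icc (0 : ℝ) 1 := ⟨by linarith [hσ.2], by linarith [hσ.1, hτ.1]⟩
            have h2 : 0 < σ - τ := sub_pos.2 hσ.1
            have h := (hΦ _ h1 y).2.norm_sub_sub_le hF h1.1 (t := t₀)
              (by simp only [t₀]; linarith [hσ.1]) ht₀.2
            rw [(hΦ _ h1 y).1, show t₀ - (1 - σ) = σ - τ by simp only [t₀]; ring] at h
            have e : (σ - τ)⁻¹ • (Φ (1 - σ) y t₀ - y) - F y t₀ =
                (σ - τ)⁻¹ • (Φ (1 - σ) y t₀ - y - (σ - τ) • F y t₀) := by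
              rw [smul_sub (σ - τ)⁻¹ (Φ (1 - σ) y t₀ - y), smul_smul, inv_mul_cancel₀ h2.ne', one_smul]
            rw [e, norm_smul, norm_inv, Real.norm_eq_abs, abs_of_pos h2, inv_mul_le_iff₀ h2]
            exact h.trans (le_of_eq (by ring))
          have hc0 : Tendsto (fun σ => Φ (1 - σ) y t₀ - y) (𝓝[>] τ) (𝓝 0) := by
            have hz : Tendsto (fun σ => B * (σ - τ)) (𝓝[>] τ) (𝓝 0) := by
              have : Tendsto (fun σ : ℝ => B * (σ - τ)) (𝓝 τ) (𝓝 (B * (τ - τ))) := by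
                exact ((continuous_const.mul (continuous_id.sub continuous_const)).tendsto τ)
              rw [sub_self, mul_zero] at this
              exact this.mono_left nhdsWithin_le_nhds
            refine squeeze_zero_norm' ?_ hz
            filter_upwards [hev] with σ hσ
            have h1 : 1 - σ ∈ Icc (0 : ℝ) 1 := ⟨by linarith [hσ.2], by linarith [hσ.1, hτ.1]⟩
            have h := (hΦ _ h1 y).2.norm_sub_le hF h1.1 (t := t₀)
              (by simp only [t₀]; linarith [hσ.1]) ht₀.2
            rwa [(hΦ _ h1 y).1, show t₀ - (1 - σ) = σ - τ by simp only [t₀]; ring] at h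
          have hdq : Tendsto (fun σ => (σ - τ)⁻¹ * (ψ (1 - σ) y - ψ t₀ y)) (𝓝[>] τ)
              (𝓝 (fderiv ℝ (ψ t₀) y (F y t₀))) := by
            have h := hd.hasFDerivWithinAt (s := univ) |>.lim (c := fun σ : ℝ => (σ - τ)⁻¹)
              (d := fun σ => Φ (1 - σ) y t₀ - y) (v := F y t₀) (l := 𝓝[>] τ)
              (by simpa using hc0) (by simp) hpos
            refine h.congr' ?_
            filter_upwards [hev] with σ hσ
            have h1 : 1 - σ ∈ Icc (0 : ℝ) 1 := ⟨by linarith [hσ.2], by linarith [hσ.1, hτ.1]⟩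
            rw [hsemi _ h1 t₀ ht₀ (by simp only [t₀]; linarith [hσ.1]) y, smul_eq_mul]
            simp
          have hrl : Tendsto (fun σ => r (1 - σ) y) (𝓝[>] τ) (𝓝 (r t₀ y)) := by
            have : Continuous fun σ => r (1 - σ) y := by simp only [r]; fun_prop
            exact (this.tendsto τ).mono_left nhdsWithin_le_nhds
          refine ((hdq.mul hrl).add_const (ψ t₀ y * (π y - ρ y))).congr' ?_
          filter_upwards [hev] with σ hσ
          have h2 : σ - τ ≠ 0 := (sub_pos.2 hσ.1).ne'
          have e : r t₀ y = r (1 - σ) y - (σ - τ) * (π y - ρ y) := by simp only [r, t₀]; ring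
          rw [e]
          field_simp
          ring
      -- The product of `F` with the interpolated density is the difference of the fluxes, so the
      -- weak divergence identities turn the first term into -∫ ψ (π - ρ), which cancels the second.
      have hzero : ∫ y in unitCube d, fderiv ℝ (ψ t₀) y (F y t₀) * r t₀ y + ψ t₀ y * (π y - ρ y)
          = 0 := by
        have hL := hψ t₀ ht₀
        have hi : ∀ {q : EuclideanSpace ℝ (Fin d) → ℝ}, Continuous q → (∀ x, |q x| ≤ C) →
            Integrable (fun y => ψ t₀ y * q y) (volume.restrict (unitCube d)) := by
          intro q hq hqC
          refine Integrable.of_bound (hL.continuous.mul hq).aestronglyMeasurable (Bφ * C)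
            (.of_forall fun y => ?_)
          rw [norm_mul]
          exact mul_le_mul (hψB _ y) (hqC y) (abs_nonneg _) hB0
        have hi1 : Integrable (fun y => ψ t₀ y) (volume.restrict (unitCube d)) :=
          Integrable.of_bound hL.continuous.aestronglyMeasurable Bφ (.of_forall fun y => hψB _ y)
        have hsum : ∀ {q : EuclideanSpace ℝ (Fin d) → ℝ}, Continuous q → (∀ x, |q x| ≤ C) →
            ∫ x in unitCube d, q x = 1 →
            ∫ y in unitCube d, ∑ j, lineDeriv ℝ (ψ t₀) y (EuclideanSpace.single j 1) * flux q j y =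
              (∫ y in unitCube d, ψ t₀ y) - ∫ y in unitCube d, ψ t₀ y * q y := by
          intro q hq hqC hq1
          rw [integral_finsetSum _ fun j _ => integrable_lineDeriv_mul_flux hq hqC hL j,
            sum_integral_lineDeriv_mul_flux hq hqC hL (hψB t₀), hq1]
          simp only [mul_sub, mul_one]
          rw [integral_sub (hi hq hqC) hi1, neg_sub]
        have hfi : ∀ {q : EuclideanSpace ℝ (Fin d) → ℝ}, Continuous q → (∀ x, |q x| ≤ C) →
            Integrable (fun y => ∑ j, lineDeriv ℝ (ψ t₀) y (EuclideanSpace.single j 1) * flux q j y)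
              (volume.restrict (unitCube d)) := fun hq hqC =>
          integrable_finsetSum _ fun j _ => integrable_lineDeriv_mul_flux hq hqC hL j
        have hae : ∀ᵐ y ∂volume.restrict (unitCube d),
            fderiv ℝ (ψ t₀) y (F y t₀) * r t₀ y + ψ t₀ y * (π y - ρ y) =
            (∑ j, lineDeriv ℝ (ψ t₀) y (EuclideanSpace.single j 1) * flux π j y) -
            (∑ j, lineDeriv ℝ (ψ t₀) y (EuclideanSpace.single j 1) * flux ρ j y) +
            (ψ t₀ y * π y - ψ t₀ y * ρ y) := by
          filter_upwards [ae_restrict_of_ae hL.ae_differentiableAt,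
            ae_restrict_mem (isClosed_unitCube d).measurableSet] with y hy hyQ
          rw [lineDeriv_sum_of_differentiableAt hy, Finset.sum_mul, mul_sub,
            ← Finset.sum_sub_distrib]
          congr 1
          refine Finset.sum_congr rfl fun j _ => ?_
          rw [mul_assoc, ← mul_sub]
          exact congrArg _ (hFρ y hyQ t₀ ht₀ j)
        have iA : Integrable (fun y =>
            (∑ j, lineDeriv ℝ (ψ t₀) y (EuclideanSpace.single j 1) * flux π j y) -
            ∑ j, lineDeriv ℝ (ψ t₀) y (EuclideanSpace.single j 1) * flux ρ j y)
            (volume.restrict (unitCube d)) := (hfi hπ hπC).sub (hfi hρ hρC)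
        have iB : Integrable (fun y => ψ t₀ y * π y - ψ t₀ y * ρ y)
            (volume.restrict (unitCube d)) := (hi hπ hπC).sub (hi hρ hρC)
        rw [integral_congr_ae hae, integral_add iA iB, integral_sub (hfi hπ hπC) (hfi hρ hρC),
          integral_sub (hi hπ hπC) (hi hρ hρC), hsum hπ hπC hπ1, hsum hρ hρC hρ1]
        ring
      rw [hzero] at hlim
      refine hlim.congr' ?_
      filter_upwards [hev] with σ hσ
      have h1 : 1 - σ ∈ Icc (0 : ℝ) 1 := ⟨by linarith [hσ.2], by linarith [hσ.1, hτ.1]⟩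
      rw [slope_def_field, integral_const_mul, integral_sub (hint _ h1) (hint _ ht₀)]
      simp only [G]
      ring
  have h1 := hG 1 (by simp)
  simp only [G, sub_self, sub_zero] at h1
  have e1 : ∀ y, ψ 1 y = φ y := fun y => by simp only [ψ]; rw [(hΦ 1 (by simp) y).1]
  simpa [r, e1] using! h1

/-! ### From integrals of Lipschitz functions to equality of measures -/

theorem integral_cubeMeasure {q : EuclideanSpace ℝ (Fin d) → ℝ} (hq : Continuous q)
    (h0 : ∀ x ∈ unitCube d, 0 ≤ q x) (f : EuclideanSpace ℝ (Fin d) → ℝ) :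
    ∫ x, f x ∂cubeMeasure q = ∫ x in unitCube d, f x * q x := by
  unfold cubeMeasure
  rw [integral_withDensity_eq_integral_toReal_smul hq.measurable.ennreal_ofReal
    (.of_forall fun _ => ENNReal.ofReal_lt_top)]
  refine setIntegral_congr_fun (isClosed_unitCube d).measurableSet fun x hx => ?_
  simp only [ENNReal.toReal_ofReal (h0 x hx), smul_eq_mul, mul_comm]

/-- Cosine and sine of a linear form are bounded and Lipschitz, so the hypothesis determines the
characteristic function. -/
theorem ext_of_integral_lipschitz {μ ν : Measure (EuclideanSpace ℝ (Fin d))} [IsFiniteMeasure μ]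
    [IsFiniteMeasure ν]
    (h : ∀ (φ : EuclideanSpace ℝ (Fin d) → ℝ) (K : ℝ≥0), LipschitzWith K φ →
      (∃ B, ∀ x, |φ x| ≤ B) → ∫ x, φ x ∂μ = ∫ x, φ x ∂ν) : μ = ν := by
  refine Measure.ext_of_charFun (funext fun ξ => ?_)
  have hinner : LipschitzWith ‖ξ‖₊ fun x : EuclideanSpace ℝ (Fin d) => inner ℝ x ξ := by
    refine LipschitzWith.of_dist_le_mul fun x y => ?_
    rw [Real.dist_eq, ← inner_sub_left, dist_eq_norm, mul_comm]
    exact abs_real_inner_le_norm _ _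
  have hc := h (fun x => Real.cos (inner ℝ x ξ)) (1 * ‖ξ‖₊)
    (Real.lipschitzWith_cos.comp hinner) ⟨1, fun x => Real.abs_cos_le_one _⟩
  have hs := h (fun x => Real.sin (inner ℝ x ξ)) (1 * ‖ξ‖₊)
    (Real.lipschitzWith_sin.comp hinner) ⟨1, fun x => Real.abs_sin_le_one _⟩
  have e : ∀ (m : Measure (EuclideanSpace ℝ (Fin d))) [IsFiniteMeasure m], charFun m ξ =
      ((∫ x, Real.cos (inner ℝ x ξ) ∂m : ℝ) : ℂ) +
        ((∫ x, Real.sin (inner ℝ x ξ) ∂m : ℝ) : ℂ) * Complex.I := by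
    intro m _
    have ic : Integrable (fun x => Real.cos (inner ℝ x ξ)) m :=
      Integrable.of_bound (by fun_prop) 1 (.of_forall fun x => Real.abs_cos_le_one _)
    have is : Integrable (fun x => Real.sin (inner ℝ x ξ)) m :=
      Integrable.of_bound (by fun_prop) 1 (.of_forall fun x => Real.abs_sin_le_one _)
    have h1 := integral_complex_ofReal (μ := m) (f := fun x => Real.cos (inner ℝ x ξ))
    have h2 := integral_complex_ofReal (μ := m) (f := fun x => Real.sin (inner ℝ x ξ))
    have ic' : Integrable (fun x => (Real.cos (inner ℝ x ξ) : ℂ)) m := ic.ofReal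
    have is' : Integrable (fun x => (Real.sin (inner ℝ x ξ) : ℂ)) m := is.ofReal
    rw [charFun_apply, ← h1, ← h2, ← integral_mul_const,
      ← integral_add ic' (is'.mul_const _)]
    congr 1
    ext x
    rw [Complex.exp_mul_I]
    simp
  rw [e μ, e ν, hc, hs]

/-- The flow of `F` transports one density to the other. -/
theorem exists_flow_map_eq (hF : IsLipField F K B) (hρ : Continuous ρ) (hπ : Continuous π) {C : ℝ}
    (hρC : ∀ x, |ρ x| ≤ C) (hπC : ∀ x, |π x| ≤ C) (hρ0 : ∀ x ∈ unitCube d, 0 ≤ ρ x)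
    (hπ0 : ∀ x ∈ unitCube d, 0 ≤ π x) (hρP : IsProbabilityMeasure (cubeMeasure ρ))
    (hπP : IsProbabilityMeasure (cubeMeasure π))
    (hFρ : ∀ x ∈ unitCube d, ∀ t ∈ Icc (0 : ℝ) 1, ∀ j,
      F x t j * ((1 - t) * π x + t * ρ x) = flux π j x - flux ρ j x) :
    ∃ X : EuclideanSpace ℝ (Fin d) → ℝ → EuclideanSpace ℝ (Fin d),
      (∀ x, X x 0 = x ∧ IsCurve F (X x)) ∧ Continuous (fun x => X x 1) ∧
      (cubeMeasure π).map (fun x => X x 1) = cubeMeasure ρ := by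
  classical
  choose! Φ hΦ using fun (t : ℝ) (ht : t ∈ Icc (0 : ℝ) 1) y => hF.exists_curve ht y
  have hΦ' : ∀ t ∈ Icc (0 : ℝ) 1, ∀ y, Φ t y t = y ∧ IsCurve F (Φ t y) := fun t ht y => hΦ t ht y
  have h0 : (0 : ℝ) ∈ Icc (0 : ℝ) 1 := by simp
  have hX : Continuous fun x => Φ 0 x 1 := by
    have : LipschitzWith (Real.toNNReal (Real.exp K)) fun x => Φ 0 x 1 := by
      refine LipschitzWith.of_dist_le_mul fun x y => ?_
      have h := IsCurve.dist_le hF (hΦ' 0 h0 x).2 (hΦ' 0 h0 y).2 le_rfl zero_le_one le_rfl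
      rw [(hΦ' 0 h0 x).1, (hΦ' 0 h0 y).1, sub_zero, mul_one] at h
      rw [Real.coe_toNNReal _ (Real.exp_pos _).le, mul_comm]
      exact h
    exact this.continuous
  have one : ∀ {q : EuclideanSpace ℝ (Fin d) → ℝ}, Continuous q → (∀ x ∈ unitCube d, 0 ≤ q x) →
      IsProbabilityMeasure (cubeMeasure q) → ∫ x in unitCube d, q x = 1 := by
    intro q hq hq0 hP
    have := integral_cubeMeasure hq hq0 (fun _ => 1)
    simpa using this.symm
  refine ⟨Φ 0, hΦ' 0 h0, hX, ?_⟩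
  have := Measure.isProbabilityMeasure_map (μ := cubeMeasure π) hX.measurable.aemeasurable
  refine ext_of_integral_lipschitz fun φ Kφ hφ ⟨Bφ, hBφ⟩ => ?_
  rw [integral_map hX.measurable.aemeasurable hφ.continuous.aestronglyMeasurable,
    integral_cubeMeasure hπ hπ0, integral_cubeMeasure hρ hρ0]
  exact integral_flow_eq hF hρ hπ hρC hπC (one hρ hρ0 hρP) (one hπ hπ0 hπP) hFρ hΦ' hφ hBφ

end Transport

/-! ### Lipschitz bounds from local polynomial approximation -/

section LocLipschitz

theorem abs_prod_sub_prod_le {κ : Type*} (s : Finset κ) {x y : κ → ℝ}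
    (hx : ∀ i ∈ s, x i ∈ Icc (0 : ℝ) 1) (hy : ∀ i ∈ s, y i ∈ Icc (0 : ℝ) 1) :
    |∏ i ∈ s, x i - ∏ i ∈ s, y i| ≤ ∑ i ∈ s, |x i - y i| := by
  classical
  induction s using Finset.induction_on with
  | empty => simp
  | insert i s hi ih =>
    rw [Finset.prod_insert hi, Finset.prod_insert hi, Finset.sum_insert hi]
    have hxi := hx i (by simp)
    have hyi := hy i (by simp)
    have ih := ih (fun j hj => hx j (by simp [hj])) (fun j hj => hy j (by simp [hj]))
    have hp0 : 0 ≤ ∏ i ∈ s, y i := Finset.prod_nonneg fun j hj => (hy j (by simp [hj])).1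
    have hp1 : ∏ i ∈ s, y i ≤ 1 :=
      Finset.prod_le_one (fun j hj => (hy j (by simp [hj])).1) fun j hj => (hy j (by simp [hj])).2
    have e : x i * ∏ i ∈ s, x i - y i * ∏ i ∈ s, y i =
        (x i - y i) * ∏ i ∈ s, y i + x i * (∏ i ∈ s, x i - ∏ i ∈ s, y i) := by ring
    rw [e]
    refine (abs_add_le _ _).trans (add_le_add ?_ ?_)
    · rw [abs_mul, abs_of_nonneg hp0]
      exact mul_le_of_le_one_right (abs_nonneg _) hp1
    · rw [abs_mul, abs_of_nonneg hxi.1]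
      exact (mul_le_of_le_one_left (abs_nonneg _) hxi.2).trans ih

variable {ι T : Type*} [Fintype ι] [DecidableEq ι] {k D : ℕ} {M : ℝ} {p : (ι → ℝ) → ℝ}
  {a : T → ι → ℝ} {u : T → (ι → ℝ) → ℝ}

theorem IsBddPoly.abs_sub_le (hp : IsBddPoly D M p) {z a : ι → ℝ} (hz : z ∈ Icc (0 : ι → ℝ) 1)
    (ha : a ∈ Icc (0 : ι → ℝ) 1) :
    |p z - p a| ≤ Fintype.card (ι → Fin (D + 1)) * (M * (Fintype.card ι * (D * dist z a))) := by
  have hM := hp.nonneg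
  obtain ⟨c, hc, hp⟩ := hp
  rw [hp, hp, ← Finset.sum_sub_distrib]
  refine (Finset.abs_sum_le_sum_abs _ _).trans ?_
  refine (Finset.sum_le_card_nsmul _ _ (M * (Fintype.card ι * (D * dist z a))) fun α _ => ?_).trans
    (by simp)
  rw [← mul_sub, abs_mul]
  refine mul_le_mul (hc α) ?_ (abs_nonneg _) hM
  have hmem : ∀ {z : ι → ℝ}, z ∈ Icc (0 : ι → ℝ) 1 → ∀ i, z i ∈ Icc (0 : ℝ) 1 :=
    fun hz i => ⟨hz.1 i, hz.2 i⟩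
  refine (abs_prod_sub_prod_le _
    (fun i _ => ⟨pow_nonneg (hmem hz i).1 _, pow_le_one₀ (hmem hz i).1 (hmem hz i).2⟩)
    (fun i _ => ⟨pow_nonneg (hmem ha i).1 _, pow_le_one₀ (hmem ha i).1 (hmem ha i).2⟩)).trans ?_
  refine (Finset.sum_le_card_nsmul _ _ (D * dist z a) fun i _ => ?_).trans (by simp)
  have h := abs_prod_sub_prod_le (Finset.range (α i)) (x := fun _ => z i) (y := fun _ => a i)
    (fun _ _ => hmem hz i) (fun _ _ => hmem ha i)
  simp only [Finset.prod_const, Finset.sum_const, Finset.card_range, nsmul_eq_mul] at h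
  refine h.trans (mul_le_mul ?_ (dist_le_pi_dist z a i) (abs_nonneg _) (Nat.cast_nonneg _))
  exact_mod_cast Nat.lt_succ_iff.1 (α i).2

/-- For k ≥ 1 the function and its polynomial agree at the base point, and polynomials with bounded
coefficients are Lipschitz on the cube. When the base point is arbitrary this becomes a genuine
Lipschitz bound. -/
theorem ULoc.exists_abs_sub_le (hu : ULoc k D a u) (hk : 1 ≤ k)
    (ha : ∀ τ, a τ ∈ Icc (0 : ι → ℝ) 1) :
    ∃ K : ℝ, 0 ≤ K ∧ ∀ τ, ∀ z ∈ Icc (0 : ι → ℝ) 1, |u τ z - u τ (a τ)| ≤ K * dist z (a τ) := by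
  obtain ⟨M, hM⟩ := hu
  refine ⟨|M| + Fintype.card (ι → Fin (D + 1)) * (|M| * (Fintype.card ι * D)), by positivity,
    fun τ z hz => ?_⟩
  obtain ⟨p, hp, hup⟩ := hM τ
  have h1 := hup z hz
  have h2 := hup _ (ha τ)
  have h3 := hp.abs_sub_le hz (ha τ)
  rw [dist_self, zero_pow (by omega), mul_zero] at h2
  rw [abs_of_nonneg hp.nonneg]
  have h4 : M * dist z (a τ) ^ k ≤ M * dist z (a τ) :=
    mul_le_mul_of_nonneg_left
      (pow_le_of_le_one dist_nonneg (dist_le_one_of_mem_Icc hz (ha τ)) (by omega)) hp.nonneg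
  calc |u τ z - u τ (a τ)| = |(u τ z - p z) + (p z - p (a τ)) - (u τ (a τ) - p (a τ))| := by ring_nf
    _ ≤ |u τ z - p z| + |p z - p (a τ)| + |u τ (a τ) - p (a τ)| :=
      (abs_sub _ _).trans (by gcongr; exact abs_add_le _ _)
    _ ≤ _ := by linarith

theorem ULoc.exists_abs_le (hu : ULoc k D a u) (ha : ∀ τ, a τ ∈ Icc (0 : ι → ℝ) 1) :
    ∃ B : ℝ, 0 ≤ B ∧ ∀ τ, ∀ z ∈ Icc (0 : ι → ℝ) 1, |u τ z| ≤ B := by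
  obtain ⟨M, hM⟩ := hu
  refine ⟨|M| + Fintype.card (ι → Fin (D + 1)) * |M|, by positivity, fun τ z hz => ?_⟩
  obtain ⟨p, hp, hup⟩ := hM τ
  have h1 := hup z hz
  have h3 := hp.abs_apply_le hz
  rw [abs_of_nonneg hp.nonneg]
  have h4 : M * dist z (a τ) ^ k ≤ M :=
    mul_le_of_le_one_right hp.nonneg (pow_le_one₀ dist_nonneg (dist_le_one_of_mem_Icc hz (ha τ)))
  calc |u τ z| = |(u τ z - p z) + p z| := by ring_nf
    _ ≤ |u τ z - p z| + |p z| := abs_add_le _ _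
    _ ≤ _ := by linarith

end LocLipschitz

/-! ### Clamping to the unit cube -/

section Clamp

variable {ι : Type*} {d : ℕ}

/-- The coordinatewise projection to the unit cube. -/
def clampPi (z : ι → ℝ) : ι → ℝ := fun i => max 0 (min 1 (z i))

theorem clampPi_mem (z : ι → ℝ) : clampPi z ∈ Icc (0 : ι → ℝ) 1 :=
  ⟨fun _ => le_max_left _ _, fun _ => max_le zero_le_one (min_le_left _ _)⟩

theorem clampPi_eq {z : ι → ℝ} (hz : z ∈ Icc (0 : ι → ℝ) 1) : clampPi z = z := by
  funext i
  have h1 := hz.1 i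
  have h2 := hz.2 i
  simp only [Pi.zero_apply, Pi.one_apply] at h1 h2
  simp [clampPi, h1, h2]

theorem dist_clampPi_le [Fintype ι] (z a : ι → ℝ) : dist (clampPi z) (clampPi a) ≤ dist z a := by
  refine (dist_pi_le_iff dist_nonneg).2 fun i => ?_
  refine le_trans ?_ (dist_le_pi_dist z a i)
  simp only [clampPi, Real.dist_eq]
  have h1 := abs_max_sub_max_le_abs (min 1 (z i)) (min 1 (a i)) 0
  have h2 := abs_min_sub_min_le_max 1 (z i) 1 (a i)
  rw [sub_self, abs_zero, max_eq_right (abs_nonneg _)] at h2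
  rw [max_comm 0, max_comm 0]
  exact h1.trans h2

/-- The projection of Euclidean space to the unit cube. -/
def clampE (x : EuclideanSpace ℝ (Fin d)) : EuclideanSpace ℝ (Fin d) :=
  WithLp.toLp 2 (clampPi x.ofLp)

theorem clampE_mem (x : EuclideanSpace ℝ (Fin d)) : clampE x ∈ unitCube d :=
  fun i => ⟨(clampPi_mem x.ofLp).1 i, (clampPi_mem x.ofLp).2 i⟩

theorem clampE_eq {x : EuclideanSpace ℝ (Fin d)} (hx : x ∈ unitCube d) : clampE x = x := by
  unfold clampE
  rw [clampPi_eq ⟨fun i => (hx i).1, fun i => (hx i).2⟩]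

theorem continuous_clampE : Continuous (clampE (d := d)) := by
  unfold clampE clampPi
  fun_prop

theorem snoc_mem {x : EuclideanSpace ℝ (Fin d)} (hx : x ∈ unitCube d) {t : ℝ}
    (ht : t ∈ Icc (0 : ℝ) 1) :
    (Fin.snoc (α := fun _ => ℝ) (fun i => x i) t : Fin (d + 1) → ℝ) ∈
      Icc (0 : Fin (d + 1) → ℝ) 1 := by
  constructor <;> intro i <;> refine Fin.lastCases ?_ (fun i => ?_) i
  · simpa using ht.1
  · simpa using (hx i).1
  · simpa using ht.2
  · simpa using (hx i).2

theorem spatial_snoc (x : EuclideanSpace ℝ (Fin d)) (t : ℝ) :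
    spatial (Fin.snoc (α := fun _ => ℝ) (fun i => x i) t) = x := by
  ext i
  simp [spatial]

theorem dist_snoc_le (x y : EuclideanSpace ℝ (Fin d)) (t s : ℝ) :
    dist (Fin.snoc (α := fun _ => ℝ) (fun i => x i) t : Fin (d + 1) → ℝ)
      (Fin.snoc (α := fun _ => ℝ) (fun i => y i) s) ≤ ‖x - y‖ + |t - s| := by
  refine (dist_pi_le_iff (by positivity)).2 fun i => Fin.lastCases ?_ (fun i => ?_) i
  · simp only [Fin.snoc_last, Real.dist_eq]
    exact le_add_of_nonneg_left (norm_nonneg _)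
  · simp only [Fin.snoc_castSucc, Real.dist_eq]
    have := PiLp.norm_apply_le (x - y) i
    rw [PiLp.sub_apply, Real.norm_eq_abs] at this
    exact this.trans (le_add_of_nonneg_right (abs_nonneg _))

theorem norm_toLp_sub_le {v w : Fin d → ℝ} {C : ℝ} (h : ∀ j, |v j - w j| ≤ C) :
    ‖(WithLp.toLp 2 v : EuclideanSpace ℝ (Fin d)) - WithLp.toLp 2 w‖ ≤ d * C := by
  refine (euclidean_norm_le_sum _).trans ?_
  exact (Finset.sum_le_card_nsmul _ _ C fun j _ => h j).trans (by simp)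

open scoped NNReal in
-- Composition with the projection extends bounds on the cube to all of space and time, so that
-- solutions exist globally and the flow maps are Lipschitz.
theorem isLipField_toVelocity_clampPi {u : (Fin (d + 1) → ℝ) → Fin d → ℝ} {K B : ℝ≥0}
    (hK : ∀ z ∈ Icc (0 : Fin (d + 1) → ℝ) 1, ∀ a ∈ Icc (0 : Fin (d + 1) → ℝ) 1, ∀ j,
      |u z j - u a j| ≤ K * dist z a)
    (hB : ∀ z ∈ Icc (0 : Fin (d + 1) → ℝ) 1, ∀ j, |u z j| ≤ B) :
    IsLipField (toVelocity fun z => u (clampPi z)) (d * K) (d * B) := by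
  constructor
  · intro x y t s
    unfold toVelocity
    have := norm_toLp_sub_le fun j => hK _ (clampPi_mem (Fin.snoc (α := fun _ => ℝ) (fun i => x i) t))
      _ (clampPi_mem (Fin.snoc (α := fun _ => ℝ) (fun i => y i) s)) j
    refine this.trans ?_
    push_cast
    rw [mul_assoc]
    gcongr
    exact (dist_clampPi_le _ _).trans (dist_snoc_le x y t s)
  · intro x t
    unfold toVelocity
    have := norm_toLp_sub_le (w := 0) (C := B) (v := u (clampPi (Fin.snoc (α := fun _ => ℝ) (fun i => x i) t)))
      fun j => by simpa using hB _ (clampPi_mem _) j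
    simpa using this

end Clamp

/-! ### The flux of a density as a combination of averages -/

section FluxAverage

variable {d k : ℕ} {L₁ L₂ : ℝ} {q : EuclideanSpace ℝ (Fin d) → ℝ}

/-- With the next two, the averages from which the transport field is built: the density itself, its
partial averages, and the integral term of the flux, where the j-th coordinate is scaled by a
uniform factor. -/
theorem isCubeAverage_id :
    IsCubeAverage (Measure.dirac ()) (fun _ : Unit => (1 : Fin d → ℝ)) (fun _ => 0) where
  prob := inferInstance
  meas_l := measurable_const
  meas_b := measurable_const
  l_mem := .of_forall fun _ _ => by simp
  maps := .of_forall fun _ x hx i => by simpa [diagAffine] using hx i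

theorem isCubeAverage_marg (j : Fin d) :
    IsCubeAverage (unifCube d) (fun _ i => if (i : ℕ) < j then (1 : ℝ) else 0)
      (fun r i => if (i : ℕ) < j then 0 else r i) where
  prob := inferInstance
  meas_l := measurable_const
  meas_b := measurable_pi_lambda _ fun i => by split_ifs <;> fun_prop
  l_mem := .of_forall fun _ i => by split_ifs <;> simp
  maps := by
    filter_upwards [ae_unifCube_mem d] with r hr x hx i
    simp only [diagAffine]
    split_ifs
    · simpa using hx i
    · simpa using hr i

theorem isCubeAverage_scaled_marg (j : Fin d) :
    IsCubeAverage ((volume.restrict (Icc (0 : ℝ) 1)).prod (unifCube d))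
      (fun p i => if (i : ℕ) < j then (1 : ℝ) else if i = j then p.1 else 0)
      (fun p i => if (i : ℕ) < j + 1 then 0 else p.2 i) where
  prob := inferInstance
  meas_l := measurable_pi_lambda _ fun i => by split_ifs <;> fun_prop
  meas_b := measurable_pi_lambda _ fun i => by split_ifs <;> fun_prop
  l_mem := by
    have h : ∀ᵐ p ∂(volume.restrict (Icc (0 : ℝ) 1)).prod (unifCube d), p.1 ∈ Icc (0 : ℝ) 1 :=
      Measure.quasiMeasurePreserving_fst.ae (ae_restrict_mem measurableSet_Icc)
    filter_upwards [h] with p hp i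
    split_ifs
    · simp
    · exact hp
    · simp
  maps := by
    have h : ∀ᵐ p ∂(volume.restrict (Icc (0 : ℝ) 1)).prod (unifCube d), p.1 ∈ Icc (0 : ℝ) 1 :=
      Measure.quasiMeasurePreserving_fst.ae (ae_restrict_mem measurableSet_Icc)
    have h' : ∀ᵐ p ∂(volume.restrict (Icc (0 : ℝ) 1)).prod (unifCube d),
        ∀ i, p.2 i ∈ Icc (0 : ℝ) 1 :=
      Measure.quasiMeasurePreserving_snd.ae (ae_unifCube_mem d)
    filter_upwards [h, h'] with p hp hp' x hx i
    simp only [diagAffine]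
    by_cases h1 : (i : ℕ) < j
    · simpa [h1, h1.trans (Nat.lt_succ_self _)] using hx i
    · by_cases h2 : i = j
      · subst h2
        simpa using ⟨mul_nonneg hp.1 (hx i).1, mul_le_one₀ hp.2 (hx i).1 (hx i).2⟩
      · have h3 : ¬ (i : ℕ) < j + 1 := by
          have : (i : ℕ) ≠ j := fun h => h2 (Fin.ext h)
          omega
        simpa [h1, h2, h3] using hp' i

theorem IsCubeDensity.continuous_comp_clampE (hq : IsCubeDensity k L₁ L₂ q) :
    Continuous (q ∘ clampE) :=
  hq.contDiffOn.continuousOn.comp_continuous continuous_clampE clampE_mem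

theorem margAvg_comp_clampE (j : Fin d) {x : EuclideanSpace ℝ (Fin d)} (hx : x ∈ unitCube d) :
    margAvg (q ∘ clampE) j x = ∫ r, q (diagAffine (fun i => if (i : ℕ) < j then (1 : ℝ) else 0)
      (fun i => if (i : ℕ) < j then 0 else r i) x) ∂unifCube d := by
  refine integral_congr_ae ?_
  filter_upwards [(isCubeAverage_marg j).maps] with r hr
  have h := hr x hx
  have e : (WithLp.toLp 2 fun i : Fin d => if (i : ℕ) < j then x i else r i) =
      diagAffine (fun i => if (i : ℕ) < j then (1 : ℝ) else 0)
      (fun i => if (i : ℕ) < j then 0 else r i) x := by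
    ext i
    simp only [diagAffine]
    split_ifs <;> simp
  rw [e, Function.comp_apply, clampE_eq h]

theorem integral_margAvg_comp_clampE (hq : IsCubeDensity k L₁ L₂ q) (hL : 0 ≤ L₁) (j : Fin d)
    {x : EuclideanSpace ℝ (Fin d)} (hx : x ∈ unitCube d) :
    ∫ s in Icc (0 : ℝ) 1, margAvg (q ∘ clampE) (j + 1)
      (WithLp.toLp 2 (Function.update x.ofLp j (s * x j))) =
    ∫ p, q (diagAffine (fun i => if (i : ℕ) < j then (1 : ℝ) else if i = j then p.1 else 0)
      (fun i => if (i : ℕ) < j + 1 then 0 else p.2 i) x)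
      ∂(volume.restrict (Icc (0 : ℝ) 1)).prod (unifCube d) := by
  have hA := isCubeAverage_scaled_marg j
  have hint := hA.integrable hq.contDiffOn.continuousOn (fun x hx => hq.abs_le hL hx) hx
  rw [integral_prod _ hint]
  refine integral_congr_ae ?_
  filter_upwards [Measure.ae_ae_of_ae_prod hA.maps] with s hs
  refine integral_congr_ae ?_
  filter_upwards [hs] with r hr
  have h := hr x hx
  have e : (WithLp.toLp 2 fun i : Fin d => if (i : ℕ) < j + 1 then
      (WithLp.toLp 2 (Function.update x.ofLp j (s * x j)) : EuclideanSpace ℝ (Fin d)) i else r i) =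
      diagAffine (fun i => if (i : ℕ) < j then (1 : ℝ) else if i = j then s else 0)
      (fun i => if (i : ℕ) < j + 1 then 0 else r i) x := by
    ext i
    simp only [diagAffine]
    by_cases h1 : (i : ℕ) < j
    · have h2 : i ≠ j := fun h => by subst h; exact lt_irrefl _ h1
      simp [h1, h1.trans (Nat.lt_succ_self _), h2]
    · by_cases h2 : i = j
      · subst h2
        simp
      · have h3 : ¬ (i : ℕ) < j + 1 := by
          have : (i : ℕ) ≠ j := fun h => h2 (Fin.ext h)
          omega
        simp [h1, h2, h3]
  rw [e, Function.comp_apply, clampE_eq h]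

variable {T : Type*} {a : T → Fin (d + 1) → ℝ} {Q R : T → EuclideanSpace ℝ (Fin d) → ℝ}

theorem uLoc_density (hQ : ∀ τ, IsCubeDensity k L₁ L₂ (Q τ)) (hL : 0 ≤ L₁) (hk : 1 ≤ k)
    (ha : ∀ τ, a τ ∈ Icc (0 : Fin (d + 1) → ℝ) 1) : ULoc k k a (fun τ z => Q τ (spatial z)) := by
  refine (isCubeAverage_id.uLoc hQ hL hk ha).congr fun τ z _ => ?_
  rw [integral_dirac]
  congr 1
  ext i
  simp [diagAffine]

theorem uLoc_flux (hQ : ∀ τ, IsCubeDensity k L₁ L₂ (Q τ)) (hL : 0 ≤ L₁) (hk : 1 ≤ k)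
    (ha : ∀ τ, a τ ∈ Icc (0 : Fin (d + 1) → ℝ) 1) (j : Fin d) :
    ULoc k (1 + k) a (fun τ z => flux (Q τ ∘ clampE) j (spatial z)) := by
  refine ((uLoc_coord j.castSucc).mul ha (((isCubeAverage_scaled_marg j).uLoc hQ hL hk ha).sub ha
    ((isCubeAverage_marg j).uLoc hQ hL hk ha))).congr fun τ z hz => ?_
  unfold flux
  rw [integral_margAvg_comp_clampE (hQ τ) hL j (spatial_mem hz),
    margAvg_comp_clampE j (spatial_mem hz)]
  rfl

/-- The `j`-th coordinate of the field transporting `π` to `ρ`, at the point `z = (x, t)`. -/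
noncomputable def transportCoord (ρ π : EuclideanSpace ℝ (Fin d) → ℝ) (j : Fin d)
    (z : Fin (d + 1) → ℝ) : ℝ :=
  (flux (π ∘ clampE) j (spatial z) - flux (ρ ∘ clampE) j (spatial z)) *
    ((1 - z (Fin.last d)) * π (spatial z) + z (Fin.last d) * ρ (spatial z))⁻¹

theorem le_interpolation {ρ π : EuclideanSpace ℝ (Fin d) → ℝ} (hρ : IsCubeDensity k L₁ L₂ ρ)
    (hπ : IsCubeDensity k L₁ L₂ π) {x : EuclideanSpace ℝ (Fin d)} (hx : x ∈ unitCube d) {t : ℝ}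
    (ht : t ∈ Icc (0 : ℝ) 1) : L₂ ≤ (1 - t) * π x + t * ρ x := by
  have h1 := mul_le_mul_of_nonneg_left (hπ.lower_bound x hx) (sub_nonneg.2 ht.2)
  have h2 := mul_le_mul_of_nonneg_left (hρ.lower_bound x hx) ht.1
  linarith

theorem transportCoord_eq_zero {ρ π : EuclideanSpace ℝ (Fin d) → ℝ} (hρ : IsCubeDensity k L₁ L₂ ρ)
    (hπ : IsCubeDensity k L₁ L₂ π) (hL : 0 ≤ L₁) (j : Fin d) {z : Fin (d + 1) → ℝ}
    (hz : z j.castSucc = 0 ∨ z j.castSucc = 1) : transportCoord ρ π j z = 0 := by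
  have h : ∀ {q}, IsCubeDensity k L₁ L₂ q → flux (q ∘ clampE) j (spatial z) = 0 := fun hq =>
    flux_eq_zero_of_coord hq.continuous_comp_clampE
      (fun x => hq.abs_le hL (clampE_mem x)) j (x := spatial z) hz
  rw [transportCoord, h hρ, h hπ, sub_self, zero_mul]

/-- Numerator and interpolated density both have degree 1 + k; inverting the latter multiplies its
degree by k. The lower bound L₂ passes to convex combinations and makes the inversion possible. -/
theorem uLoc_transportCoord (hR : ∀ τ, IsCubeDensity k L₁ L₂ (R τ))
    (hQ : ∀ τ, IsCubeDensity k L₁ L₂ (Q τ)) (hL : 0 ≤ L₁) (hL₂ : 0 < L₂) (hk : 1 ≤ k)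
    (ha : ∀ τ, a τ ∈ Icc (0 : Fin (d + 1) → ℝ) 1) (j : Fin d) :
    ULoc k (1 + k + k * (1 + k)) a (fun τ => transportCoord (R τ) (Q τ) j) := by
  have hden : ULoc k (1 + k) a (fun τ z => (1 - z (Fin.last d)) * Q τ (spatial z) +
      z (Fin.last d) * R τ (spatial z)) := by
    refine ULoc.add (ULoc.mul ha ?_ (uLoc_density hQ hL hk ha))
      ((uLoc_coord _).mul ha (uLoc_density hR hL hk ha))
    exact (uLoc_const (C := 1) (c := fun _ => 1) (by simp)).sub ha (uLoc_coord _)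
  obtain ⟨K, -, hK⟩ := hden.exists_abs_sub_le hk ha
  refine ((uLoc_flux hQ hL hk ha j).sub ha (uLoc_flux hR hL hk ha j)).mul ha
    (hden.inv ha hL₂ (K := K) (fun τ z hz => ?_) fun τ z hz => ?_)
  · exact le_interpolation (hR τ) (hQ τ) (spatial_mem hz) ⟨hz.1 _, hz.2 _⟩
  · rw [abs_sub_comm]
    exact hK τ z hz

end FluxAverage

/-! ### Regularity of ReLU² networks -/

section NetLipschitz

open scoped NNReal

theorem AffineLayer.locallyLipschitz_apply {m n : ℕ} (A : AffineLayer m n) :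
    LocallyLipschitz A.apply := by
  have h : ContDiff ℝ 1 A.apply := by
    unfold AffineLayer.apply
    refine ContDiff.add ?_ contDiff_const
    exact (LinearMap.toContinuousLinearMap (Matrix.mulVecLin A.weight)).contDiff
  exact h.locallyLipschitz

theorem locallyLipschitz_reluSq {n : ℕ} : LocallyLipschitz (reluSq (n := n)) := by
  have h1 : LocallyLipschitz fun v : Fin n → ℝ => fun i => v i ^ 2 := by
    have : ContDiff ℝ 1 fun v : Fin n → ℝ => fun i => v i ^ 2 := by fun_prop
    exact this.locallyLipschitz
  have h2 : LipschitzWith 1 fun v : Fin n → ℝ => fun i => max 0 (v i) := by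
    refine LipschitzWith.of_dist_le_mul fun v w => ?_
    rw [NNReal.coe_one, one_mul]
    refine (dist_pi_le_iff dist_nonneg).2 fun i => ?_
    refine le_trans ?_ (dist_le_pi_dist v w i)
    rw [Real.dist_eq, Real.dist_eq, max_comm 0, max_comm 0]
    exact abs_max_sub_max_le_abs _ _ _
  exact h1.comp h2.locallyLipschitz

variable {m n W : ℕ}

theorem ReLUSqNet.locallyLipschitz_eval (N : ReLUSqNet m n W) : LocallyLipschitz N.eval := by
  have hmid : ∀ (l : List (AffineLayer W W)) (f : (Fin m → ℝ) → Fin W → ℝ), LocallyLipschitz f →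
      LocallyLipschitz fun x => l.foldl (fun v A => A.apply (reluSq v)) (f x) := by
    intro l
    induction l with
    | nil => exact fun f hf => hf
    | cons A l ih =>
      exact fun f hf => ih (fun x => A.apply (reluSq (f x)))
        (A.locallyLipschitz_apply.comp (locallyLipschitz_reluSq.comp hf))
  exact N.last.locallyLipschitz_apply.comp
    (locallyLipschitz_reluSq.comp (hmid N.mid _ N.first.locallyLipschitz_apply))

/-- These constants depend on the network without any control. They serve existence and uniqueness
of its flow only and do not enter the error estimate. -/
theorem ReLUSqNet.exists_bounds (N : ReLUSqNet m n W) :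
    ∃ K B : ℝ≥0, (∀ z ∈ Icc (0 : Fin m → ℝ) 1, ∀ a ∈ Icc (0 : Fin m → ℝ) 1, ∀ j,
      |N.eval z j - N.eval a j| ≤ K * dist z a) ∧
      ∀ z ∈ Icc (0 : Fin m → ℝ) 1, ∀ j, |N.eval z j| ≤ B := by
  obtain ⟨K, hK⟩ := (N.locallyLipschitz_eval.locallyLipschitzOn
    (s := Icc 0 1)).exists_lipschitzOnWith_of_compact isCompact_Icc
  have hlip : ∀ z ∈ Icc (0 : Fin m → ℝ) 1, ∀ a ∈ Icc (0 : Fin m → ℝ) 1, ∀ j,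
      |N.eval z j - N.eval a j| ≤ K * dist z a := fun z hz a ha j =>
    (dist_le_pi_dist (N.eval z) (N.eval a) j).trans (hK.dist_le_mul z hz a ha)
  refine ⟨K, K + ‖N.eval 0‖₊, hlip, fun z hz j => ?_⟩
  have h0 : (0 : Fin m → ℝ) ∈ Icc (0 : Fin m → ℝ) 1 := ⟨le_rfl, fun _ => zero_le_one⟩
  have h1 := hlip z hz 0 h0 j
  have h2 : (K : ℝ) * dist z 0 ≤ K := mul_le_of_le_one_right K.2 (dist_le_one_of_mem_Icc hz h0)
  have h3 : |N.eval 0 j| ≤ ‖N.eval 0‖ := norm_le_pi_norm (N.eval 0) j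
  push_cast
  calc |N.eval z j| = |(N.eval z j - N.eval 0 j) + N.eval 0 j| := by ring_nf
    _ ≤ |N.eval z j - N.eval 0 j| + |N.eval 0 j| := abs_add_le _ _
    _ ≤ _ := by linarith

end NetLipschitz

/-! ### Invariance of the cube and stability of flows -/

section Stability

open Filter Topology
open scoped NNReal

variable {d : ℕ} {G : EuclideanSpace ℝ (Fin d) → ℝ → EuclideanSpace ℝ (Fin d)}

/-- Continuous induction: the times spent in the cube form a closed set, and from each such time the
curve stays inside for a while, since at a face the strict sign of the normal velocity decides and
elsewhere continuity does. -/
theorem IsCurve.mem_unitCube {α : ℝ → EuclideanSpace ℝ (Fin d)} (hα : IsCurve G α)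
    (h0 : α 0 ∈ unitCube d)
    (hlow : ∀ x ∈ unitCube d, ∀ t ∈ Icc (0 : ℝ) 1, ∀ j, x j = 0 → 0 < G x t j)
    (hhigh : ∀ x ∈ unitCube d, ∀ t ∈ Icc (0 : ℝ) 1, ∀ j, x j = 1 → G x t j < 0) {t : ℝ}
    (ht : t ∈ Icc (0 : ℝ) 1) : α t ∈ unitCube d := by
  have hclosed : IsClosed (α ⁻¹' unitCube d ∩ Icc 0 1) := by
    rw [inter_comm]
    exact hα.continuousOn.preimage_isClosed_of_isClosed isClosed_Icc (isClosed_unitCube d)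
  refine hclosed.Icc_subset_of_forall_mem_nhdsWithin h0 (fun s hs => ?_) ht
  have hs1 : s ∈ Icc (0 : ℝ) 1 := Ico_subset_Icc_self hs.2
  have hcoord : ∀ j, HasDerivWithinAt (fun r => α r j) (G (α s) s j) (Ioi s) s := fun j =>
    ((EuclideanSpace.proj (𝕜 := ℝ) j).hasFDerivAt.comp_hasDerivWithinAt s
      (hα.hasDerivWithinAt_Ici hs.2)).mono Ioi_subset_Ici_self
  have hslope : ∀ j, Tendsto (slope (fun r => α r j) s) (𝓝[>] s) (𝓝 (G (α s) s j)) := fun j =>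
    (hasDerivWithinAt_iff_tendsto_slope' (by simp)).1 (hcoord j)
  have hgt : ∀ᶠ r in 𝓝[>] s, s < r := self_mem_nhdsWithin
  have hcont : ∀ j, Tendsto (fun r => α r j) (𝓝[>] s) (𝓝 (α s j)) := fun j =>
    (hcoord j).continuousWithinAt
  have hev : ∀ j, ∀ᶠ r in 𝓝[>] s, α r j ∈ Icc (0 : ℝ) 1 := by
    intro j
    have h0 : ∀ᶠ r in 𝓝[>] s, 0 ≤ α r j := by
      rcases (hs.1 j).1.eq_or_lt with h | h
      · filter_upwards [(hslope j).eventually_const_lt (hlow _ hs.1 s hs1 j h.symm), hgt]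
          with r hr hr'
        rw [slope_def_field, lt_div_iff₀ (sub_pos.2 hr'), zero_mul, ← h, sub_zero] at hr
        exact hr.le
      · filter_upwards [(hcont j).eventually_const_lt h] with r hr using hr.le
    have h1 : ∀ᶠ r in 𝓝[>] s, α r j ≤ 1 := by
      rcases (hs.1 j).2.eq_or_lt with h | h
      · filter_upwards [(hslope j).eventually_lt_const (hhigh _ hs.1 s hs1 j h), hgt]
          with r hr hr'
        rw [slope_def_field, div_lt_iff₀ (sub_pos.2 hr'), zero_mul, h] at hr
        linarith
      · filter_upwards [(hcont j).eventually_lt_const h] with r hr using hr.le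
    filter_upwards [h0, h1] with r h h' using ⟨h, h'⟩
  exact eventually_all.2 hev

theorem IsCurve.congr {H : EuclideanSpace ℝ (Fin d) → ℝ → EuclideanSpace ℝ (Fin d)}
    {α : ℝ → EuclideanSpace ℝ (Fin d)} (hα : IsCurve G α)
    (h : ∀ t ∈ Icc (0 : ℝ) 1, G (α t) t = H (α t) t) : IsCurve H α :=
  fun t ht => h t ht ▸ hα t ht

/-- Gronwall's inequality with the Lipschitz constant of `F`; the other field has to be close to `F`
only along its own curve. -/
theorem IsCurve.dist_le_of_approx {F : EuclideanSpace ℝ (Fin d) → ℝ → EuclideanSpace ℝ (Fin d)}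
    {K B : ℝ≥0} (hF : IsLipField F K B) {α β : ℝ → EuclideanSpace ℝ (Fin d)} (hα : IsCurve F α)
    (hβ : IsCurve G β) (h0 : α 0 = β 0) {δ : ℝ} (hδ : 0 ≤ δ)
    (h : ∀ t ∈ Icc (0 : ℝ) 1, ‖G (β t) t - F (β t) t‖ ≤ δ) :
    dist (α 1) (β 1) ≤ δ * Real.exp (K + 1) := by
  -- The constant is weakened to K + 1 because the Gronwall bound has a different form for constant
  -- zero.
  have := dist_le_of_approx_trajectories_ODE (v := fun t x => F x t) (K := K + 1) (a := 0) (b := 1)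
    (δ := 0) (εf := 0) (εg := δ) (fun t => (hF.lipschitzWith t).weaken (by simp))
    hα.continuousOn (fun _ ht => hα.hasDerivWithinAt_Ici ht) (fun _ _ => by simp)
    hβ.continuousOn (fun _ ht => hβ.hasDerivWithinAt_Ici ht)
    (fun t ht => by rw [dist_eq_norm]; exact h t (Ico_subset_Icc_self ht)) (by simp [h0]) 1 (by simp)
  have hK : ((K + 1 : ℝ≥0) : ℝ) ≠ 0 := by positivity
  rw [gronwallBound_of_K_ne_0 hK] at this
  push_cast at this
  simp only [zero_mul, zero_add, sub_zero, mul_one] at this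
  refine this.trans ?_
  have h1 : δ / ((K : ℝ) + 1) ≤ δ := div_le_self hδ (by simp)
  have h2 : 0 ≤ Real.exp ((K : ℝ) + 1) - 1 := by
    have := Real.one_le_exp (x := (K : ℝ) + 1) (by positivity)
    linarith
  calc δ / ((K : ℝ) + 1) * (Real.exp ((K : ℝ) + 1) - 1) ≤ δ * (Real.exp ((K : ℝ) + 1) - 1) := by gcongr
    _ ≤ _ := by gcongr; linarith

/-- The joint law of X and Y is a coupling, and on a probability space every L^p norm is at most the
essential supremum. -/
theorem wasserstein_map_le {Ω E : Type*} [MeasurableSpace Ω] [NormedAddCommGroup E]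
    [MeasurableSpace E] {P : Measure Ω} [IsProbabilityMeasure P] {X Y : Ω → E}
    (hX : AEMeasurable X P) (hY : AEMeasurable Y P) {C : ℝ} (hC : ∀ᵐ ω ∂P, ‖X ω - Y ω‖ ≤ C)
    (hm : Measurable fun z : E × E => z.1 - z.2) [BorelSpace E] [SecondCountableTopology E]
    (p : ℝ≥0∞) : wasserstein p (P.map X) (P.map Y) ≤ ENNReal.ofReal C := by
  have hXY := hX.prodMk hY
  refine iInf₂_le_of_le (P.map fun ω => (X ω, Y ω)) ⟨?_, ?_⟩ ?_
  · rw [AEMeasurable.map_map_of_aemeasurable measurable_fst.aemeasurable hXY]; rfl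
  · rw [AEMeasurable.map_map_of_aemeasurable measurable_snd.aemeasurable hXY]; rfl
  rw [eLpNorm_map_measure hm.aestronglyMeasurable hXY]
  refine (eLpNorm_le_of_ae_bound hC).trans ?_
  simp

end Stability

/-! ### The transport field -/

section Transport

open scoped NNReal

variable {d k : ℕ} {L₁ L₂ : ℝ}

theorem LocPoly.mono_right {ι : Type*} [Fintype ι] [DecidableEq ι] {k D : ℕ} {M M' : ℝ}
    {u : (ι → ℝ) → ℝ} (hu : LocPoly k D M u) (h : M ≤ M') : LocPoly k D M' u := by
  intro a ha
  obtain ⟨p, hp, hup⟩ := hu a ha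
  exact ⟨p, hp.mono_right h, fun z hz => (hup z hz).trans (by gcongr)⟩

theorem exists_transportCoord_bounds (d : ℕ) (hL : 0 ≤ L₁) (hL₂ : 0 < L₂) (hk : 1 ≤ k) :
    ∃ M : ℝ, ∃ K B : ℝ≥0, ∀ ρ π : EuclideanSpace ℝ (Fin d) → ℝ,
      IsCubeDensity k L₁ L₂ ρ → IsCubeDensity k L₁ L₂ π →
      (∀ ε ∈ Icc (0 : ℝ) 1, ∀ j, LocPoly k (1 + k + k * (1 + k)) M
        fun z => transportCoord ρ π j z + ε * (1 / 2 - z j.castSucc)) ∧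
      (∀ z ∈ Icc (0 : Fin (d + 1) → ℝ) 1, ∀ a ∈ Icc (0 : Fin (d + 1) → ℝ) 1, ∀ j,
        |transportCoord ρ π j z - transportCoord ρ π j a| ≤ K * dist z a) ∧
      ∀ z ∈ Icc (0 : Fin (d + 1) → ℝ) 1, ∀ j, |transportCoord ρ π j z| ≤ B := by
  -- The densities, ε and the base point form one index set, so that the constants of `ULoc` become
  -- uniform in all of them.
  let T := {τ : ((EuclideanSpace ℝ (Fin d) → ℝ) × (EuclideanSpace ℝ (Fin d) → ℝ)) ×
    ℝ × (Fin (d + 1) → ℝ) // (IsCubeDensity k L₁ L₂ τ.1.1 ∧ IsCubeDensity k L₁ L₂ τ.1.2) ∧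
      τ.2.1 ∈ Icc (0 : ℝ) 1 ∧ τ.2.2 ∈ Icc (0 : Fin (d + 1) → ℝ) 1}
  let a : T → Fin (d + 1) → ℝ := fun τ => τ.1.2.2
  have ha : ∀ τ, a τ ∈ Icc (0 : Fin (d + 1) → ℝ) 1 := fun τ => τ.2.2.2
  have hf : ∀ j : Fin d, ULoc k (1 + k + k * (1 + k)) a
      (fun τ : T => transportCoord τ.1.1.1 τ.1.1.2 j) := fun j =>
    uLoc_transportCoord (fun τ : T => τ.2.1.1) (fun τ => τ.2.1.2) hL hL₂ hk ha j
  have hu : ∀ j : Fin d, ULoc k (1 + k + k * (1 + k)) a (fun (τ : T) z =>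
      transportCoord τ.1.1.1 τ.1.1.2 j z + τ.1.2.1 * (1 / 2 - z j.castSucc)) := by
    intro j
    refine (hf j).add (ULoc.const_mul (C := 1) ha (fun τ => ?_) (ULoc.mono (D := 1)
      ((uLoc_const (C := 1 / 2) fun _ => ?_).sub ha (uLoc_coord _)) ?_))
    · rw [abs_of_nonneg τ.2.2.1.1]; exact τ.2.2.1.2
    · rw [abs_of_nonneg (by norm_num)]
    · rw [add_assoc]; exact Nat.le_add_right 1 _
  choose M hM using hu
  choose K hK0 hK using fun j => (hf j).exists_abs_sub_le hk ha
  choose B hB0 hB using fun j => (hf j).exists_abs_le ha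
  have hle : ∀ (c : Fin d → ℝ) j, c j ≤ ∑ j, |c j| := fun c j => (le_abs_self _).trans
    (Finset.single_le_sum (f := fun j => |c j|) (fun _ _ => abs_nonneg _) (Finset.mem_univ j))
  have h0 : ∀ c : Fin d → ℝ, 0 ≤ ∑ j, |c j| := fun c => Finset.sum_nonneg fun _ _ => abs_nonneg _
  refine ⟨∑ j, |M j|, (∑ j, |K j|).toNNReal, (∑ j, |B j|).toNNReal, fun ρ π hρ hπ =>
    ⟨fun ε hε j => LocPoly.mono_right (M := M j) (fun b hb => ?_) (hle M j),
      fun z hz b hb j => ?_, fun z hz j => ?_⟩⟩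
  · exact hM j ⟨((ρ, π), (ε, b)), ⟨hρ, hπ⟩, hε, hb⟩
  · rw [Real.coe_toNNReal _ (h0 K)]
    refine (hK j ⟨((ρ, π), (0, b)), ⟨hρ, hπ⟩, ⟨le_rfl, zero_le_one⟩, hb⟩ z hz).trans ?_
    exact mul_le_mul_of_nonneg_right (hle K j) dist_nonneg
  · rw [Real.coe_toNNReal _ (h0 B)]
    exact (hB j ⟨((ρ, π), (0, z)), ⟨hρ, hπ⟩, ⟨le_rfl, zero_le_one⟩, hz⟩ z hz).trans (hle B j)

theorem cubeMeasure_comp_clampE (q : EuclideanSpace ℝ (Fin d) → ℝ) :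
    cubeMeasure (q ∘ clampE) = cubeMeasure q := by
  refine withDensity_congr_ae ?_
  filter_upwards [ae_restrict_mem (isClosed_unitCube d).measurableSet] with x hx
  rw [Function.comp_apply, clampE_eq hx]

theorem ae_cubeMeasure_mem (q : EuclideanSpace ℝ (Fin d) → ℝ) :
    ∀ᵐ x ∂cubeMeasure q, x ∈ unitCube d :=
  (withDensity_absolutelyContinuous _ _).ae_le
    (ae_restrict_mem (isClosed_unitCube d).measurableSet)

/-- The velocity field transporting `π` to `ρ`, constant outside of the cube. -/
noncomputable def transportField (ρ π : EuclideanSpace ℝ (Fin d) → ℝ) :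
    EuclideanSpace ℝ (Fin d) → ℝ → EuclideanSpace ℝ (Fin d) :=
  toVelocity fun z j => transportCoord ρ π j (clampPi z)

theorem transportField_apply {ρ π : EuclideanSpace ℝ (Fin d) → ℝ} {x : EuclideanSpace ℝ (Fin d)}
    (hx : x ∈ unitCube d) {t : ℝ} (ht : t ∈ Icc (0 : ℝ) 1) (j : Fin d) :
    transportField ρ π x t j =
      transportCoord ρ π j (Fin.snoc (α := fun _ => ℝ) (fun i => x i) t) := by
  unfold transportField toVelocity
  simp only
  rw [clampPi_eq (snoc_mem hx ht)]

theorem exists_transport {ρ π : EuclideanSpace ℝ (Fin d) → ℝ} (hρ : IsCubeDensity k L₁ L₂ ρ)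
    (hπ : IsCubeDensity k L₁ L₂ π) (hL : 0 ≤ L₁) (hL₂ : 0 < L₂) {K B : ℝ≥0}
    (hF : IsLipField (transportField ρ π) K B) :
    ∃ X : EuclideanSpace ℝ (Fin d) → ℝ → EuclideanSpace ℝ (Fin d),
      (∀ x, X x 0 = x ∧ IsCurve (transportField ρ π) (X x)) ∧ Continuous (fun x => X x 1) ∧
      (cubeMeasure π).map (fun x => X x 1) = cubeMeasure ρ := by
  have hnn : ∀ {q}, IsCubeDensity k L₁ L₂ q → ∀ x ∈ unitCube d, 0 ≤ (q ∘ clampE) x := fun hq x _ =>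
    hL₂.le.trans (hq.lower_bound _ (clampE_mem x))
  have h := exists_flow_map_eq hF hρ.continuous_comp_clampE hπ.continuous_comp_clampE (C := L₁)
    (fun x => hρ.abs_le hL (clampE_mem x)) (fun x => hπ.abs_le hL (clampE_mem x)) (hnn hρ) (hnn hπ)
    (by rw [cubeMeasure_comp_clampE]; exact hρ.isProbabilityMeasure)
    (by rw [cubeMeasure_comp_clampE]; exact hπ.isProbabilityMeasure) ?_
  · rwa [cubeMeasure_comp_clampE, cubeMeasure_comp_clampE] at h
  · intro x hx t ht j
    have hpos := hL₂.trans_le (le_interpolation hρ hπ hx ht)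
    rw [transportField_apply hx ht]
    unfold transportCoord
    rw [spatial_snoc, Fin.snoc_last, Function.comp_apply, Function.comp_apply, clampE_eq hx,
      mul_assoc, inv_mul_cancel₀ hpos.ne', mul_one]

end Transport

/-! ### The main theorem -/

section Main

open scoped NNReal

variable {d k : ℕ} {L₁ L₂ : ℝ}

/-- A network close to the transport field, perturbed to point into the cube, has flows
transporting one density close to the other. -/
theorem flow_of_approx {ρ π : EuclideanSpace ℝ (Fin d) → ℝ} (hρ : IsCubeDensity k L₁ L₂ ρ)
    (hπ : IsCubeDensity k L₁ L₂ π) (hL : 0 ≤ L₁) (hL₂ : 0 < L₂) {K B : ℝ≥0}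
    (hF : IsLipField (transportField ρ π) K B) {ε : ℝ} (hε : 0 < ε) {W : ℕ}
    (net : ReLUSqNet (d + 1) d W) (hnet : ∀ z ∈ Icc (0 : Fin (d + 1) → ℝ) 1, ∀ j,
      |net.eval z j - (transportCoord ρ π j z + ε * (1 / 2 - z j.castSucc))| ≤ ε / 4) :
    (∃ X, IsFlowOn (toVelocity net.eval) (unitCube d) X) ∧
    ∀ X, IsFlowOn (toVelocity net.eval) (unitCube d) X →
      AEMeasurable (fun x => X x 1) (cubeMeasure π) ∧
      ∀ p : ℝ≥0∞, wasserstein p (cubeMeasure ρ) ((cubeMeasure π).map (fun x => X x 1)) ≤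
        ENNReal.ofReal (d * Real.exp (K + 1) * ε) := by
  obtain ⟨Kg, Bg, hKg, hBg⟩ := net.exists_bounds
  let G := toVelocity net.eval
  let H := toVelocity fun z : Fin (d + 1) → ℝ => net.eval (clampPi z)
  have hH : IsLipField H (d * Kg) (d * Bg) := isLipField_toVelocity_clampPi hKg hBg
  have hGH : ∀ x ∈ unitCube d, ∀ t ∈ Icc (0 : ℝ) 1, G x t = H x t := by
    intro x hx t ht
    simp only [G, H, toVelocity]
    rw [clampPi_eq (snoc_mem hx ht)]
  -- On the face the transport field has no normal component, the perturbation contributes ε/2 and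
  -- the approximation error takes away at most ε/4.
  have hlow : ∀ x ∈ unitCube d, ∀ t ∈ Icc (0 : ℝ) 1, ∀ j, x j = 0 → 0 < G x t j := by
    intro x hx t ht j hj
    have h := hnet _ (snoc_mem hx ht) j
    rw [transportCoord_eq_zero hρ hπ hL j (.inl (by simpa using hj)), Fin.snoc_castSucc, hj] at h
    have := (abs_le.1 h).1
    change 0 < net.eval _ j
    linarith
  have hhigh : ∀ x ∈ unitCube d, ∀ t ∈ Icc (0 : ℝ) 1, ∀ j, x j = 1 → G x t j < 0 := by
    intro x hx t ht j hj
    have h := hnet _ (snoc_mem hx ht) j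
    rw [transportCoord_eq_zero hρ hπ hL j (.inr (by simpa using hj)), Fin.snoc_castSucc, hj] at h
    have := (abs_le.1 h).2
    change net.eval _ j < 0
    linarith
  -- In each coordinate the deviation is at most ε/2 from the perturbation plus ε/4 from the
  -- approximation.
  have hclose : ∀ x ∈ unitCube d, ∀ t ∈ Icc (0 : ℝ) 1, ‖G x t - transportField ρ π x t‖ ≤ d * ε := by
    intro x hx t ht
    refine norm_toLp_sub_le fun j => ?_
    beta_reduce
    rw [clampPi_eq (snoc_mem hx ht)]
    have h := abs_le.1 (hnet _ (snoc_mem hx ht) j)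
    rw [Fin.snoc_castSucc] at h
    have h0 := mul_nonneg hε.le (hx j).1
    have h1 := mul_le_mul_of_nonneg_left (hx j).2 hε.le
    rw [abs_le]
    constructor <;> linarith [h.1, h.2]
  -- The flow of the network composed with the projection to the cube is globally defined and
  -- Lipschitz in x. Its curves from the cube stay there, so they are also curves of the network
  -- itself.
  choose Y hY0 hY using fun x => hH.exists_curve (t₀ := 0) (by simp) x
  have hYQ : ∀ x ∈ unitCube d, ∀ t ∈ Icc (0 : ℝ) 1, Y x t ∈ unitCube d := fun x hx t ht =>
    (hY x).mem_unitCube (by rwa [hY0])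
      (fun x hx t ht j hj => by rw [← hGH x hx t ht]; exact hlow x hx t ht j hj)
      (fun x hx t ht j hj => by rw [← hGH x hx t ht]; exact hhigh x hx t ht j hj) ht
  have hYcont : Continuous fun x => Y x 1 := by
    have : LipschitzWith (Real.toNNReal (Real.exp (d * Kg))) fun x => Y x 1 := by
      refine LipschitzWith.of_dist_le_mul fun x y => ?_
      have h := IsCurve.dist_le hH (hY x) (hY y) le_rfl zero_le_one le_rfl
      rw [hY0, hY0, sub_zero, mul_one] at h
      rw [Real.coe_toNNReal _ (Real.exp_pos _).le, mul_comm]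
      exact_mod_cast h
    exact this.continuous
  refine ⟨⟨Y, fun x hx => ⟨hY0 x, (hY x).congr fun t ht => (hGH _ (hYQ x hx t ht) t ht).symm⟩⟩,
    fun X hX => ?_⟩
  have hXc : ∀ x ∈ unitCube d, IsCurve G (X x) := fun x hx => (hX x hx).2
  have hXQ : ∀ x ∈ unitCube d, ∀ t ∈ Icc (0 : ℝ) 1, X x t ∈ unitCube d := fun x hx t ht =>
    (hXc x hx).mem_unitCube (by rwa [(hX x hx).1]) hlow hhigh ht
  -- Any flow of the network stays in the cube as well, hence solves the projected equation and
  -- coincides there with `Y` at time 1. Off the cube `X` is arbitrary, but that set is null.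
  have hXY : ∀ x ∈ unitCube d, X x 1 = Y x 1 := by
    intro x hx
    have h := IsCurve.dist_le hH ((hXc x hx).congr fun t ht => hGH _ (hXQ x hx t ht) t ht) (hY x)
      le_rfl zero_le_one le_rfl
    rw [(hX x hx).1, hY0, dist_self, zero_mul] at h
    exact dist_le_zero.1 h
  have hXm : AEMeasurable (fun x => X x 1) (cubeMeasure π) := by
    refine hYcont.measurable.aemeasurable.congr ?_
    filter_upwards [ae_cubeMeasure_mem π] with x hx using (hXY x hx).symm
  refine ⟨hXm, fun p => ?_⟩
  obtain ⟨Z, hZ, hZc, hZρ⟩ := exists_transport hρ hπ hL hL₂ hF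
  have := hπ.isProbabilityMeasure
  rw [← hZρ]
  refine wasserstein_map_le hZc.measurable.aemeasurable hXm ?_ (by fun_prop) p
  filter_upwards [ae_cubeMeasure_mem π] with x hx
  have h := (hZ x).2.dist_le_of_approx hF (hXc x hx) (by rw [(hZ x).1, (hX x hx).1])
    (δ := d * ε) (by positivity) fun t ht => hclose _ (hXQ x hx t ht) t ht
  rw [dist_eq_norm] at h
  exact h.trans (le_of_eq (by ring))

/-- The error constraint dictates the N-th scale up to rounding; the 1 lost to rounding up is
absorbed because ε^(-1/k) ≥ 1. -/
theorem exists_nat_pow_ge {A ε : ℝ} (hA : 0 < A) (hε : 0 < ε) (hε1 : ε ≤ 1) (hk : 1 ≤ k) :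
    ∃ N : ℕ, 1 ≤ N ∧ A / N ^ k ≤ ε ∧ (N : ℝ) ≤ (A ^ (1 / (k : ℝ)) + 1) * ε ^ (-(1 / (k : ℝ))) := by
  have hk' : (k : ℝ) ≠ 0 := by positivity
  have hpos : 0 < (A / ε) ^ (1 / (k : ℝ)) := Real.rpow_pos_of_pos (div_pos hA hε) _
  refine ⟨⌈(A / ε) ^ (1 / (k : ℝ))⌉₊, Nat.one_le_ceil_iff.2 hpos, ?_, ?_⟩
  · have h1 : A / ε ≤ (⌈(A / ε) ^ (1 / (k : ℝ))⌉₊ : ℝ) ^ k := by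
      calc A / ε = ((A / ε) ^ (1 / (k : ℝ))) ^ k := by
            rw [← Real.rpow_natCast, ← Real.rpow_mul (div_pos hA hε).le, one_div_mul_cancel hk',
              Real.rpow_one]
        _ ≤ _ := by gcongr; exact Nat.le_ceil _
    have h2 : (0 : ℝ) < (⌈(A / ε) ^ (1 / (k : ℝ))⌉₊ : ℝ) ^ k := (div_pos hA hε).trans_le h1
    rw [div_le_iff₀ h2]
    rw [div_le_iff₀ hε] at h1
    linarith
  · have h1 := (Nat.ceil_lt_add_one hpos.le).le
    have h2 : (1 : ℝ) ≤ ε ^ (-(1 / (k : ℝ))) :=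
      Real.one_le_rpow_of_pos_of_le_one_of_nonpos hε hε1 (neg_nonpos.2 (by positivity))
    have h3 : (A / ε) ^ (1 / (k : ℝ)) = A ^ (1 / (k : ℝ)) * ε ^ (-(1 / (k : ℝ))) := by
      rw [Real.div_rpow hA.le hε.le, Real.rpow_neg hε.le, div_eq_mul_inv]
    linarith

end Main

theorem mainTheorem10 (d k : ℕ) (hd : 1 ≤ d) (hk : 1 ≤ k) :
    ∃ Cdk : ℝ, ∀ L₁ L₂ : ℝ, 1 < L₁ → 0 < L₂ →
      ∃ C' C : ℝ, ∀ ρ π : EuclideanSpace ℝ (Fin d) → ℝ,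
        IsCubeDensity k L₁ L₂ ρ → IsCubeDensity k L₁ L₂ π →
        ∀ ε : ℝ, 0 < ε → ε ≤ 1 →
          ∃ (L W S : ℕ) (B : ℝ), ∃ g ∈ reluSqClass (d + 1) d L W S B,
            (L : ℝ) ≤ Cdk ∧
            (W : ℝ) ≤ C' * ε ^ (-(((d : ℝ) + 1) / (k : ℝ))) ∧
            (S : ℝ) ≤ C' * ε ^ (-(((d : ℝ) + 1) / (k : ℝ))) ∧
            B ≤ C' * ε ^ (-(1 / (k : ℝ))) ∧
            (∃ X, IsFlowOn (toVelocity g) (unitCube d) X) ∧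
            ∀ X, IsFlowOn (toVelocity g) (unitCube d) X →
              AEMeasurable (fun x => X x 1) (cubeMeasure π) ∧
              ∀ p : ℝ≥0∞, 1 ≤ p →
                wasserstein p (cubeMeasure ρ) ((cubeMeasure π).map (fun x => X x 1)) ≤
                  ENNReal.ofReal (C * ε) := by
  -- Depth and size factor are fixed before the bound M on the local polynomials is known, so the
  -- depth does not depend on L₁ and L₂.
  obtain ⟨L, K, hnet⟩ := exists_net_approx (d + 1) d k (1 + k + k * (1 + k))
  refine ⟨L, fun L₁ L₂ hL₁ hL₂ => ?_⟩
  have hL : 0 ≤ L₁ := by linarith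
  obtain ⟨M, KF, BF, hbd⟩ := exists_transportCoord_bounds d hL hL₂ hk
  obtain ⟨C₁, hC₁, hnet⟩ := hnet M
  -- N will be at most H ε^(-1/k); the factor 4 brings the network error C₁ / N^k below ε/4.
  let H : ℝ := (4 * C₁) ^ (1 / (k : ℝ)) + 1
  have hH : 0 < H := by positivity
  -- In the first constant one summand serves width and sparsity, the other the size of the weights.
  -- The second is the Gronwall constant, with `d * KF` the Lipschitz constant of the transport
  -- field.
  refine ⟨K * H ^ (d + 1) + C₁ * H, d * Real.exp ((d * KF : NNReal) + 1),
    fun ρ π hρ hπ ε hε hε1 => ?_⟩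
  obtain ⟨hloc, hlip, hbound⟩ := hbd ρ π hρ hπ
  obtain ⟨N, hN1, hNε, hNH⟩ := exists_nat_pow_ge (k := k) (A := 4 * C₁) (by positivity) hε hε1 hk
  obtain ⟨W, net, hdepth, hW, hS, hB, happ⟩ := hnet N hN1 _ (hloc ε ⟨hε.le, hε1⟩)
  have hF : IsLipField (transportField ρ π) (d * KF) (d * BF) :=
    isLipField_toVelocity_clampPi (u := fun z j => transportCoord ρ π j z) hlip hbound
  have hflow := flow_of_approx hρ hπ hL hL₂ hF hε net fun z hz j => (happ z hz j).trans (by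
    have : 4 * C₁ / N ^ k = 4 * (C₁ / N ^ k) := mul_div_assoc _ _ _
    linarith)
  have hpow : (N : ℝ) ^ (d + 1) ≤ H ^ (d + 1) * ε ^ (-(((d : ℝ) + 1) / (k : ℝ))) := by
    calc (N : ℝ) ^ (d + 1) ≤ (H * ε ^ (-(1 / (k : ℝ)))) ^ (d + 1) := by gcongr
      _ = _ := by
        rw [mul_pow, ← Real.rpow_natCast (ε ^ _), ← Real.rpow_mul hε.le]
        congr 2
        push_cast
        ring
  have hsize : ∀ n : ℕ, n ≤ K * N ^ (d + 1) →
      (n : ℝ) ≤ (K * H ^ (d + 1) + C₁ * H) * ε ^ (-(((d : ℝ) + 1) / (k : ℝ))) := by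
    intro n hn
    calc (n : ℝ) ≤ K * (N : ℝ) ^ (d + 1) := by exact_mod_cast hn
      _ ≤ K * (H ^ (d + 1) * ε ^ (-(((d : ℝ) + 1) / (k : ℝ)))) := by gcongr
      _ = K * H ^ (d + 1) * ε ^ (-(((d : ℝ) + 1) / (k : ℝ))) := by ring
      _ ≤ _ := by gcongr; exact le_add_of_nonneg_right (by positivity)
  refine ⟨L, W, net.sparsity, C₁ * N, net.eval, ⟨net, hdepth, le_rfl, hB, rfl⟩, le_rfl, hsize W hW,
    hsize _ hS, ?_, hflow.1, fun X hX => ⟨(hflow.2 X hX).1, fun p _ => (hflow.2 X hX).2 p⟩⟩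
  calc C₁ * N ≤ C₁ * (H * ε ^ (-(1 / (k : ℝ)))) := by gcongr
    _ = C₁ * H * ε ^ (-(1 / (k : ℝ))) := by ring
    _ ≤ _ := by gcongr; exact le_add_of_nonneg_left (by positivity)
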